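/- Let $n,m\ge 1$ be integers and define on $\mathbb{R}^n$ the polyharmonic radial basis function $$\psi_{2m-n}(x)=\begin{cases}\|x\|^{2m-n} & \text{if } 2m-n<0 \text{ or } n \text{ is odd},\\ \|x\|^{2m-n}\ln\|x\| & \text{if } 2m-n\ge 0 \text{ and } n \text{ is even}.\end{cases}$$ There is a constant $\varrho\neq 0$, depending only on $n$ and $m$, such that $\varrho\,\psi_{2m-n}$ is locally integrable and a fundamental solution of the polyharmonic operator, $\Delta^m(\varrho\,\psi_{2m-n})=\delta$ on $\mathbb{R}^n$ in the sense of distributions, and such that the following holds. Let $\lambda_d\in\mathbb{R}\setminus\{0\}$ and let $p_g,p_d$ be probability densities on $\mathbb{R}^n$ with $\int_{\|y\|\ge 1}|\psi_{2m-n}(y)|\,p(y)\,dy<\infty$ for $p\in\{p_g,p_d\}$ (this is automatic for densities with bounded support). Let $\mathcal{X}\subseteq\mathbb{R}^n$ be an open convex set outside of which $p_g$ and $p_d$ vanish almost everywhere (for instance the interior of the convex hull of their supports, or $\mathbb{R}^n$). Consider the WGAN discriminator loss with the $m$-th order gradient penalty $$\mathcal{L}_D(D)=\mathbb{E}_{x\sim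 p_g}[D(x)]-\mathbb{E}_{x\sim p_d}[D(x)]+\lambda_d\int_{\mathcal{X}}\|\nabla^mD(x)\|_2^2\,dx,\qquad \|\nabla^m D\|_2^2=\sum_{|\alpha|=m}\frac{m!}{\alpha!}(\partial^\alpha D)^2,$$ over all $D$ in the Beppo-Levi space $\mathrm{BL}^{m,2}(\mathcal{X})$ (locally integrable functions whose weak derivatives of order $m$ lie in $L^2(\mathcal{X})$) for which both expectations exist. A minimizer of $\mathcal{L}_D$ over this class is called an optimal discriminator on $\mathcal{X}$. 1. Every optimal discriminator $D$ on $\mathcal{X}$ is a weak solution on $\mathcal{X}$ of $$\Delta^mD=\frac{(-1)^{m+1}}{2\lambda_d}\,(p_g-p_d).$$ On any open set, every weak solution that is $2m$ times continuously differentiable satisfies the equation at almost every point, and at every point where $p_g-p_d$ is continuous. 2. The convolution $(p_g-p_d)*(\varrho\,\psi_{2m-n})$ exists almost everywhere, and $$D_p^*=\frac{(-1)^{m+1}}{2\lambda_d}\,\big((p_g-p_d)*(\varrho\,\psi_{2m-n})\big)$$ is a weak solution of this equation on all of $\mathbb{R}^n$; so is $D_p^*+P$ for every polynomial $P$ of degree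 at most $m-1$. 3. The general solution on $\mathbb{R}^n$ is $D_p^*+P$ with $P$ a polynomial of degree at most $m-1$, in the following sense. If the equation has a weak solution in $\mathrm{BL}^{m,2}(\mathbb{R}^n)$, then its weak solutions in $\mathrm{BL}^{m,2}(\mathbb{R}^n)$ are, up to almost everywhere equality, exactly the functions $D_p^*+P$. If there is an optimal discriminator on $\mathcal{X}=\mathbb{R}^n$, then the optimal discriminators on $\mathbb{R}^n$ are, up to almost everywhere equality, exactly those functions $D_p^*+P$ whose expectations under $p_g$ and $p_d$ exist. Finally, on every $\mathcal{X}$ as above, if $D_0$ is an optimal discriminator on $\mathcal{X}$, then the optimal discriminators on $\mathcal{X}$ are exactly the functions that equal $D_0+P$ almost everywhere on $\mathcal{X}$, with $P$ a polynomial of degree at most $m-1$, and whose expectations under $p_g$ and $p_d$ exist. -/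

import Mathlib

open MeasureTheory Set

namespace PolyWGAN

noncomputable section

/-- Euclidean space `ℝⁿ`. -/
abbrev E (n : ℕ) : Type := EuclideanSpace ℝ (Fin n)

/-- The classical first partial derivative `∂f/∂xᵢ`. -/
def partialDeriv {n : ℕ} (i : Fin n) (f : E n → ℝ) : E n → ℝ :=
  fun x => fderiv ℝ f x (EuclideanSpace.single i 1)

/-- The classical partial derivative `∂^α f = ∂₁^{α₁} ⋯ ∂ₙ^{αₙ} f` for a multi-index `α`. -/
def iteratedPartial {n : ℕ} (α : Fin n → ℕ) (f : E n → ℝ) : E n → ℝ :=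
  (List.finRange n).foldr (fun i g => (partialDeriv i)^[α i] g) f

/-- The polyharmonic operator `Δ^m f = Δ(Δ^{m-1} f)`, with Mathlib's Laplacian. -/
def polyLaplacian {n : ℕ} (m : ℕ) (f : E n → ℝ) : E n → ℝ :=
  (fun g : E n → ℝ => (Laplacian.laplacian g : E n → ℝ))^[m] f

/-- Test functions on the open set `X`: smooth, with compact support contained in `X`. -/
structure IsTestFunction {n : ℕ} (X : Set (E n)) (η : E n → ℝ) : Prop where
  contDiff : ContDiff ℝ ((⊤ : ℕ∞) : WithTop ℕ∞) η
  hasCompactSupport : HasCompactSupport η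
  tsupport_subset : tsupport η ⊆ X

/-- `g` is a weak partial derivative `∂^α u` on the open set `X`. -/
structure HasWeakPartial {n : ℕ} (X : Set (E n)) (α : Fin n → ℕ) (u g : E n → ℝ) : Prop where
  locallyIntegrable : LocallyIntegrableOn g X
  integral_eq : ∀ η : E n → ℝ, IsTestFunction X η →
    ∫ x, u x * iteratedPartial α η x = (-1) ^ (∑ i, α i) * ∫ x, g x * η x

open Classical in
/-- A representative of the weak partial derivative `∂^α u` on `X` (unique almost everywhere
on `X`); `0` if there is none. -/
def weakPartial {n : ℕ} (X : Set (E n)) (α : Fin n → ℕ) (u : E n → ℝ) : E n → ℝ :=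
  if h : ∃ g, HasWeakPartial X α u g then h.choose else 0

/-- The Beppo-Levi space `BL^{m,2}(X)`: locally integrable functions on the open set `X` all of
whose weak partial derivatives of order `m` exist and are square integrable on `X`. -/
structure MemBeppoLevi {n : ℕ} (m : ℕ) (X : Set (E n)) (u : E n → ℝ) : Prop where
  locallyIntegrable : LocallyIntegrableOn u X
  exists_weakPartial : ∀ α : Fin n → ℕ, ∑ i, α i = m →
    ∃ g, HasWeakPartial X α u g ∧ MemLp g 2 (volume.restrict X)

/-- `‖∇^m u(x)‖² = ∑_{|α| = m} (m! / α!) (∂^α u(x))²`, with weak derivatives on `X`. -/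
def gradNormSq {n : ℕ} (m : ℕ) (X : Set (E n)) (u : E n → ℝ) (x : E n) : ℝ :=
  ∑ α ∈ Finset.piAntidiag (Finset.univ : Finset (Fin n)) m,
    ((m.factorial : ℝ) / (∏ i, ((α i).factorial : ℝ))) * (weakPartial X α u x) ^ 2

/-- `p` is a probability density on `ℝⁿ`. -/
structure IsDensity {n : ℕ} (p : E n → ℝ) : Prop where
  integrable : Integrable p
  nonneg : ∀ x, 0 ≤ p x
  integral_eq_one : ∫ x, p x = 1

/-- The discriminator loss
`E_{p_g}[D] - E_{p_d}[D] + lam * ∫_X ‖∇^m D‖²`. -/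
def discriminatorLoss {n : ℕ} (m : ℕ) (lam : ℝ) (pg pd : E n → ℝ) (X : Set (E n))
    (D : E n → ℝ) : ℝ :=
  (∫ x, D x * pg x) - (∫ x, D x * pd x) + lam * ∫ x in X, gradNormSq m X D x

/-- The discriminators over which the loss is minimized: the functions in `BL^{m,2}(X)` whose
expectations under `p_g` and `p_d` exist. -/
structure IsAdmissible {n : ℕ} (m : ℕ) (pg pd : E n → ℝ) (X : Set (E n))
    (D : E n → ℝ) : Prop where
  memBeppoLevi : MemBeppoLevi m X D
  integrable_pg : Integrable (fun x => D x * pg x)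
  integrable_pd : Integrable (fun x => D x * pd x)

/-- `D` is an optimal discriminator: it minimizes the loss among all admissible ones. -/
structure IsOptimal {n : ℕ} (m : ℕ) (lam : ℝ) (pg pd : E n → ℝ) (X : Set (E n))
    (D : E n → ℝ) : Prop where
  admissible : IsAdmissible m pg pd X D
  loss_le : ∀ D' : E n → ℝ, IsAdmissible m pg pd X D' →
    discriminatorLoss m lam pg pd X D ≤ discriminatorLoss m lam pg pd X D'

/-- An open convex set that carries both densities, such as the interior of the convex hull of
their supports, or `ℝⁿ`. -/
structure IsCarrier {n : ℕ} (pg pd : E n → ℝ) (X : Set (E n)) : Prop where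
  isOpen : IsOpen X
  convex : Convex ℝ X
  eq_zero : ∀ᵐ x, x ∉ X → pg x = 0 ∧ pd x = 0

/-- `D` is a weak (distributional) solution of `Δ^m D = rhs` on the open set `X`. -/
structure IsWeakSolution {n : ℕ} (m : ℕ) (X : Set (E n)) (D rhs : E n → ℝ) : Prop where
  locallyIntegrable : LocallyIntegrableOn D X
  integral_eq : ∀ η : E n → ℝ, IsTestFunction X η →
    ∫ x, D x * polyLaplacian m η x = ∫ x, rhs x * η x

/-- `Φ` is a fundamental solution of `Δ^m`: `Δ^m Φ = δ` on `ℝⁿ` as distributions. -/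
structure IsFundamentalSolution {n : ℕ} (m : ℕ) (Φ : E n → ℝ) : Prop where
  locallyIntegrable : LocallyIntegrable Φ
  integral_eq : ∀ η : E n → ℝ, IsTestFunction univ η →
    ∫ x, Φ x * polyLaplacian m η x = η 0

/-- The polyharmonic radial basis function `ψ_{2m-n}` on `ℝⁿ`. -/
def rbf (n m : ℕ) (x : E n) : ℝ :=
  if 2 * (m : ℤ) - n < 0 ∨ Odd n then ‖x‖ ^ (2 * (m : ℤ) - n)
  else ‖x‖ ^ (2 * (m : ℤ) - n) * Real.log ‖x‖

/-- The density `p` has a finite `ψ_{2m-n}`-moment at infinity (automatic if `2m < n` or if `p`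
has bounded support). -/
def HasRbfMoment {n : ℕ} (m : ℕ) (p : E n → ℝ) : Prop :=
  IntegrableOn (fun y => rbf n m y * p y) {y | 1 ≤ ‖y‖}

/-- The right-hand side `((-1)^{m+1} / (2 lam)) (p_g - p_d)` of the discriminator equation. -/
def pdeRhs {n : ℕ} (m : ℕ) (lam : ℝ) (pg pd : E n → ℝ) (x : E n) : ℝ :=
  (-1) ^ (m + 1) / (2 * lam) * (pg x - pd x)

/-- The function `((-1)^{m+1} / (2 lam)) ((p_g - p_d) * (ϱ ψ_{2m-n}))`. -/
def particularSolution {n : ℕ} (m : ℕ) (lam ϱ : ℝ) (pg pd : E n → ℝ) (x : E n) : ℝ :=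
  (-1) ^ (m + 1) / (2 * lam) *
    convolution (fun y => pg y - pd y) (fun y => ϱ * rbf n m y)
      (ContinuousLinearMap.mul ℝ ℝ) volume x

/-- The function on `ℝⁿ` defined by a polynomial in `n` variables. -/
def polyFun {n : ℕ} (P : MvPolynomial (Fin n) ℝ) (x : E n) : ℝ :=
  MvPolynomial.eval (fun i => x i) P

end

end PolyWGAN

open PolyWGAN

/-!
Along a line `t ↦ D + t h` of admissible discriminators the loss is a quadratic polynomial in `t`,
with quadratic coefficient `lam * ∫ ‖∇^m h‖²`. Its linear coefficient vanishes at a minimizer.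
For test functions `h = η` this is the weak form of the equation, because the multinomial theorem
`Δ^m = ∑_{|α| = m} (m! / α!) ∂^α ∂^α` (`polyLaplacian_eq_sum`) turns the Beppo-Levi inner product
with `η` into `± ∫ D Δ^m η` (`IsOptimal.isWeakSolution`). For the difference `h` of two minimizers
the quadratic coefficient vanishes as well, so `∇^m h = 0`, and on a convex set this makes `h` a
polynomial of degree less than `m`, by mollification and Taylor's formula
(`exists_polyFun_ae_eq`, `IsOptimal.isOptimal_iff`).

The fundamental solution is found by analytic continuation in the exponent
(`exists_isFundamentalSolution_rbf`). For `δ > 0` one has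
`Δ^m ‖x‖^{2m-n+δ} = c(δ) · δ ‖x‖^{δ-n}` with a polynomial `c`, and `δ ‖x‖^{δ-n}` tends to a multiple
of the point mass at the origin as `δ → 0⁺`. If `2m - n` is negative or odd, then `c(0) ≠ 0`.
Otherwise `c` has a simple zero at `0`, and comparing the terms of first order in `δ` brings in the
logarithm. Convolution with the fundamental solution is controlled by the bound
`∫_{‖x‖ ≤ R} |ψ(x - y)| dx ≤ C (1 + |ψ(y)| 1_{‖y‖ ≥ 1})` (`integral_closedBall_rbf_le`), so that the
moment hypothesis and Fubini's theorem give its existence almost everywhere, its local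
integrability, and the equation (`isWeakSolution_convolution`).

That there are no further solutions in the Beppo-Levi space is a Liouville theorem
(`IsWeakSolution.exists_polyFun`), proved without Fourier analysis. Since `ψ` is homogeneous up to a
logarithm, the truncated fundamental solution `χ(x / R) Φ(x)` satisfies
`Δ^m (χ(· / R) Φ) = δ - W_R`, where `W_R(x) = R^{-n} (Z(x / R) + log R · Y(x / R))` for two fixed
test functions `Z` and `Y` (`exists_scaled_parametrix`). If `D` is a solution with right-hand side `q`,
then `∫ D ∂^α η` is equal to `∫ q (χ(· / R) Φ * ∂^α η)` up to the pairing of `∂^α D ∈ L²` with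
`W_R * η`, whose `L²` norm is `O(R^{-n/2} log R)`. As `R → ∞`, the derivatives of order `m` of `D`
turn out to be those of `q * Φ`, and `D - q * Φ` is a polynomial of degree less than `m`.

A solution of class `C^{2m}` satisfies the equation pointwise, by integration by parts after
multiplication with a cutoff function.
-/

namespace PolyWGAN

open scoped ContDiff Topology Convolution
open Laplacian Filter

noncomputable section

variable {n : ℕ}

/-! ### Partial derivatives of smooth functions as commuting operators -/

theorem two_le_infty : (2 : WithTop ℕ∞) ≤ ∞ := WithTop.coe_le_coe.2 le_top

theorem contDiff_partialDeriv (i : Fin n) {f : E n → ℝ} {k l : WithTop ℕ∞}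
    (hf : ContDiff ℝ k f) (h : l + 1 ≤ k) : ContDiff ℝ l (partialDeriv i f) :=
  (hf.fderiv_right h).clm_apply contDiff_const

theorem smooth_partialDeriv (i : Fin n) {f : E n → ℝ} (hf : ContDiff ℝ ∞ f) :
    ContDiff ℝ ∞ (partialDeriv i f) :=
  contDiff_partialDeriv i hf (by simp)

theorem partialDeriv_comm (i j : Fin n) {f : E n → ℝ} (hf : ContDiff ℝ 2 f) :
    partialDeriv i (partialDeriv j f) = partialDeriv j (partialDeriv i f) := by
  have key : ∀ (a b : E n) (x : E n), fderiv ℝ (fun y => fderiv ℝ f y a) x b =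
      fderiv ℝ (fderiv ℝ f) x b a := by
    intro a b x
    have h1 : DifferentiableAt ℝ (fderiv ℝ f) x :=
      ((hf.fderiv_right (m := 1) (by norm_num)).differentiable (by norm_num)) x
    rw [fderiv_clm_apply h1 (differentiableAt_const _)]
    simp
  funext x
  have hs : IsSymmSndFDerivAt ℝ f x := hf.contDiffAt.isSymmSndFDerivAt (by simp)
  change fderiv ℝ (fun y => fderiv ℝ f y _) x _ = fderiv ℝ (fun y => fderiv ℝ f y _) x _
  rw [key, key]
  exact hs _ _

/-- Mathlib's coordinate-free Laplacian in the standard basis. -/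
theorem laplacian_eq_sum_partialDeriv {f : E n → ℝ} {x : E n} (hf : ContDiffAt ℝ 2 f x) :
    Laplacian.laplacian f x = ∑ i, partialDeriv i (partialDeriv i f) x := by
  rw [InnerProductSpace.laplacian_eq_iteratedFDeriv_orthonormalBasis f
    (EuclideanSpace.basisFun (Fin n) ℝ)]
  refine Finset.sum_congr rfl fun i _ => ?_
  rw [iteratedFDeriv_two_apply]
  have h1 : DifferentiableAt ℝ (fderiv ℝ f) x :=
    (hf.fderiv_right (m := 1) (by norm_num)).differentiableAt (by norm_num)
  change _ = fderiv ℝ (fun y => fderiv ℝ f y _) x _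
  rw [fderiv_clm_apply h1 (differentiableAt_const _)]
  simp

/-- The space of smooth functions on `ℝⁿ`. -/
def smoothFun (n : ℕ) : Submodule ℝ (E n → ℝ) where
  carrier := {f | ContDiff ℝ ∞ f}
  add_mem' hf hg := ContDiff.add (n := ∞) hf hg
  zero_mem' := (contDiff_const : ContDiff ℝ ∞ fun _ : E n => (0 : ℝ))
  smul_mem' c _ hf := ContDiff.const_smul (n := ∞) c hf

theorem contDiff_smoothFun (f : smoothFun n) : ContDiff ℝ ∞ (f : E n → ℝ) := f.2

/-- `∂/∂xᵢ` as a linear operator on smooth functions. -/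
def partialOp (i : Fin n) : Module.End ℝ (smoothFun n) where
  toFun f := ⟨partialDeriv i f, smooth_partialDeriv i f.2⟩
  map_add' f g := by
    ext x
    change fderiv ℝ ((f : E n → ℝ) + (g : E n → ℝ)) x _ = _
    rw [fderiv_add ((contDiff_smoothFun f).differentiable (by simp) x)
      ((contDiff_smoothFun g).differentiable (by simp) x)]
    rfl
  map_smul' c f := by
    ext x
    change fderiv ℝ (c • (f : E n → ℝ)) x _ = _
    rw [fderiv_const_smul ((contDiff_smoothFun f).differentiable (by simp) x)]
    rfl

theorem coe_partialOp (i : Fin n) (f : smoothFun n) :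
    (partialOp i f : E n → ℝ) = partialDeriv i f := rfl

theorem partialOp_commute (i j : Fin n) : Commute (partialOp i) (partialOp j) := by
  refine LinearMap.ext fun f => Subtype.ext ?_
  exact partialDeriv_comm i j ((contDiff_smoothFun f).of_le two_le_infty)

/-- `∂^α` as a linear operator on smooth functions. -/
def multiOp (α : Fin n → ℕ) : Module.End ℝ (smoothFun n) :=
  ((List.finRange n).map fun i => partialOp i ^ α i).prod

theorem coe_partialOp_pow (i : Fin n) (k : ℕ) (f : smoothFun n) :
    ((partialOp i ^ k) f : E n → ℝ) = (partialDeriv i)^[k] f := by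
  induction k generalizing f with
  | zero => rfl
  | succ k ih =>
    rw [pow_succ, Module.End.mul_apply, ih, Function.iterate_succ_apply, coe_partialOp]

theorem coe_multiOp (α : Fin n → ℕ) (f : smoothFun n) :
    (multiOp α f : E n → ℝ) = iteratedPartial α f := by
  unfold multiOp iteratedPartial
  induction List.finRange n with
  | nil => rfl
  | cons i l ih =>
    rw [List.map_cons, List.prod_cons, Module.End.mul_apply, coe_partialOp_pow, ih,
      List.foldr_cons]

theorem partialOp_pow_pairwise (α : Fin n → ℕ) :
    ((Finset.univ : Finset (Fin n)) : Set (Fin n)).Pairwise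
      (Function.onFun Commute fun i => partialOp i ^ α i) :=
  fun i _ j _ _ => (partialOp_commute i j).pow_pow _ _

theorem noncommProd_partialOp (α : Fin n → ℕ) :
    (Finset.univ : Finset (Fin n)).noncommProd (fun i => partialOp i ^ α i)
      (partialOp_pow_pairwise α) = multiOp α := by
  rw [multiOp, ← Finset.noncommProd_toFinset (List.finRange n) _ (fun i _ j _ _ =>
    (partialOp_commute i j).pow_pow _ _) (List.nodup_finRange n)]
  congr 1
  ext i
  simp

/-- The Laplacian as a linear operator on smooth functions. -/
def lapOp (n : ℕ) : Module.End ℝ (smoothFun n) := ∑ i, partialOp i * partialOp i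

theorem coe_lapOp (f : smoothFun n) : (lapOp n f : E n → ℝ) = Δ (f : E n → ℝ) := by
  funext x
  rw [laplacian_eq_sum_partialDeriv ((contDiff_smoothFun f).contDiffAt.of_le two_le_infty), lapOp,
    LinearMap.sum_apply, Submodule.coe_sum, Finset.sum_apply]
  rfl

theorem coe_lapOp_pow (m : ℕ) (f : smoothFun n) :
    ((lapOp n ^ m) f : E n → ℝ) = polyLaplacian m f := by
  unfold polyLaplacian
  induction m generalizing f with
  | zero => rfl
  | succ k ih =>
    rw [pow_succ, Module.End.mul_apply, ih, Function.iterate_succ_apply, coe_lapOp]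

/-- The weight `m! / α!` of the multi-index `α` in `‖∇^m u‖²`. -/
def multiCoeff (m : ℕ) (α : Fin n → ℕ) : ℝ :=
  (m.factorial : ℝ) / ∏ i, ((α i).factorial : ℝ)

theorem multiCoeff_pos (m : ℕ) (α : Fin n → ℕ) : 0 < multiCoeff m α := by
  unfold multiCoeff
  positivity

theorem mem_piAntidiag_univ {m : ℕ} {α : Fin n → ℕ} :
    α ∈ Finset.piAntidiag (Finset.univ : Finset (Fin n)) m ↔ ∑ i, α i = m := by
  simp

theorem natCast_multinomial {m : ℕ} {α : Fin n → ℕ} (h : ∑ i, α i = m) :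
    (Nat.multinomial Finset.univ α : ℝ) = multiCoeff m α := by
  have := Nat.multinomial_spec Finset.univ α
  rw [h] at this
  rw [multiCoeff, eq_div_iff (by positivity), mul_comm]
  exact_mod_cast this

/-- The multinomial theorem for the commuting operators `∂ᵢ²`. -/
theorem lapOp_pow (m : ℕ) : lapOp n ^ m =
    ∑ α ∈ Finset.piAntidiag (Finset.univ : Finset (Fin n)) m,
      multiCoeff m α • (multiOp α * multiOp α) := by
  have hc : ((Finset.univ : Finset (Fin n)) : Set (Fin n)).Pairwise
      (Function.onFun Commute fun i => partialOp i * partialOp i) := fun i _ j _ _ =>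
    ((partialOp_commute i j).mul_right (partialOp_commute i j)).mul_left
      ((partialOp_commute i j).mul_right (partialOp_commute i j))
  rw [lapOp, Finset.sum_pow_eq_sum_piAntidiag_of_commute _ _ hc]
  refine Finset.sum_congr rfl fun α hα => ?_
  rw [← natCast_multinomial (mem_piAntidiag_univ.1 hα), ← noncommProd_partialOp,
    ← Finset.noncommProd_mul_distrib _ _ _ _ (fun i _ j _ _ =>
      (partialOp_commute i j).pow_pow _ _), Nat.cast_smul_eq_nsmul, nsmul_eq_mul]
  congr 1
  refine Finset.noncommProd_congr rfl (fun i _ => ?_) _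
  simp only [Pi.mul_apply, ← pow_add]
  rw [← pow_two, ← pow_mul, two_mul]

/-- Powers of the directional derivative along `y`, by the multinomial theorem. -/
theorem dirOp_pow (y : Fin n → ℝ) (k : ℕ) : (∑ i, y i • partialOp i) ^ k =
    ∑ α ∈ Finset.piAntidiag (Finset.univ : Finset (Fin n)) k,
      (multiCoeff k α * ∏ i, y i ^ α i) • multiOp α := by
  have hc : ((Finset.univ : Finset (Fin n)) : Set (Fin n)).Pairwise
      (Function.onFun Commute fun i => y i • partialOp i) := fun i _ j _ _ =>
    ((partialOp_commute i j).smul_right _).smul_left _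
  rw [Finset.sum_pow_eq_sum_piAntidiag_of_commute _ _ hc]
  refine Finset.sum_congr rfl fun α hα => ?_
  rw [← natCast_multinomial (mem_piAntidiag_univ.1 hα), mul_smul, Nat.cast_smul_eq_nsmul,
    nsmul_eq_mul]
  congr 1
  have h2 : ∀ s : Finset (Fin n), ∀ (h1 : (s : Set (Fin n)).Pairwise
      (Function.onFun Commute fun i => (y i • partialOp i) ^ α i))
      (h2 : (s : Set (Fin n)).Pairwise (Function.onFun Commute fun i => partialOp i ^ α i)),
      s.noncommProd (fun i => (y i • partialOp i) ^ α i) h1 =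
        (∏ i ∈ s, y i ^ α i) • s.noncommProd (fun i => partialOp i ^ α i) h2 := by
    intro s
    induction s using Finset.cons_induction with
    | empty => intros; simp
    | cons a s ha ih =>
      intro h1 h2
      rw [Finset.noncommProd_cons, Finset.noncommProd_cons, Finset.prod_cons,
        ih (h1.mono (by simp)) (h2.mono (by simp)), smul_pow, smul_mul_smul_comm]
  rw [h2 _ _ (partialOp_pow_pairwise α), noncommProd_partialOp]

/-! ### Multi-index derivatives and the polyharmonic operator on smooth functions -/

theorem iteratedPartial_induction {Q : (E n → ℝ) → Prop}
    (hQ : ∀ i f, Q f → Q (partialDeriv i f)) (α : Fin n → ℕ) {f : E n → ℝ} (hf : Q f) :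
    Q (iteratedPartial α f) := by
  unfold iteratedPartial
  induction List.finRange n with
  | nil => exact hf
  | cons i l ih =>
    rw [List.foldr_cons]
    induction α i with
    | zero => exact ih
    | succ k ih' => rw [Function.iterate_succ_apply']; exact hQ _ _ ih'

theorem smooth_iteratedPartial (α : Fin n → ℕ) {f : E n → ℝ} (hf : ContDiff ℝ ∞ f) :
    ContDiff ℝ ∞ (iteratedPartial α f) :=
  iteratedPartial_induction (fun i _ h => smooth_partialDeriv i h) α hf

theorem smooth_polyLaplacian (m : ℕ) {f : E n → ℝ} (hf : ContDiff ℝ ∞ f) :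
    ContDiff ℝ ∞ (polyLaplacian m f) := by
  rw [← coe_lapOp_pow m ⟨f, hf⟩]
  exact Subtype.property _

theorem polyLaplacian_succ (m : ℕ) (f : E n → ℝ) :
    polyLaplacian (m + 1) f = polyLaplacian m (Δ f) := rfl

theorem polyLaplacian_succ' (m : ℕ) (f : E n → ℝ) :
    polyLaplacian (m + 1) f = Δ (polyLaplacian m f) :=
  Function.iterate_succ_apply' _ _ _

/-- `Δ^m = ∑_{|α| = m} (m! / α!) ∂^α ∂^α`, the multinomial theorem. -/
theorem polyLaplacian_eq_sum (m : ℕ) {f : E n → ℝ} (hf : ContDiff ℝ ∞ f) (x : E n) :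
    polyLaplacian m f x = ∑ α ∈ Finset.piAntidiag (Finset.univ : Finset (Fin n)) m,
      multiCoeff m α * iteratedPartial α (iteratedPartial α f) x := by
  rw [← coe_lapOp_pow m ⟨f, hf⟩, lapOp_pow, LinearMap.sum_apply, Submodule.coe_sum,
    Finset.sum_apply]
  refine Finset.sum_congr rfl fun α _ => ?_
  rw [LinearMap.smul_apply, Module.End.mul_apply, Submodule.coe_smul, coe_multiOp, coe_multiOp]
  rfl

theorem polyLaplacian_add (m : ℕ) {f g : E n → ℝ} (hf : ContDiff ℝ ∞ f)
    (hg : ContDiff ℝ ∞ g) :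
    polyLaplacian m (f + g) = polyLaplacian m f + polyLaplacian m g := by
  have := congrArg Subtype.val ((lapOp n ^ m).map_add ⟨f, hf⟩ ⟨g, hg⟩)
  simpa only [coe_lapOp_pow, Submodule.coe_add] using this

/-! ### Supports -/

theorem tsupport_partialDeriv_subset (i : Fin n) (f : E n → ℝ) :
    tsupport (partialDeriv i f) ⊆ tsupport f := by
  refine (closure_mono ?_).trans (tsupport_fderiv_subset ℝ (f := f))
  intro x hx h
  exact hx (by simp [partialDeriv, h])

theorem tsupport_iteratedPartial_subset (α : Fin n → ℕ) (f : E n → ℝ) :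
    tsupport (iteratedPartial α f) ⊆ tsupport f :=
  iteratedPartial_induction (Q := fun g => tsupport g ⊆ tsupport f)
    (fun i g h => (tsupport_partialDeriv_subset i g).trans h) α subset_rfl

theorem tsupport_laplacian_subset (f : E n → ℝ) : tsupport (Δ f) ⊆ tsupport f := by
  refine closure_minimal ?_ (isClosed_tsupport f)
  intro x hx
  by_contra h
  have h0 : f =ᶠ[nhds x] fun _ => 0 := notMem_tsupport_iff_eventuallyEq.1 h
  exact hx (by rw [(InnerProductSpace.laplacian_congr_nhds h0).self_of_nhds]; simp)

theorem tsupport_polyLaplacian_subset (m : ℕ) (f : E n → ℝ) :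
    tsupport (polyLaplacian m f) ⊆ tsupport f := by
  induction m with
  | zero => exact subset_rfl
  | succ k ih => rw [polyLaplacian_succ']; exact (tsupport_laplacian_subset _).trans ih

theorem polyLaplacian_congr_nhds (m : ℕ) {f g : E n → ℝ} {x : E n} (h : f =ᶠ[nhds x] g) :
    polyLaplacian m f =ᶠ[nhds x] polyLaplacian m g := by
  induction m with
  | zero => exact h
  | succ k ih =>
    rw [polyLaplacian_succ', polyLaplacian_succ']
    exact InnerProductSpace.laplacian_congr_nhds ih

theorem IsTestFunction.multiDeriv {X : Set (E n)} {η : E n → ℝ} (h : IsTestFunction X η)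
    (α : Fin n → ℕ) : IsTestFunction X (iteratedPartial α η) where
  contDiff := smooth_iteratedPartial α h.contDiff
  hasCompactSupport := h.hasCompactSupport.of_isClosed_subset (isClosed_tsupport _)
    (tsupport_iteratedPartial_subset α η)
  tsupport_subset := (tsupport_iteratedPartial_subset α η).trans h.tsupport_subset

theorem IsTestFunction.polyLap {X : Set (E n)} {η : E n → ℝ} (h : IsTestFunction X η)
    (m : ℕ) : IsTestFunction X (polyLaplacian m η) where
  contDiff := smooth_polyLaplacian m h.contDiff
  hasCompactSupport := h.hasCompactSupport.of_isClosed_subset (isClosed_tsupport _)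
    (tsupport_polyLaplacian_subset m η)
  tsupport_subset := (tsupport_polyLaplacian_subset m η).trans h.tsupport_subset

/-! ### Affine changes of variable -/

theorem partialDeriv_const_mul (i : Fin n) (f : E n → ℝ) (c : ℝ) :
    partialDeriv i (fun x => c * f x) = fun x => c * partialDeriv i f x := by
  funext x
  change fderiv ℝ (c • f) x _ = c * fderiv ℝ f x _
  rw [fderiv_const_smul_field]
  rfl

theorem iteratedPartial_const_mul (α : Fin n → ℕ) (f : E n → ℝ) (c : ℝ) :
    iteratedPartial α (fun x => c * f x) = fun x => c * iteratedPartial α f x := by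
  have h1 : ∀ (i : Fin n) (k : ℕ) (g : E n → ℝ),
      (partialDeriv i)^[k] (fun y => c * g y) = fun y => c * (partialDeriv i)^[k] g y := by
    intro i k
    induction k with
    | zero => intro g; rfl
    | succ k ih =>
      intro g
      rw [Function.iterate_succ_apply, Function.iterate_succ_apply, partialDeriv_const_mul, ih]
  unfold iteratedPartial
  induction List.finRange n with
  | nil => rfl
  | cons i l ih => rw [List.foldr_cons, ih, h1]; rfl

theorem partialDeriv_comp_affine (i : Fin n) (f : E n → ℝ) (a : E n) (c : ℝ) :
    partialDeriv i (fun y => f (a + c • y)) = fun y => c * partialDeriv i f (a + c • y) := by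
  funext y
  unfold partialDeriv
  have h := fderiv_comp_smul (𝕜 := ℝ) (f := fun z => f (a + z)) (x := y) c
  have h2 := fderiv_comp_add_left (𝕜 := ℝ) (f := f) (x := c • y) a
  change fderiv ℝ (fun y => (fun z => f (a + z)) (c • y)) y _ = _
  rw [h, h2]
  simp

theorem iteratedPartial_comp_affine (α : Fin n → ℕ) (f : E n → ℝ) (a : E n) (c : ℝ) :
    iteratedPartial α (fun y => f (a + c • y)) =
      fun y => c ^ (∑ i, α i) * iteratedPartial α f (a + c • y) := by
  have h1 : ∀ (i : Fin n) (k : ℕ) (d : ℝ) (g : E n → ℝ),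
      (partialDeriv i)^[k] (fun y => d * g (a + c • y)) =
        fun y => c ^ k * d * (partialDeriv i)^[k] g (a + c • y) := by
    intro i k
    induction k with
    | zero => intro d g; simp
    | succ k ih =>
      intro d g
      rw [Function.iterate_succ_apply, Function.iterate_succ_apply, partialDeriv_const_mul,
        partialDeriv_comp_affine]
      have := ih (d * c) (partialDeriv i g)
      simp only [← mul_assoc] at this ⊢
      rw [this]
      funext y
      ring
  unfold iteratedPartial
  rw [Fin.sum_univ_def]
  induction List.finRange n with
  | nil => simp
  | cons i l ih =>
    rw [List.foldr_cons, ih, h1, List.map_cons, List.sum_cons, pow_add]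
    rfl

theorem polyLaplacian_comp_affine (m : ℕ) {f : E n → ℝ} (hf : ContDiff ℝ ∞ f) (a : E n)
    (c : ℝ) : polyLaplacian m (fun y => f (a + c • y)) =
      fun y => c ^ (2 * m) * polyLaplacian m f (a + c • y) := by
  have hA : ContDiff ℝ ∞ (fun y : E n => a + c • y) := by fun_prop
  funext y
  have h0 : ContDiff ℝ ∞ (fun y => f (a + c • y)) := hf.comp hA
  rw [polyLaplacian_eq_sum m h0, polyLaplacian_eq_sum m hf, Finset.mul_sum]
  refine Finset.sum_congr rfl fun α hα => ?_
  have hα' := mem_piAntidiag_univ.1 hα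
  have h3 : iteratedPartial α (fun y => c ^ m * iteratedPartial α f (a + c • y)) y =
      c ^ m * (c ^ m * iteratedPartial α (iteratedPartial α f) (a + c • y)) := by
    have h4 := iteratedPartial_comp_affine α (iteratedPartial α f) a c
    rw [iteratedPartial_const_mul α (fun y => iteratedPartial α f (a + c • y))]
    change c ^ m * iteratedPartial α (fun y => iteratedPartial α f (a + c • y)) y = _
    rw [h4, hα']
  rw [iteratedPartial_comp_affine α f a c, hα', h3]
  ring

theorem IsTestFunction.comp_affine {η : E n → ℝ} (h : IsTestFunction univ η) (a : E n) {c : ℝ}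
    (hc : c ≠ 0) : IsTestFunction univ (fun y => η (a + c • y)) where
  contDiff := by
    have hA : ContDiff ℝ ∞ (fun y : E n => a + c • y) := by fun_prop
    exact h.contDiff.comp hA
  hasCompactSupport := h.hasCompactSupport.comp_homeomorph
    ((Homeomorph.smulOfNeZero c hc).trans (Homeomorph.addLeft a))
  tsupport_subset := subset_univ _

/-! ### Integration by parts -/

theorem integral_mul_partialDeriv (i : Fin n) {u η : E n → ℝ} (hu : ContDiff ℝ 1 u)
    (hη : ContDiff ℝ 1 η) (hc : HasCompactSupport η) :
    ∫ x, u x * partialDeriv i η x = -∫ x, partialDeriv i u x * η x := by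
  have cu := contDiff_partialDeriv (l := 0) i hu (by simp)
  have ce := contDiff_partialDeriv (l := 0) i hη (by simp)
  have hc' : HasCompactSupport (partialDeriv i η) :=
    hc.of_isClosed_subset (isClosed_tsupport _) (tsupport_partialDeriv_subset i η)
  refine integral_mul_fderiv_eq_neg_fderiv_mul_of_integrable ?_ ?_ ?_
    (fun x _ => hu.differentiable (by simp) x) (fun x _ => hη.differentiable (by simp) x)
  · exact (cu.continuous.mul hη.continuous).integrable_of_hasCompactSupport hc.mul_left
  · exact (hu.continuous.mul ce.continuous).integrable_of_hasCompactSupport hc'.mul_left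
  · exact (hu.continuous.mul hη.continuous).integrable_of_hasCompactSupport hc.mul_left

theorem contDiff_laplacian {u : E n → ℝ} {k : ℕ} (hu : ContDiff ℝ ((k + 2 : ℕ) : WithTop ℕ∞) u) :
    ContDiff ℝ (k : WithTop ℕ∞) (Δ u) := by
  have h2 : ContDiff ℝ 2 u := hu.of_le (by exact_mod_cast Nat.le_add_left 2 k)
  have : Δ u = fun x => ∑ i, partialDeriv i (partialDeriv i u) x :=
    funext fun x => laplacian_eq_sum_partialDeriv h2.contDiffAt
  rw [this]
  refine ContDiff.sum fun i _ => contDiff_partialDeriv (k := ((k + 1 : ℕ) : WithTop ℕ∞)) i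
    (contDiff_partialDeriv i hu ?_) ?_ <;> norm_cast

theorem integral_mul_laplacian {u η : E n → ℝ} (hu : ContDiff ℝ 2 u) (hη : ContDiff ℝ 2 η)
    (hc : HasCompactSupport η) : ∫ x, u x * Δ η x = ∫ x, Δ u x * η x := by
  have e1 : ∀ x, u x * Δ η x = ∑ i, u x * partialDeriv i (partialDeriv i η) x := fun x => by
    rw [laplacian_eq_sum_partialDeriv hη.contDiffAt, Finset.mul_sum]
  have e2 : ∀ x, Δ u x * η x = ∑ i, partialDeriv i (partialDeriv i u) x * η x := fun x => by
    rw [laplacian_eq_sum_partialDeriv hu.contDiffAt, Finset.sum_mul]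
  simp_rw [e1, e2]
  have hc' : ∀ i, HasCompactSupport (partialDeriv i η) := fun i =>
    hc.of_isClosed_subset (isClosed_tsupport _) (tsupport_partialDeriv_subset i η)
  have hc'' : ∀ i, HasCompactSupport (partialDeriv i (partialDeriv i η)) := fun i =>
    (hc' i).of_isClosed_subset (isClosed_tsupport _) (tsupport_partialDeriv_subset i _)
  have u1 : ∀ i, ContDiff ℝ 1 (partialDeriv i u) := fun i =>
    contDiff_partialDeriv i hu (by norm_num)
  have h1 : ∀ i, ContDiff ℝ 1 (partialDeriv i η) := fun i =>
    contDiff_partialDeriv i hη (by norm_num)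
  have u2 : ∀ i, Continuous (partialDeriv i (partialDeriv i u)) := fun i =>
    (contDiff_partialDeriv (l := 0) i (u1 i) (by simp)).continuous
  have h2 : ∀ i, Continuous (partialDeriv i (partialDeriv i η)) := fun i =>
    (contDiff_partialDeriv (l := 0) i (h1 i) (by simp)).continuous
  have i1 : ∀ i, Integrable fun x => u x * partialDeriv i (partialDeriv i η) x := fun i =>
    (hu.continuous.mul (h2 i)).integrable_of_hasCompactSupport (hc'' i).mul_left
  have i2 : ∀ i, Integrable fun x => partialDeriv i (partialDeriv i u) x * η x := fun i =>
    ((u2 i).mul hη.continuous).integrable_of_hasCompactSupport hc.mul_left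
  rw [integral_finsetSum _ fun i _ => i1 i, integral_finsetSum _ fun i _ => i2 i]
  refine Finset.sum_congr rfl fun i _ => ?_
  rw [integral_mul_partialDeriv i (hu.of_le one_le_two) (h1 i) (hc' i),
    integral_mul_partialDeriv i (u1 i) (hη.of_le one_le_two) hc, neg_neg]

theorem integral_mul_polyLaplacian (m : ℕ) {u η : E n → ℝ}
    (hu : ContDiff ℝ ((2 * m : ℕ) : WithTop ℕ∞) u) (hη : ContDiff ℝ ∞ η)
    (hc : HasCompactSupport η) :
    ∫ x, u x * polyLaplacian m η x = ∫ x, polyLaplacian m u x * η x := by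
  induction m generalizing u with
  | zero => rfl
  | succ k ih =>
    have hk := hc.of_isClosed_subset (isClosed_tsupport _) (tsupport_polyLaplacian_subset k η)
    rw [polyLaplacian_succ', integral_mul_laplacian (hu.of_le (by norm_cast; omega))
      ((smooth_polyLaplacian k hη).of_le two_le_infty) hk,
      ih (contDiff_laplacian (k := 2 * k) hu)]
    rfl

theorem integral_mul_iteratedPartial (α : Fin n → ℕ) {u η : E n → ℝ} (hu : ContDiff ℝ ∞ u)
    (hη : ContDiff ℝ ∞ η) (hc : HasCompactSupport η) :
    ∫ x, u x * iteratedPartial α η x =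
      (-1) ^ (∑ i, α i) * ∫ x, iteratedPartial α u x * η x := by
  -- `A T c` says that `c • T` is the formal adjoint of `T`
  let A : Module.End ℝ (smoothFun n) → ℝ → Prop := fun T c => ∀ f g : smoothFun n,
    HasCompactSupport (g : E n → ℝ) → HasCompactSupport (T g : E n → ℝ) ∧
      ∫ x, (f : E n → ℝ) x * (T g : E n → ℝ) x = c * ∫ x, (T f : E n → ℝ) x * (g : E n → ℝ) x
  have one : A 1 1 := fun f g hg => ⟨hg, by simp⟩
  have mul : ∀ S T c d, Commute S T → A S c → A T d → A (S * T) (c * d) := by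
    intro S T c d hST hS hT f g hg
    obtain ⟨h1, h2⟩ := hT (S f) g hg
    obtain ⟨h3, h4⟩ := hS f (T g) h1
    refine ⟨h3, ?_⟩
    rw [Module.End.mul_apply, h4, h2, mul_assoc, hST.eq]
    rfl
  have basic : ∀ i, A (partialOp i) (-1) := by
    intro i f g hg
    refine ⟨hg.of_isClosed_subset (isClosed_tsupport _) (tsupport_partialDeriv_subset i _), ?_⟩
    rw [neg_one_mul]
    exact integral_mul_partialDeriv i ((contDiff_smoothFun f).of_le (by simp))
      ((contDiff_smoothFun g).of_le (by simp)) hg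
  have pow : ∀ i k, A (partialOp i ^ k) ((-1) ^ k) := by
    intro i k
    induction k with
    | zero => exact one
    | succ k ih => rw [pow_succ, pow_succ]; exact mul _ _ _ _ (Commute.pow_self _ _) ih (basic i)
  have main : A (multiOp α) ((-1) ^ (∑ i, α i)) := by
    rw [multiOp, Fin.sum_univ_def]
    induction List.finRange n with
    | nil => exact one
    | cons i l ih =>
      rw [List.map_cons, List.prod_cons, List.map_cons, List.sum_cons, pow_add]
      refine mul _ _ _ _ (Commute.list_prod_right _ _ fun x hx => ?_) (pow i _) ih
      obtain ⟨j, _, rfl⟩ := List.mem_map.1 hx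
      exact (partialOp_commute i j).pow_pow _ _
  have := (main ⟨u, hu⟩ ⟨η, hη⟩ hc).2
  simpa only [coe_multiOp] using this

/-! ### Polynomials -/

theorem smooth_polyFun (P : MvPolynomial (Fin n) ℝ) : ContDiff ℝ ∞ (polyFun P) := by
  unfold polyFun
  induction P using MvPolynomial.induction_on with
  | C a => simpa using contDiff_const
  | add p q hp hq => simpa using hp.add hq
  | mul_X p i hp =>
    simp only [map_mul, MvPolynomial.eval_X]
    exact hp.mul (by fun_prop)

theorem polyFun_add (P Q : MvPolynomial (Fin n) ℝ) : polyFun (P + Q) = polyFun P + polyFun Q := by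
  funext x
  simp [polyFun]

theorem polyFun_sub (P Q : MvPolynomial (Fin n) ℝ) : polyFun (P - Q) = polyFun P - polyFun Q := by
  funext x
  simp [polyFun]

theorem partialDeriv_polyFun (i : Fin n) (P : MvPolynomial (Fin n) ℝ) :
    partialDeriv i (polyFun P) = polyFun (MvPolynomial.pderiv i P) := by
  have hd : ∀ P : MvPolynomial (Fin n) ℝ, Differentiable ℝ (polyFun P) := fun P =>
    (smooth_polyFun P).differentiable (by simp)
  induction P using MvPolynomial.induction_on with
  | C a =>
    funext x
    have : polyFun (MvPolynomial.C a : MvPolynomial (Fin n) ℝ) = fun _ => a := by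
      funext y; simp [polyFun]
    simp [partialDeriv, this, polyFun]
  | add p q hp hq =>
    rw [polyFun_add, map_add, polyFun_add, ← hp, ← hq]
    funext x
    simp only [partialDeriv, Pi.add_apply]
    rw [fderiv_add (hd p x) (hd q x)]
    rfl
  | mul_X p j hp =>
    funext x
    have e : polyFun (p * MvPolynomial.X j) = fun y => polyFun p y * y j := by
      funext y; simp [polyFun]
    have hj : HasFDerivAt (fun y : E n => y j) (EuclideanSpace.proj j : E n →L[ℝ] ℝ) x :=
      (EuclideanSpace.proj j : E n →L[ℝ] ℝ).hasFDerivAt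
    have h1 := congrFun hp x
    simp only [partialDeriv] at h1 ⊢
    have h2 : HasFDerivAt (fun y => polyFun p y * y j) _ x := (hd p x).hasFDerivAt.mul hj
    rw [e, h2.fderiv]
    have h3 : (EuclideanSpace.proj j : E n →L[ℝ] ℝ) (EuclideanSpace.single i 1) =
        if j = i then 1 else 0 := by
      simp
    simp only [add_apply, smul_apply, smul_eq_mul, h1, h3, polyFun, Derivation.leibniz,
      MvPolynomial.pderiv_X, map_add, map_mul, MvPolynomial.eval_X]
    by_cases hij : j = i
    · subst hij; simp
    · simp [hij]

/-- Differentiation lowers the degree of each monomial by one. -/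
theorem degree_of_mem_support_pderiv {P : MvPolynomial (Fin n) ℝ} {i : Fin n} {t : Fin n →₀ ℕ}
    (ht : t ∈ (MvPolynomial.pderiv i P).support) : ∃ s ∈ P.support, s.degree = t.degree + 1 := by
  rw [P.as_sum, map_sum] at ht
  obtain ⟨s, hs, hst⟩ := Finset.mem_biUnion.1 (MvPolynomial.support_sum ht)
  refine ⟨s, hs, ?_⟩
  rw [MvPolynomial.pderiv_monomial] at hst
  have h0 : s i ≠ 0 := by
    rintro h
    simp [h] at hst
  have h1 := Finset.mem_singleton.1 (MvPolynomial.support_monomial_subset hst)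
  have h2 : s = t + Finsupp.single i 1 := by
    rw [h1, tsub_add_cancel_of_le]
    simpa using Nat.one_le_iff_ne_zero.2 h0
  rw [h2, map_add]
  simp

/-- Induction along the first derivatives that make up `∂^α`, counting their number. -/
theorem iteratedPartial_induction_order {Q : ℕ → (E n → ℝ) → Prop}
    (hQ : ∀ i k f, Q k f → Q (k + 1) (partialDeriv i f)) (α : Fin n → ℕ) {f : E n → ℝ}
    (hf : Q 0 f) : Q (∑ i, α i) (iteratedPartial α f) := by
  have h1 : ∀ (i : Fin n) (k j : ℕ) (g : E n → ℝ), Q j g → Q (k + j) ((partialDeriv i)^[k] g) := by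
    intro i k j g hg
    induction k with
    | zero => simpa using hg
    | succ k ih =>
      rw [Function.iterate_succ_apply', show k + 1 + j = k + j + 1 by ring]
      exact hQ _ _ _ ih
  unfold iteratedPartial
  rw [Fin.sum_univ_def]
  induction List.finRange n with
  | nil => exact hf
  | cons i l ih => exact h1 i _ _ _ ih

theorem iteratedPartial_polyFun_eq_zero {P : MvPolynomial (Fin n) ℝ} {α : Fin n → ℕ}
    (h : P.totalDegree < ∑ i, α i) : iteratedPartial α (polyFun P) = 0 := by
  obtain ⟨Q, hQ, hd⟩ := iteratedPartial_induction_order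
    (Q := fun k f => ∃ Q : MvPolynomial (Fin n) ℝ, f = polyFun Q ∧
      ∀ s ∈ Q.support, s.degree + k ≤ P.totalDegree)
    (by
      rintro i k _ ⟨Q, rfl, hQ⟩
      refine ⟨_, partialDeriv_polyFun i Q, fun t ht => ?_⟩
      obtain ⟨s, hs, hst⟩ := degree_of_mem_support_pderiv ht
      have := hQ s hs
      omega) α ⟨P, rfl, fun s hs => MvPolynomial.le_totalDegree hs⟩
  have hQ0 : Q = 0 := by
    rw [← MvPolynomial.support_eq_empty, Finset.eq_empty_iff_forall_notMem]
    intro s hs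
    have := hd s hs
    omega
  rw [hQ, hQ0]
  funext x
  simp [polyFun]

/-- The `k`-th derivative along the diagonal as the `k`-th power of a directional derivative. -/
theorem iteratedFDeriv_const_eq (f : smoothFun n) (k : ℕ) (x y : E n) :
    iteratedFDeriv ℝ k (f : E n → ℝ) x (fun _ => y) =
      (((∑ i, y i • partialOp i) ^ k) f : E n → ℝ) x := by
  induction k generalizing x with
  | zero => simp
  | succ k ih =>
    have hd : DifferentiableAt ℝ (iteratedFDeriv ℝ k (f : E n → ℝ)) x :=
      (contDiff_smoothFun f).differentiable_iteratedFDeriv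
        (by exact_mod_cast ENat.natCast_lt_top k) x
    rw [hd.iteratedFDeriv_succ_apply_left', pow_succ', Module.End.mul_apply]
    simp only [Fin.tail_def, ih]
    generalize ((∑ i, y i • partialOp i) ^ k) f = g
    rw [LinearMap.sum_apply, Submodule.coe_sum, Finset.sum_apply]
    have hy : y = ∑ i, y i • EuclideanSpace.single i (1 : ℝ) := by
      ext j
      simp [Finset.sum_apply, Pi.single_apply]
    conv_lhs => rw [hy]
    simp only [map_sum, map_smul]
    rfl

/-- The polynomial `(y - x₀)^α` in the variable `y`. -/
def shiftedMonomial (x₀ : E n) (α : Fin n → ℕ) : MvPolynomial (Fin n) ℝ :=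
  ∏ i, (MvPolynomial.X i - MvPolynomial.C (x₀ i)) ^ α i

theorem totalDegree_shiftedMonomial_le (x₀ : E n) (α : Fin n → ℕ) :
    (shiftedMonomial x₀ α).totalDegree ≤ ∑ i, α i := by
  refine (MvPolynomial.totalDegree_finsetProd _ _).trans (Finset.sum_le_sum fun i _ => ?_)
  refine (MvPolynomial.totalDegree_pow _ _).trans ?_
  have : (MvPolynomial.X i - MvPolynomial.C (x₀ i) : MvPolynomial (Fin n) ℝ).totalDegree ≤ 1 :=
    (MvPolynomial.totalDegree_sub_C_le _ _).trans (MvPolynomial.totalDegree_X i).le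
  nlinarith

theorem polyFun_shiftedMonomial (x₀ : E n) (α : Fin n → ℕ) (x : E n) :
    polyFun (shiftedMonomial x₀ α) x = ∏ i, (x i - x₀ i) ^ α i := by
  simp [polyFun, shiftedMonomial, map_prod]

/-- By Taylor's formula, a smooth function whose derivatives of order `m` all vanish on a convex
set agrees there with a polynomial of degree less than `m`. -/
theorem exists_polyFun_of_iteratedPartial_eq_zero {m : ℕ} (hm : 1 ≤ m) {f : E n → ℝ}
    (hf : ContDiff ℝ ∞ f) {U : Set (E n)} (hU : Convex ℝ U)
    (h : ∀ α : Fin n → ℕ, ∑ i, α i = m → ∀ x ∈ U, iteratedPartial α f x = 0) :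
    ∃ P : MvPolynomial (Fin n) ℝ, P.totalDegree ≤ m - 1 ∧ ∀ x ∈ U, f x = polyFun P x := by
  rcases U.eq_empty_or_nonempty with rfl | ⟨x₀, hx₀⟩
  · exact ⟨0, by simp, by simp⟩
  obtain ⟨m, rfl⟩ : ∃ l, m = l + 1 := ⟨m - 1, by omega⟩
  have key : ∀ (k : ℕ) (x y : E n), iteratedFDeriv ℝ k f x (fun _ => y) =
      ∑ α ∈ Finset.piAntidiag (Finset.univ : Finset (Fin n)) k,
        (multiCoeff k α * ∏ i, y i ^ α i) * iteratedPartial α f x := by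
    intro k x y
    rw [iteratedFDeriv_const_eq ⟨f, hf⟩, dirOp_pow, LinearMap.sum_apply, Submodule.coe_sum,
      Finset.sum_apply]
    refine Finset.sum_congr rfl fun α _ => ?_
    rw [LinearMap.smul_apply, Submodule.coe_smul, coe_multiOp]
    rfl
  refine ⟨∑ k ∈ Finset.range (m + 1),
    ∑ α ∈ Finset.piAntidiag (Finset.univ : Finset (Fin n)) k,
      MvPolynomial.C ((k.factorial : ℝ)⁻¹ * (multiCoeff k α * iteratedPartial α f x₀)) *
        shiftedMonomial x₀ α, ?_, fun x hx => ?_⟩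
  · refine MvPolynomial.totalDegree_finsetSum_le fun k hk =>
      MvPolynomial.totalDegree_finsetSum_le fun α hα => ?_
    have h1 := Finset.mem_range.1 hk
    have h2 := mem_piAntidiag_univ.1 hα
    refine (MvPolynomial.totalDegree_mul _ _).trans ?_
    rw [MvPolynomial.totalDegree_C, zero_add]
    exact (totalDegree_shiftedMonomial_le x₀ α).trans (by omega)
  · have hT := map_add_eq_sum_add_integral_iteratedFDeriv (f := f) (x := x₀) (y := x - x₀) (n := m)
      fun t _ => hf.contDiffAt.of_le (by exact_mod_cast le_top)
    have hz : ∀ t ∈ Set.uIcc (0 : ℝ) 1, (1 - t) ^ m •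
        iteratedFDeriv ℝ (m + 1) f (x₀ + t • (x - x₀)) (fun _ => x - x₀) = 0 := by
      intro t ht
      rw [Set.uIcc_of_le zero_le_one] at ht
      rw [key, Finset.sum_eq_zero, smul_zero]
      intro α hα
      rw [h α (mem_piAntidiag_univ.1 hα) _ (hU.add_smul_sub_mem hx₀ hx ht), mul_zero]
    rw [intervalIntegral.integral_congr hz, intervalIntegral.integral_zero, smul_zero, add_zero,
      add_sub_cancel] at hT
    rw [hT]
    unfold polyFun
    simp only [map_sum, map_mul, MvPolynomial.eval_C]
    refine Finset.sum_congr rfl fun k _ => ?_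
    rw [key, smul_eq_mul, Finset.mul_sum]
    refine Finset.sum_congr rfl fun α _ => ?_
    have := polyFun_shiftedMonomial x₀ α x
    unfold polyFun at this
    rw [this]
    simp only [PiLp.sub_apply]
    ring

/-! ### Weak derivatives -/

theorem integrable_mul_of_tsupport_subset {X : Set (E n)} {u η : E n → ℝ}
    (hu : LocallyIntegrableOn u X) (hη : Continuous η) (hc : HasCompactSupport η)
    (hX : tsupport η ⊆ X) : Integrable fun x => u x * η x := by
  have hK : IntegrableOn u (tsupport η) := hu.integrableOn_compact_subset hX hc
  have h1 : Integrable ((tsupport η).indicator u) :=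
    (integrable_indicator_iff (isClosed_tsupport η).measurableSet).2 hK
  obtain ⟨C, hC⟩ := hη.bounded_above_of_compact_support hc
  refine (h1.mul_bdd (c := C) hη.aestronglyMeasurable (ae_of_all _ hC)).congr
    (ae_of_all _ fun x => ?_)
  by_cases hx : x ∈ tsupport η
  · simp [hx]
  · simp [image_eq_zero_of_notMem_tsupport hx]

theorem IsTestFunction.integrable_mul {X : Set (E n)} {u η : E n → ℝ} (hη : IsTestFunction X η)
    (hu : LocallyIntegrableOn u X) : Integrable fun x => u x * η x :=
  integrable_mul_of_tsupport_subset hu hη.contDiff.continuous hη.hasCompactSupport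
    hη.tsupport_subset

theorem IsTestFunction.eq_zero {X : Set (E n)} {η : E n → ℝ} (hη : IsTestFunction X η)
    {x : E n} (hx : x ∉ X) : η x = 0 :=
  image_eq_zero_of_notMem_tsupport fun h => hx (hη.tsupport_subset h)

theorem IsTestFunction.integral_mul_congr {X : Set (E n)} {u v η : E n → ℝ}
    (hη : IsTestFunction X η) (h : ∀ᵐ x, x ∈ X → u x = v x) :
    ∫ x, u x * η x = ∫ x, v x * η x := by
  refine integral_congr_ae ?_
  filter_upwards [h] with x hx
  by_cases hxX : x ∈ X
  · rw [hx hxX]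
  · rw [hη.eq_zero hxX, mul_zero, mul_zero]

/-- The fundamental lemma of the calculus of variations. -/
theorem ae_eq_of_forall_integral_mul_eq {X : Set (E n)} (hX : IsOpen X) {u v : E n → ℝ}
    (hu : LocallyIntegrableOn u X) (hv : LocallyIntegrableOn v X)
    (h : ∀ η, IsTestFunction X η → ∫ x, u x * η x = ∫ x, v x * η x) :
    ∀ᵐ x, x ∈ X → u x = v x := by
  have := hX.ae_eq_zero_of_integral_contDiff_smul_eq_zero (hu.sub hv) (fun η h1 h2 h3 => by
    have hη : IsTestFunction X η := ⟨h1, h2, h3⟩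
    have := h η hη
    rw [← sub_eq_zero, ← integral_sub (hη.integrable_mul hu) (hη.integrable_mul hv)] at this
    rw [← this]
    refine integral_congr_ae (ae_of_all _ fun x => ?_)
    simp only [Pi.sub_apply, smul_eq_mul]
    ring)
  filter_upwards [this] with x hx hxX
  exact sub_eq_zero.1 (hx hxX)

theorem HasWeakPartial.ae_eq {X : Set (E n)} (hX : IsOpen X) {α : Fin n → ℕ} {u g g' : E n → ℝ}
    (h : HasWeakPartial X α u g) (h' : HasWeakPartial X α u g') : ∀ᵐ x, x ∈ X → g x = g' x := by
  refine ae_eq_of_forall_integral_mul_eq hX h.1 h'.1 fun η hη => ?_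
  have := (h.2 η hη).symm.trans (h'.2 η hη)
  exact mul_left_cancel₀ (pow_ne_zero _ (by norm_num)) this

theorem HasWeakPartial.congr {X : Set (E n)} {α : Fin n → ℕ} {u v g : E n → ℝ}
    (h : HasWeakPartial X α u g) (huv : ∀ᵐ x, x ∈ X → u x = v x) : HasWeakPartial X α v g :=
  ⟨h.1, fun η hη => by
    rw [← h.2 η hη]
    exact ((hη.multiDeriv α).integral_mul_congr huv).symm⟩

open Classical in
theorem weakPartial_congr {X : Set (E n)} {u v : E n → ℝ} (huv : ∀ᵐ x, x ∈ X → u x = v x)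
    (α : Fin n → ℕ) : weakPartial X α u = weakPartial X α v := by
  have : (fun g => HasWeakPartial X α u g) = fun g => HasWeakPartial X α v g := by
    funext g
    refine propext ⟨fun h => h.congr huv, fun h => h.congr ?_⟩
    filter_upwards [huv] with x hx hxX using (hx hxX).symm
  exact congrArg (fun p : (E n → ℝ) → Prop => if h : ∃ g, p g then h.choose else 0) this

theorem HasWeakPartial.add_smul {X : Set (E n)} {α : Fin n → ℕ} {u v g k : E n → ℝ}
    (hu : LocallyIntegrableOn u X) (hv : LocallyIntegrableOn v X) (h : HasWeakPartial X α u g)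
    (h' : HasWeakPartial X α v k) (t : ℝ) :
    HasWeakPartial X α (fun x => u x + t * v x) (fun x => g x + t * k x) where
  locallyIntegrable := h.1.add (h'.1.smul t)
  integral_eq η hη := by
    have hη' := hη.multiDeriv α
    simp only [add_mul, mul_assoc]
    rw [integral_add (hη'.integrable_mul hu) ((hη'.integrable_mul hv).const_mul t),
      integral_add (hη.integrable_mul h.1) ((hη.integrable_mul h'.1).const_mul t),
      integral_const_mul, integral_const_mul, h.2 η hη, h'.2 η hη]
    ring

theorem hasWeakPartial_of_smooth {X : Set (E n)} (α : Fin n → ℕ) {f : E n → ℝ}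
    (hf : ContDiff ℝ ∞ f) : HasWeakPartial X α f (iteratedPartial α f) where
  locallyIntegrable :=
    (smooth_iteratedPartial α hf).continuous.locallyIntegrable.locallyIntegrableOn X
  integral_eq _ hη := integral_mul_iteratedPartial α hf hη.contDiff hη.hasCompactSupport

theorem hasWeakPartial_weakPartial {X : Set (E n)} {α : Fin n → ℕ} {u g : E n → ℝ}
    (h : HasWeakPartial X α u g) : HasWeakPartial X α u (weakPartial X α u) := by
  have h' : ∃ g, HasWeakPartial X α u g := ⟨g, h⟩
  unfold weakPartial
  rw [dif_pos h']
  exact h'.choose_spec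

theorem HasWeakPartial.weakPartial_ae_eq {X : Set (E n)} (hX : IsOpen X) {α : Fin n → ℕ}
    {u g : E n → ℝ} (h : HasWeakPartial X α u g) : weakPartial X α u =ᵐ[volume.restrict X] g :=
  (ae_restrict_iff' hX.measurableSet).2 ((hasWeakPartial_weakPartial h).ae_eq hX h)

theorem MemBeppoLevi.memLp_weakPartial {m : ℕ} {X : Set (E n)} (hX : IsOpen X) {u : E n → ℝ}
    (h : MemBeppoLevi m X u) {α : Fin n → ℕ} (hα : ∑ i, α i = m) :
    MemLp (weakPartial X α u) 2 (volume.restrict X) := by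
  obtain ⟨g, hg, hg2⟩ := h.2 α hα
  exact hg2.ae_eq (hg.weakPartial_ae_eq hX).symm

theorem MemBeppoLevi.hasWeakPartial {m : ℕ} {X : Set (E n)} {u : E n → ℝ}
    (h : MemBeppoLevi m X u) {α : Fin n → ℕ} (hα : ∑ i, α i = m) :
    HasWeakPartial X α u (weakPartial X α u) := by
  obtain ⟨g, hg, _⟩ := h.2 α hα
  exact hasWeakPartial_weakPartial hg

theorem MemBeppoLevi.add_smul {m : ℕ} {X : Set (E n)} {u v : E n → ℝ} (hu : MemBeppoLevi m X u)
    (hv : MemBeppoLevi m X v) (t : ℝ) : MemBeppoLevi m X (fun x => u x + t * v x) where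
  locallyIntegrable := hu.1.add (hv.1.smul t)
  exists_weakPartial α hα := by
    obtain ⟨g, hg, hg2⟩ := hu.2 α hα
    obtain ⟨k, hk, hk2⟩ := hv.2 α hα
    exact ⟨_, hg.add_smul hu.1 hv.1 hk t, hg2.add (hk2.const_mul t)⟩

theorem LocallyIntegrableOn.congr_ae_on {X : Set (E n)} {u v : E n → ℝ}
    (hX : IsOpen X) (hu : LocallyIntegrableOn u X) (huv : ∀ᵐ x, x ∈ X → u x = v x) :
    LocallyIntegrableOn v X := by
  rw [locallyIntegrableOn_iff hX.isLocallyClosed] at hu ⊢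
  intro K hKX hK
  refine (hu K hKX hK).congr ?_
  refine (ae_restrict_iff' hK.measurableSet).2 ?_
  filter_upwards [huv] with x hx hxK using hx (hKX hxK)

theorem MemBeppoLevi.congr {m : ℕ} {X : Set (E n)} (hX : IsOpen X) {u v : E n → ℝ}
    (hu : MemBeppoLevi m X u) (huv : ∀ᵐ x, x ∈ X → u x = v x) : MemBeppoLevi m X v where
  locallyIntegrable := LocallyIntegrableOn.congr_ae_on hX hu.1 huv
  exists_weakPartial α hα := by
    obtain ⟨g, hg, hg2⟩ := hu.2 α hα
    exact ⟨g, hg.congr huv, hg2⟩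

theorem IsTestFunction.memBeppoLevi (m : ℕ) {X : Set (E n)} {η : E n → ℝ}
    (hη : IsTestFunction X η) : MemBeppoLevi m X η where
  locallyIntegrable := hη.contDiff.continuous.locallyIntegrable.locallyIntegrableOn X
  exists_weakPartial α _ := by
    have h := hη.multiDeriv α
    exact ⟨_, hasWeakPartial_of_smooth α hη.contDiff,
      (h.contDiff.continuous.memLp_of_hasCompactSupport h.hasCompactSupport).restrict X⟩

theorem hasWeakPartial_polyFun {m : ℕ} (hm : 1 ≤ m) {X : Set (E n)}
    {P : MvPolynomial (Fin n) ℝ} (hP : P.totalDegree ≤ m - 1) {α : Fin n → ℕ}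
    (hα : ∑ i, α i = m) : HasWeakPartial X α (polyFun P) 0 := by
  rw [← iteratedPartial_polyFun_eq_zero (P := P) (α := α) (by omega)]
  exact hasWeakPartial_of_smooth α (smooth_polyFun P)

theorem memBeppoLevi_polyFun {m : ℕ} (hm : 1 ≤ m) (X : Set (E n))
    {P : MvPolynomial (Fin n) ℝ} (hP : P.totalDegree ≤ m - 1) : MemBeppoLevi m X (polyFun P) where
  locallyIntegrable := (smooth_polyFun P).continuous.locallyIntegrable.locallyIntegrableOn X
  exists_weakPartial _ hα := ⟨0, hasWeakPartial_polyFun hm hP hα, MemLp.zero'⟩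

theorem gradNormSq_eq_sum (m : ℕ) (X : Set (E n)) (u : E n → ℝ) (x : E n) :
    gradNormSq m X u x = ∑ α ∈ Finset.piAntidiag (Finset.univ : Finset (Fin n)) m,
      multiCoeff m α * weakPartial X α u x ^ 2 := rfl

/-! ### Functions whose weak derivatives of order `m` vanish -/

/-- Polynomials of bounded degree are closed under pointwise convergence, because they form a
finite-dimensional, hence closed, subspace of the functions on the set of convergence. -/
theorem exists_polyFun_ae_eq_of_tendsto {d : ℕ} {X : Set (E n)} {u : E n → ℝ}
    {P : ℕ → MvPolynomial (Fin n) ℝ} (hP : ∀ k, (P k).totalDegree ≤ d)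
    (h : ∀ᵐ x, x ∈ X → Tendsto (fun k => polyFun (P k) x) atTop (𝓝 (u x))) :
    ∃ Q : MvPolynomial (Fin n) ℝ, Q.totalDegree ≤ d ∧ ∀ᵐ x, x ∈ X → u x = polyFun Q x := by
  let S : Set (E n) := {x | Tendsto (fun k => polyFun (P k) x) atTop (𝓝 (u x))}
  let T : MvPolynomial (Fin n) ℝ →ₗ[ℝ] (S → ℝ) :=
    { toFun := fun Q s => polyFun Q s
      map_add' := fun p q => by funext s; simp [polyFun]
      map_smul' := fun c p => by funext s; simp [polyFun] }
  let V : Submodule ℝ (S → ℝ) := (MvPolynomial.restrictTotalDegree (Fin n) ℝ d).map T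
  have hV : IsClosed (V : Set (S → ℝ)) := V.closed_of_finiteDimensional
  have hmem : (fun s : S => u s) ∈ (V : Set (S → ℝ)) := by
    refine hV.mem_of_tendsto (f := fun k => T (P k)) (b := atTop) ?_
      (Eventually.of_forall fun k => ?_)
    · exact tendsto_pi_nhds.2 fun s => s.2
    · exact Submodule.mem_map_of_mem ((MvPolynomial.mem_restrictTotalDegree _ _ _).2 (hP k))
  obtain ⟨Q, hQ, hQT⟩ := hmem
  refine ⟨Q, (MvPolynomial.mem_restrictTotalDegree _ _ _).1 hQ, ?_⟩
  filter_upwards [h] with x hx hxX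
  exact (congrFun hQT ⟨x, hx hxX⟩).symm

theorem partialDeriv_convolution (i : Fin n) {u φ : E n → ℝ} (hu : LocallyIntegrable u)
    (hφ : ContDiff ℝ ∞ φ) (hc : HasCompactSupport φ) :
    partialDeriv i (u ⋆[ContinuousLinearMap.mul ℝ ℝ] φ) =
      u ⋆[ContinuousLinearMap.mul ℝ ℝ] partialDeriv i φ := by
  funext x
  have h1 : ContDiff ℝ 1 φ := hφ.of_le (by simp)
  unfold partialDeriv
  rw [(hc.hasFDerivAt_convolution_right (ContinuousLinearMap.mul ℝ ℝ) hu h1 x).fderiv,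
    convolution_precompR_apply _ hu (hc.fderiv (𝕜 := ℝ)) (h1.continuous_fderiv (by simp))]

theorem iteratedPartial_convolution (α : Fin n → ℕ) {u φ : E n → ℝ} (hu : LocallyIntegrable u)
    (hφ : IsTestFunction univ φ) :
    iteratedPartial α (u ⋆[ContinuousLinearMap.mul ℝ ℝ] φ) =
      u ⋆[ContinuousLinearMap.mul ℝ ℝ] iteratedPartial α φ := by
  have h1 : ∀ (i : Fin n) (k : ℕ) (g : E n → ℝ), IsTestFunction univ g →
      IsTestFunction univ ((partialDeriv i)^[k] g) ∧
      (partialDeriv i)^[k] (u ⋆[ContinuousLinearMap.mul ℝ ℝ] g) =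
        u ⋆[ContinuousLinearMap.mul ℝ ℝ] ((partialDeriv i)^[k] g) := by
    intro i k g hg
    induction k with
    | zero => exact ⟨hg, rfl⟩
    | succ k ih =>
      obtain ⟨h2, h3⟩ := ih
      rw [Function.iterate_succ_apply', Function.iterate_succ_apply', h3]
      exact ⟨⟨smooth_partialDeriv i h2.1, h2.2.of_isClosed_subset (isClosed_tsupport _)
        (tsupport_partialDeriv_subset i _), subset_univ _⟩, partialDeriv_convolution i hu h2.1 h2.2⟩
  have h2 : ∀ l : List (Fin n),
      IsTestFunction univ (l.foldr (fun i g => (partialDeriv i)^[α i] g) φ) ∧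
      l.foldr (fun i g => (partialDeriv i)^[α i] g) (u ⋆[ContinuousLinearMap.mul ℝ ℝ] φ) =
        u ⋆[ContinuousLinearMap.mul ℝ ℝ] (l.foldr (fun i g => (partialDeriv i)^[α i] g) φ) := by
    intro l
    induction l with
    | nil => exact ⟨hφ, rfl⟩
    | cons i l ih =>
      rw [List.foldr_cons, List.foldr_cons, ih.2]
      exact h1 i _ _ ih.1
  exact (h2 _).2

/-- On a bounded convex set `U` well inside `X`, the mollifications of `u` have vanishing classical
derivatives of order `m`. Hence they are polynomials of degree less than `m`, and so is their
limit `u`. -/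
theorem exists_polyFun_ae_eq_of_thickening_subset {m : ℕ} (hm : 1 ≤ m) {X U : Set (E n)}
    {u : E n → ℝ} (hu : LocallyIntegrableOn u X) (hU : Convex ℝ U) (hb : Bornology.IsBounded U)
    {δ : ℝ} (hδ : 0 < δ) (hUX : Metric.cthickening δ U ⊆ X)
    (h : ∀ α : Fin n → ℕ, ∑ i, α i = m → ∀ η, IsTestFunction X η →
      ∫ x, u x * iteratedPartial α η x = 0) :
    ∃ P : MvPolynomial (Fin n) ℝ, P.totalDegree ≤ m - 1 ∧ ∀ᵐ x, x ∈ U → u x = polyFun P x := by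
  set K := Metric.cthickening δ U with hK
  have hKc : IsCompact K :=
    Metric.isCompact_of_isClosed_isBounded Metric.isClosed_cthickening hb.cthickening
  have hball : ∀ x ∈ U, ∀ y, dist y x ≤ δ → y ∈ K := fun x hx y hy =>
    Metric.mem_cthickening_of_dist_le y x δ U hx hy
  set v := K.indicator u with hv
  have hvi : LocallyIntegrable v := ((integrable_indicator_iff hKc.measurableSet).2
    (hu.integrableOn_compact_subset hUX hKc)).locallyIntegrable
  -- mollify at the scales `δ / (k + 1)`, at which the convolution only sees `u` on `K`
  have hpos : ∀ k : ℕ, 0 < δ / (k + 1) := fun k => by positivity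
  let φ : ℕ → ContDiffBump (0 : E n) := fun k =>
    ⟨δ / (k + 1) / 2, δ / (k + 1), half_pos (hpos k), half_lt_self (hpos k)⟩
  have hφt : ∀ k, IsTestFunction univ ((φ k).normed volume) := fun k =>
    ⟨(φ k).contDiff_normed, (φ k).hasCompactSupport_normed, subset_univ _⟩
  let f : ℕ → E n → ℝ := fun k => v ⋆[ContinuousLinearMap.mul ℝ ℝ] ((φ k).normed volume)
  have hf : ∀ k, ContDiff ℝ ∞ (f k) := fun k =>
    (hφt k).2.contDiff_convolution_right _ hvi (hφt k).1
  have hfz : ∀ k, ∀ α : Fin n → ℕ, ∑ i, α i = m → ∀ x ∈ U, iteratedPartial α (f k) x = 0 := by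
    intro k α hα x hx
    have hz : ∀ y, y ∉ K → (φ k).normed volume (x - y) = 0 := by
      intro y hy
      by_contra hne
      have h1 : x - y ∈ Function.support ((φ k).normed volume) := hne
      rw [(φ k).support_normed_eq, mem_ball_zero_iff] at h1
      refine hy (hball x hx y ?_)
      rw [dist_comm, dist_eq_norm]
      refine h1.le.trans (div_le_self hδ.le ?_)
      simp
    have ht0 := (hφt k).comp_affine x (c := -1) (by norm_num)
    have ht : IsTestFunction X (fun y => (φ k).normed volume (x + (-1 : ℝ) • y)) := by
      refine ⟨ht0.1, ht0.2, (closure_minimal ?_ hKc.isClosed).trans hUX⟩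
      intro y hy
      by_contra hyK
      exact hy (by simpa [← sub_eq_add_neg] using hz y hyK)
    have h2 := h α hα _ ht
    rw [iteratedPartial_comp_affine] at h2
    have hsub : tsupport (fun y => (φ k).normed volume (x + (-1 : ℝ) • y)) ⊆ K := by
      refine closure_minimal ?_ hKc.isClosed
      intro y hy
      by_contra hyK
      exact hy (by simpa [← sub_eq_add_neg] using hz y hyK)
    have h3 : ∀ y, y ∉ K → iteratedPartial α ((φ k).normed volume) (x - y) = 0 := by
      intro y hy
      have h4 := image_eq_zero_of_notMem_tsupport
        (fun h5 => hy (hsub (tsupport_iteratedPartial_subset α _ h5)))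
      rw [iteratedPartial_comp_affine] at h4
      simpa [← sub_eq_add_neg] using h4
    rw [iteratedPartial_convolution α hvi (hφt k), convolution_def]
    have h5 : ∀ y, u y * ((-1 : ℝ) ^ (∑ i, α i) *
        iteratedPartial α ((φ k).normed volume) (x + (-1 : ℝ) • y)) = (-1 : ℝ) ^ (∑ i, α i) *
        (v y * iteratedPartial α ((φ k).normed volume) (x - y)) := by
      intro y
      have e : x + (-1 : ℝ) • y = x - y := by simp [sub_eq_add_neg]
      rw [e]
      by_cases hy : y ∈ K
      · rw [hv, indicator_of_mem hy]; ring
      · rw [h3 y hy]; ring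
    simp_rw [h5] at h2
    rw [integral_const_mul] at h2
    exact (mul_eq_zero.1 h2).resolve_left (pow_ne_zero _ (by norm_num))
  choose P hPd hP using fun k =>
    exists_polyFun_of_iteratedPartial_eq_zero hm (hf k) hU (hfz k)
  refine exists_polyFun_ae_eq_of_tendsto hPd ?_
  have hlim : Tendsto (fun k => (φ k).rOut) atTop (𝓝 0) := by
    have := (tendsto_one_div_add_atTop_nhds_zero_nat (𝕜 := ℝ)).const_mul δ
    simpa [φ, div_eq_mul_inv] using this
  have hae := ContDiffBump.ae_convolution_tendsto_right_of_locallyIntegrable (φ := φ) (K := 2)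
    (μ := volume) hlim (Eventually.of_forall fun k => by simp [φ]; linarith) hvi
  filter_upwards [hae] with x hx hxU
  have hxv : v x = u x := indicator_of_mem (hball x hxU x (by simpa using hδ.le)) u
  rw [hxv] at hx
  refine hx.congr fun k => ?_
  rw [← hP k x hxU]
  have : (ContinuousLinearMap.mul ℝ ℝ).flip = ContinuousLinearMap.lsmul ℝ ℝ := by
    ext; simp
  change _ = (v ⋆[ContinuousLinearMap.mul ℝ ℝ] ((φ k).normed volume)) x
  rw [← this, convolution_flip]

/-- A locally integrable function on an open convex set whose weak derivatives of order `m` all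
vanish is a polynomial of degree less than `m`. -/
theorem exists_polyFun_ae_eq {m : ℕ} (hm : 1 ≤ m) {X : Set (E n)} (hX : IsOpen X)
    (hconv : Convex ℝ X) {u : E n → ℝ} (hu : LocallyIntegrableOn u X)
    (h : ∀ α : Fin n → ℕ, ∑ i, α i = m → ∀ η, IsTestFunction X η →
      ∫ x, u x * iteratedPartial α η x = 0) :
    ∃ P : MvPolynomial (Fin n) ℝ, P.totalDegree ≤ m - 1 ∧ ∀ᵐ x, x ∈ X → u x = polyFun P x := by
  -- exhaust `X` by bounded convex sets that keep a distance `1 / (j + 1)` from its complement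
  let U : ℕ → Set (E n) := fun j =>
    {x | ‖x‖ ≤ j ∧ ∀ v : E n, ‖v‖ < 1 / (j + 1) → x + v ∈ X}
  have hUc : ∀ j, Convex ℝ (U j) := by
    intro j x hx y hy a b ha hb hab
    refine ⟨?_, fun v hv => ?_⟩
    · have := (convex_closedBall (0 : E n) j) (mem_closedBall_zero_iff.2 hx.1)
        (mem_closedBall_zero_iff.2 hy.1) ha hb hab
      exact mem_closedBall_zero_iff.1 this
    · have := hconv (hx.2 v hv) (hy.2 v hv) ha hb hab
      convert this using 1
      rw [smul_add, smul_add, add_add_add_comm, ← _root_.add_smul, hab, one_smul]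
  have hUb : ∀ j, Bornology.IsBounded (U j) := fun j =>
    (Metric.isBounded_closedBall (x := (0 : E n)) (r := j)).subset fun x hx =>
      mem_closedBall_zero_iff.2 hx.1
  have hUX : ∀ j : ℕ, Metric.cthickening (1 / (2 * (j + 1)) : ℝ) (U j) ⊆ X := by
    intro j
    have hlt : (1 / (2 * (j + 1)) : ℝ) < 1 / (j + 1) :=
      one_div_lt_one_div_of_lt (by positivity) (by linarith [(Nat.cast_nonneg j : (0 : ℝ) ≤ j)])
    refine (Metric.cthickening_subset_thickening' (by positivity) hlt _).trans ?_
    intro y hy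
    obtain ⟨x, hx, hxy⟩ := Metric.mem_thickening_iff.1 hy
    have := hx.2 (y - x) (by rwa [← dist_eq_norm])
    rwa [add_sub_cancel] at this
  choose P hPd hP using fun j => exists_polyFun_ae_eq_of_thickening_subset hm hu (hUc j) (hUb j)
    (by positivity) (hUX j) h
  refine exists_polyFun_ae_eq_of_tendsto hPd ?_
  filter_upwards [ae_all_iff.2 hP] with x hx hxX
  obtain ⟨ε, hε, hball⟩ := Metric.isOpen_iff.1 hX x hxX
  obtain ⟨N, hN⟩ := exists_nat_one_div_lt hε
  obtain ⟨M, hM⟩ := exists_nat_ge ‖x‖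
  refine tendsto_const_nhds.congr' ?_
  filter_upwards [eventually_ge_atTop (max N M)] with j hj
  refine hx j ⟨hM.trans (by exact_mod_cast (le_max_right _ _).trans hj), fun v hv => hball ?_⟩
  rw [Metric.mem_ball, dist_eq_norm, add_sub_cancel_left]
  refine (hv.trans_le ?_).trans hN
  exact one_div_le_one_div_of_le (by positivity)
    (by have : N ≤ j := (le_max_left _ _).trans hj
        have : (N : ℝ) ≤ j := by exact_mod_cast this
        linarith)

/-! ### The loss along a line of discriminators -/

theorem IsAdmissible.add_smul {m : ℕ} {pg pd : E n → ℝ} {X : Set (E n)} {D h : E n → ℝ}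
    (hD : IsAdmissible m pg pd X D) (hh : IsAdmissible m pg pd X h) (t : ℝ) :
    IsAdmissible m pg pd X (fun x => D x + t * h x) where
  memBeppoLevi := hD.1.add_smul hh.1 t
  integrable_pg := by
    simp only [add_mul, mul_assoc]
    exact hD.2.add (hh.2.const_mul t)
  integrable_pd := by
    simp only [add_mul, mul_assoc]
    exact hD.3.add (hh.3.const_mul t)

/-- The inner product `∑_{|α| = m} (m! / α!) ∂^α u ∂^α v` that polarizes `‖∇^m u‖²`. -/
def gradInner (m : ℕ) (X : Set (E n)) (u v : E n → ℝ) (x : E n) : ℝ :=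
  ∑ α ∈ Finset.piAntidiag (Finset.univ : Finset (Fin n)) m,
    multiCoeff m α * (weakPartial X α u x * weakPartial X α v x)

theorem MemBeppoLevi.integrable_gradInner {m : ℕ} {X : Set (E n)} (hX : IsOpen X)
    {u v : E n → ℝ} (hu : MemBeppoLevi m X u) (hv : MemBeppoLevi m X v) :
    Integrable (gradInner m X u v) (volume.restrict X) := by
  unfold gradInner
  refine integrable_finsetSum _ fun α hα => Integrable.const_mul ?_ _
  have hα' := mem_piAntidiag_univ.1 hα
  exact (hu.memLp_weakPartial hX hα').integrable_mul (hv.memLp_weakPartial hX hα')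

theorem gradNormSq_eq_gradInner (m : ℕ) (X : Set (E n)) (u : E n → ℝ) :
    gradNormSq m X u = gradInner m X u u := by
  funext x
  rw [gradNormSq_eq_sum, gradInner]
  simp only [sq]

theorem MemBeppoLevi.integral_gradNormSq_add_smul {m : ℕ} {X : Set (E n)} (hX : IsOpen X)
    {u v : E n → ℝ} (hu : MemBeppoLevi m X u) (hv : MemBeppoLevi m X v) (t : ℝ) :
    ∫ x in X, gradNormSq m X (fun x => u x + t * v x) x =
      (∫ x in X, gradNormSq m X u x) + t * (2 * ∫ x in X, gradInner m X u v x) +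
        t ^ 2 * ∫ x in X, gradNormSq m X v x := by
  have h1 : ∀ᵐ x ∂(volume.restrict X), gradNormSq m X (fun x => u x + t * v x) x =
      gradInner m X u u x + t * (2 * gradInner m X u v x) + t ^ 2 * gradInner m X v v x := by
    have h2 : ∀ᵐ x ∂(volume.restrict X), ∀ α ∈ Finset.piAntidiag (Finset.univ : Finset (Fin n)) m,
        weakPartial X α (fun x => u x + t * v x) x =
          weakPartial X α u x + t * weakPartial X α v x := by
      refine (Finset.eventually_all _).2 fun α hα => ?_
      have hα' := mem_piAntidiag_univ.1 hα
      exact ((hu.hasWeakPartial hα').add_smul hu.1 hv.1 (hv.hasWeakPartial hα') t).weakPartial_ae_eq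
        hX
    filter_upwards [h2] with x hx
    simp only [gradNormSq_eq_sum, gradInner, Finset.mul_sum, ← Finset.sum_add_distrib]
    refine Finset.sum_congr rfl fun α hα => ?_
    rw [hx α hα]
    ring
  rw [integral_congr_ae h1, gradNormSq_eq_gradInner, gradNormSq_eq_gradInner]
  have i1 := hu.integrable_gradInner hX hu
  have i2 := ((hu.integrable_gradInner hX hv).const_mul 2).const_mul t
  have i3 := (hv.integrable_gradInner hX hv).const_mul (t ^ 2)
  have e1 := integral_add i1 i2
  have e2 := integral_add (i1.add i2) i3
  simp only [Pi.add_apply] at e1 e2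
  rw [e2, e1, integral_const_mul, integral_const_mul,
    integral_const_mul]

/-- The first variation of the loss at `D` in the direction `h`. -/
def lossVariation (m : ℕ) (lam : ℝ) (pg pd : E n → ℝ) (X : Set (E n)) (D h : E n → ℝ) : ℝ :=
  (∫ x, h x * pg x) - (∫ x, h x * pd x) + 2 * lam * ∫ x in X, gradInner m X D h x

theorem discriminatorLoss_add_smul {m : ℕ} (lam : ℝ) {pg pd : E n → ℝ} {X : Set (E n)}
    (hX : IsOpen X) {D h : E n → ℝ} (hD : IsAdmissible m pg pd X D)
    (hh : IsAdmissible m pg pd X h) (t : ℝ) :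
    discriminatorLoss m lam pg pd X (fun x => D x + t * h x) =
      discriminatorLoss m lam pg pd X D + t * lossVariation m lam pg pd X D h +
        t ^ 2 * (lam * ∫ x in X, gradNormSq m X h x) := by
  unfold discriminatorLoss lossVariation
  rw [hD.1.integral_gradNormSq_add_smul hX hh.1]
  simp only [add_mul, mul_assoc]
  rw [integral_add hD.2 (hh.2.const_mul t), integral_add hD.3 (hh.3.const_mul t),
    integral_const_mul, integral_const_mul]
  ring

theorem eq_zero_of_forall_nonneg {b c : ℝ} (h : ∀ t : ℝ, 0 ≤ t * b + t ^ 2 * c) : b = 0 := by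
  have h0 := h 0
  by_contra hb
  have hpos : 0 < b ^ 2 := by positivity
  have h1 := h (-b / (1 + |c|))
  have hc : 0 < 1 + |c| := by positivity
  have e : -b / (1 + |c|) * b + (-b / (1 + |c|)) ^ 2 * c =
      b ^ 2 * (c - (1 + |c|)) / (1 + |c|) ^ 2 := by
    field_simp
    ring
  rw [e] at h1
  have h2 : b ^ 2 * (c - (1 + |c|)) < 0 := by
    have := le_abs_self c
    nlinarith
  have := div_neg_of_neg_of_pos h2 (by positivity : 0 < (1 + |c|) ^ 2)
  linarith

/-- Along the line `t ↦ D + t h` the loss is a quadratic polynomial in `t` with a minimum at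
`t = 0`, so that its linear coefficient vanishes, whatever the sign of `lam`. -/
theorem IsOptimal.lossVariation_eq_zero {m : ℕ} {lam : ℝ} {pg pd : E n → ℝ} {X : Set (E n)}
    (hX : IsOpen X) {D h : E n → ℝ} (hD : IsOptimal m lam pg pd X D)
    (hh : IsAdmissible m pg pd X h) : lossVariation m lam pg pd X D h = 0 := by
  refine eq_zero_of_forall_nonneg (c := lam * ∫ x in X, gradNormSq m X h x) fun t => ?_
  have := hD.2 _ (hD.1.add_smul hh t)
  rw [discriminatorLoss_add_smul lam hX hD.1 hh t] at this
  linarith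

theorem IsTestFunction.integrable_mul_density {X : Set (E n)} {η p : E n → ℝ}
    (hη : IsTestFunction X η) (hp : Integrable p) : Integrable fun x => η x * p x := by
  have := hη.integrable_mul (hp.locallyIntegrable.locallyIntegrableOn X)
  simpa only [mul_comm] using this

theorem IsTestFunction.isAdmissible (m : ℕ) {X : Set (E n)} {η pg pd : E n → ℝ}
    (hη : IsTestFunction X η) (hg : IsDensity pg) (hd : IsDensity pd) :
    IsAdmissible m pg pd X η :=
  ⟨hη.memBeppoLevi m, hη.integrable_mul_density hg.1, hη.integrable_mul_density hd.1⟩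

/-- The Beppo-Levi inner product with a test function, by `Δ^m = ∑_{|α| = m} (m! / α!) ∂^α ∂^α`. -/
theorem IsTestFunction.integral_gradInner {m : ℕ} {X : Set (E n)} (hX : IsOpen X)
    {D η : E n → ℝ} (hD : MemBeppoLevi m X D) (hη : IsTestFunction X η) :
    ∫ x in X, gradInner m X D η x = (-1) ^ m * ∫ x, D x * polyLaplacian m η x := by
  have h1 : ∀ᵐ x ∂(volume.restrict X), gradInner m X D η x =
      ∑ α ∈ Finset.piAntidiag (Finset.univ : Finset (Fin n)) m,
        multiCoeff m α * (weakPartial X α D x * iteratedPartial α η x) := by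
    have h2 : ∀ᵐ x ∂(volume.restrict X), ∀ α ∈ Finset.piAntidiag (Finset.univ : Finset (Fin n)) m,
        weakPartial X α η x = iteratedPartial α η x :=
      (Finset.eventually_all _).2 fun α _ =>
        (hasWeakPartial_of_smooth α hη.contDiff).weakPartial_ae_eq hX
    filter_upwards [h2] with x hx
    exact Finset.sum_congr rfl fun α hα => by rw [hx α hα]
  have hi : ∀ α ∈ Finset.piAntidiag (Finset.univ : Finset (Fin n)) m,
      Integrable fun x => multiCoeff m α * (weakPartial X α D x * iteratedPartial α η x) :=
    fun α hα => ((hη.multiDeriv α).integrable_mul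
      (hD.hasWeakPartial (mem_piAntidiag_univ.1 hα)).1).const_mul _
  have hj : ∀ α ∈ Finset.piAntidiag (Finset.univ : Finset (Fin n)) m,
      Integrable fun x => multiCoeff m α * (D x * iteratedPartial α (iteratedPartial α η) x) :=
    fun α hα => (((hη.multiDeriv α).multiDeriv α).integrable_mul hD.1).const_mul _
  rw [integral_congr_ae h1, setIntegral_eq_integral_of_forall_compl_eq_zero (fun x hx =>
    Finset.sum_eq_zero fun α _ => by rw [(hη.multiDeriv α).eq_zero hx, mul_zero, mul_zero]),
    integral_finsetSum _ hi]
  have h3 : ∀ x, D x * polyLaplacian m η x =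
      ∑ α ∈ Finset.piAntidiag (Finset.univ : Finset (Fin n)) m,
        multiCoeff m α * (D x * iteratedPartial α (iteratedPartial α η) x) := fun x => by
    rw [polyLaplacian_eq_sum m hη.contDiff, Finset.mul_sum]
    exact Finset.sum_congr rfl fun α _ => by ring
  simp_rw [h3]
  rw [integral_finsetSum _ hj, Finset.mul_sum]
  refine Finset.sum_congr rfl fun α hα => ?_
  have hα' := mem_piAntidiag_univ.1 hα
  have h4 := (hD.hasWeakPartial hα').2 _ (hη.multiDeriv α)
  rw [integral_const_mul, integral_const_mul, h4, hα']
  have h5 : ((-1 : ℝ) ^ m) * (-1) ^ m = 1 := by rw [← mul_pow]; simp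
  linear_combination (-multiCoeff m α *
    ∫ x, weakPartial X α D x * iteratedPartial α η x) * h5

/-- The Euler-Lagrange equation of the loss. -/
theorem IsOptimal.isWeakSolution {m : ℕ} {lam : ℝ} (hlam : lam ≠ 0) {pg pd : E n → ℝ}
    (hg : IsDensity pg) (hd : IsDensity pd) {X : Set (E n)} (hX : IsOpen X) {D : E n → ℝ}
    (hD : IsOptimal m lam pg pd X D) : IsWeakSolution m X D (pdeRhs m lam pg pd) where
  locallyIntegrable := hD.1.1.1
  integral_eq η hη := by
    have h := hD.lossVariation_eq_zero hX (hη.isAdmissible m hg hd)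
    rw [lossVariation, hη.integral_gradInner hX hD.1.1] at h
    have e : ∀ x, pdeRhs m lam pg pd x * η x =
        (-1) ^ (m + 1) / (2 * lam) * (η x * pg x - η x * pd x) := fun x => by
      unfold pdeRhs
      ring
    simp_rw [e]
    rw [integral_const_mul, integral_sub (hη.integrable_mul_density hg.1)
      (hη.integrable_mul_density hd.1)]
    have h5 : ((-1 : ℝ) ^ m) * (-1) ^ m = 1 := by rw [← mul_pow]; simp
    rw [pow_succ]
    field_simp
    linear_combination (-1) ^ m * h - 2 * lam * (∫ x, D x * polyLaplacian m η x) * h5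

/-! ### Optimal discriminators differ by polynomials -/

theorem gradNormSq_nonneg (m : ℕ) (X : Set (E n)) (u : E n → ℝ) (x : E n) :
    0 ≤ gradNormSq m X u x := by
  rw [gradNormSq_eq_sum]
  exact Finset.sum_nonneg fun α _ => mul_nonneg (multiCoeff_pos m α).le (sq_nonneg _)

theorem MemBeppoLevi.exists_polyFun_of_integral_gradNormSq {m : ℕ} (hm : 1 ≤ m)
    {X : Set (E n)} (hX : IsOpen X) (hc : Convex ℝ X) {u : E n → ℝ} (hu : MemBeppoLevi m X u)
    (h : ∫ x in X, gradNormSq m X u x = 0) :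
    ∃ P : MvPolynomial (Fin n) ℝ, P.totalDegree ≤ m - 1 ∧ ∀ᵐ x, x ∈ X → u x = polyFun P x := by
  have hi := hu.integrable_gradInner hX hu
  rw [← gradNormSq_eq_gradInner] at hi
  have h0 := (integral_eq_zero_iff_of_nonneg (gradNormSq_nonneg m X u) hi).1 h
  refine exists_polyFun_ae_eq hm hX hc hu.1 fun α hα η hη => ?_
  rw [(hu.hasWeakPartial hα).2 η hη]
  have hz : ∀ᵐ x, x ∈ X → weakPartial X α u x = (0 : E n → ℝ) x := by
    filter_upwards [(ae_restrict_iff' hX.measurableSet).1 h0] with x hx hxX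
    have h1 := hx hxX
    rw [gradNormSq_eq_sum] at h1
    have h2 := (Finset.sum_eq_zero_iff_of_nonneg fun α _ =>
      mul_nonneg (multiCoeff_pos m α).le (sq_nonneg _)).1 h1 α (mem_piAntidiag_univ.2 hα)
    simpa [(multiCoeff_pos m α).ne'] using h2
  rw [hη.integral_mul_congr hz]
  simp

theorem mul_density_ae_eq {X : Set (E n)} {u v p : E n → ℝ}
    (h : ∀ᵐ x, x ∈ X → u x = v x) (hp : ∀ᵐ x, x ∉ X → p x = 0) :
    (fun x => u x * p x) =ᵐ[volume] fun x => v x * p x := by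
  filter_upwards [h, hp] with x hx hpx
  by_cases hxX : x ∈ X
  · rw [hx hxX]
  · rw [hpx hxX, mul_zero, mul_zero]

/-- The loss is quadratic along lines. Between two minimizers both its linear and its quadratic
coefficient vanish, so `∇^m` of their difference is zero. Conversely, a polynomial of degree less
than `m` with finite expectations only contributes to the linear coefficient, which is zero. -/
theorem IsOptimal.isOptimal_iff {m : ℕ} (hm : 1 ≤ m) {lam : ℝ} (hlam : lam ≠ 0)
    {pg pd : E n → ℝ} {X : Set (E n)} (hX : IsCarrier pg pd X) {D₀ : E n → ℝ}
    (hD₀ : IsOptimal m lam pg pd X D₀) (D : E n → ℝ) :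
    IsOptimal m lam pg pd X D ↔ IsAdmissible m pg pd X D ∧
      ∃ P : MvPolynomial (Fin n) ℝ, P.totalDegree ≤ m - 1 ∧
        ∀ᵐ x, x ∈ X → D x = D₀ x + polyFun P x := by
  constructor
  · intro hD
    refine ⟨hD.1, ?_⟩
    have hh := hD.1.add_smul hD₀.1 (-1)
    set h : E n → ℝ := fun x => D x + -1 * D₀ x with hdef
    have hadd : (fun x => D₀ x + 1 * h x) = D := by
      funext x
      simp only [hdef]
      ring
    have h1 := discriminatorLoss_add_smul lam hX.1 hD₀.1 hh 1
    rw [hadd, hD₀.lossVariation_eq_zero hX.1 hh, le_antisymm (hD.2 _ hD₀.1) (hD₀.2 _ hD.1)] at h1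
    have h2 : ∫ x in X, gradNormSq m X h x = 0 := by
      have : lam * ∫ x in X, gradNormSq m X h x = 0 := by linarith
      exact (mul_eq_zero.1 this).resolve_left hlam
    obtain ⟨P, hP, hPh⟩ := hh.1.exists_polyFun_of_integral_gradNormSq hm hX.1 hX.2 h2
    refine ⟨P, hP, ?_⟩
    filter_upwards [hPh] with x hx hxX
    rw [← hx hxX]
    simp only [hdef]
    ring
  · rintro ⟨hD, P, hP, hPD⟩
    have hpg : ∀ᵐ x, x ∉ X → pg x = 0 := hX.3.mono fun x hx hxX => (hx hxX).1
    have hpd : ∀ᵐ x, x ∉ X → pd x = 0 := hX.3.mono fun x hx hxX => (hx hxX).2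
    have hPD' : ∀ᵐ x, x ∈ X → polyFun P x = D x - D₀ x := by
      filter_upwards [hPD] with x hx hxX
      rw [hx hxX]
      ring
    have hPa : IsAdmissible m pg pd X (polyFun P) := by
      refine ⟨memBeppoLevi_polyFun hm X hP, ?_, ?_⟩
      · refine ((hD.2.sub hD₀.1.2).congr (ae_of_all _ fun x => ?_)).congr
          (mul_density_ae_eq hPD' hpg).symm
        simp only [Pi.sub_apply]
        ring
      · refine ((hD.3.sub hD₀.1.3).congr (ae_of_all _ fun x => ?_)).congr
          (mul_density_ae_eq hPD' hpd).symm
        simp only [Pi.sub_apply]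
        ring
    have hgrad : ∫ x in X, gradNormSq m X (polyFun P) x = 0 := by
      refine integral_eq_zero_of_ae ?_
      have h2 : ∀ᵐ x ∂(volume.restrict X), ∀ α ∈ Finset.piAntidiag (Finset.univ : Finset (Fin n)) m,
          weakPartial X α (polyFun P) x = (0 : E n → ℝ) x :=
        (Finset.eventually_all _).2 fun α hα =>
          (hasWeakPartial_polyFun hm hP (mem_piAntidiag_univ.1 hα)).weakPartial_ae_eq hX.1
      filter_upwards [h2] with x hx
      rw [gradNormSq_eq_sum]
      exact Finset.sum_eq_zero fun α hα => by rw [hx α hα]; simp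
    have hloss : discriminatorLoss m lam pg pd X D = discriminatorLoss m lam pg pd X D₀ := by
      have h1 := discriminatorLoss_add_smul lam hX.1 hD₀.1 hPa 1
      rw [hgrad, hD₀.lossVariation_eq_zero hX.1 hPa] at h1
      have h2 : ∀ᵐ x, x ∈ X → D x = D₀ x + 1 * polyFun P x := by simpa using hPD
      have h3 : discriminatorLoss m lam pg pd X D =
          discriminatorLoss m lam pg pd X (fun x => D₀ x + 1 * polyFun P x) := by
        unfold discriminatorLoss gradNormSq
        rw [integral_congr_ae (mul_density_ae_eq h2 hpg),
          integral_congr_ae (mul_density_ae_eq h2 hpd)]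
        simp only [weakPartial_congr h2]
      rw [h3, h1]
      ring
    exact ⟨hD, fun D' hD' => hloss ▸ hD₀.2 D' hD'⟩

/-! ### Powers of the norm -/

theorem locallyIntegrable_norm_rpow (hn : 1 ≤ n) {s : ℝ} (hs : -(n : ℝ) < s) :
    LocallyIntegrable fun x : E n => ‖x‖ ^ s := by
  refine locallyIntegrable_of_norm_le_rpow (C := 1) (α := -s)
    (by rw [finrank_euclideanSpace_fin]; exact hn) (by simp; linarith) (ae_of_all _ fun x => ?_) ?_
  · rw [neg_neg, one_mul, Real.norm_of_nonneg (by positivity)]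
  · exact (measurable_norm.pow_const s).aestronglyMeasurable

theorem ae_norm_pos (hn : 1 ≤ n) : ∀ᵐ x : E n, 0 < ‖x‖ := by
  have : Nontrivial (E n) := Module.nontrivial_of_finrank_pos (R := ℝ)
    (by rw [finrank_euclideanSpace_fin]; exact hn)
  have h : ∀ᵐ x : E n, x ≠ 0 := by
    rw [ae_iff]
    simp
  filter_upwards [h] with x hx using norm_pos_iff.2 hx

theorem contDiff_regularized {ε : ℝ} (hε : 0 < ε) (a : ℝ) :
    ContDiff ℝ ∞ fun x : E n => (‖x‖ ^ 2 + ε) ^ a :=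
  ((contDiff_norm_sq ℝ).add contDiff_const).rpow_const_of_ne fun x => by positivity

/-- The Laplacian of the smooth approximation `(‖x‖² + ε)^a` of `‖x‖^{2a}`. The last term is the
error that disappears as `ε → 0⁺`. -/
theorem laplacian_regularized {ε : ℝ} (hε : 0 < ε) (a : ℝ) (x : E n) :
    Δ (fun x : E n => (‖x‖ ^ 2 + ε) ^ a) x =
      2 * a * (2 * a + n - 2) * (‖x‖ ^ 2 + ε) ^ (a - 1) -
        4 * a * (a - 1) * (ε * (‖x‖ ^ 2 + ε) ^ (a - 1 - 1)) := by
  have hp : ∀ y : E n, 0 < ‖y‖ ^ 2 + ε := fun y => by positivity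
  have hd : ∀ (b : ℝ) (y : E n), HasFDerivAt (fun x : E n => (‖x‖ ^ 2 + ε) ^ b)
      ((b * (‖y‖ ^ 2 + ε) ^ (b - 1)) • (2 • innerSL ℝ y)) y := fun b y =>
    HasFDerivAt.rpow_const (((hasStrictFDerivAt_norm_sq y).hasFDerivAt).add_const ε)
      (Or.inl (hp y).ne')
  have h1 : ∀ i : Fin n, partialDeriv i (fun x : E n => (‖x‖ ^ 2 + ε) ^ a) =
      fun y => 2 * a * ((‖y‖ ^ 2 + ε) ^ (a - 1) * y i) := by
    intro i
    funext y
    unfold partialDeriv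
    rw [(hd a y).fderiv]
    simp [EuclideanSpace.inner_single_right]
    ring
  have h2 : ∀ i : Fin n, partialDeriv i (fun y : E n => (‖y‖ ^ 2 + ε) ^ (a - 1) * y i) x =
      2 * (a - 1) * (‖x‖ ^ 2 + ε) ^ (a - 1 - 1) * x i ^ 2 + (‖x‖ ^ 2 + ε) ^ (a - 1) := by
    intro i
    have hj : HasFDerivAt (fun y : E n => y i) (EuclideanSpace.proj i : E n →L[ℝ] ℝ) x :=
      (EuclideanSpace.proj i : E n →L[ℝ] ℝ).hasFDerivAt
    have h3 : HasFDerivAt (fun y : E n => (‖y‖ ^ 2 + ε) ^ (a - 1) * y i) _ x :=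
      (hd (a - 1) x).mul hj
    unfold partialDeriv
    rw [h3.fderiv]
    simp [EuclideanSpace.inner_single_right]
    ring
  rw [laplacian_eq_sum_partialDeriv ((contDiff_regularized hε a).of_le two_le_infty).contDiffAt]
  simp_rw [h1, partialDeriv_const_mul, h2]
  rw [← Finset.mul_sum, Finset.sum_add_distrib, ← Finset.mul_sum, ← EuclideanSpace.real_norm_sq_eq,
    Finset.sum_const, Finset.card_univ, Fintype.card_fin, nsmul_eq_mul]
  have h4 : (‖x‖ ^ 2 + ε) ^ (a - 1) = (‖x‖ ^ 2 + ε) ^ (a - 1 - 1) * (‖x‖ ^ 2 + ε) := by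
    rw [← Real.rpow_add_one (hp x).ne']
    ring_nf
  rw [h4]
  ring

/-- A bound of `(‖x‖² + ε)^b` that does not depend on `ε`, for either sign of `b`. -/
theorem regularized_le {ε : ℝ} (hε : 0 < ε) (hε1 : ε ≤ 1) (b : ℝ) {x : E n} (hx : 0 < ‖x‖) :
    (‖x‖ ^ 2 + ε) ^ b ≤ ‖x‖ ^ (2 * b) + (‖x‖ ^ 2 + 1) ^ b := by
  have e : ‖x‖ ^ (2 * b) = (‖x‖ ^ 2) ^ b := by
    rw [Real.rpow_mul hx.le]
    norm_num
  rw [e]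
  rcases le_total b 0 with hb | hb
  · have : (‖x‖ ^ 2 + ε) ^ b ≤ (‖x‖ ^ 2) ^ b :=
      Real.rpow_le_rpow_of_nonpos (by positivity) (by linarith) hb
    have h2 : 0 ≤ (‖x‖ ^ 2 + 1) ^ b := by positivity
    linarith
  · have : (‖x‖ ^ 2 + ε) ^ b ≤ (‖x‖ ^ 2 + 1) ^ b :=
      Real.rpow_le_rpow (by positivity) (by linarith) hb
    have h2 : 0 ≤ (‖x‖ ^ 2) ^ b := by positivity
    linarith

theorem integrable_regularized_bound (hn : 1 ≤ n) {b : ℝ} (hb : -(n : ℝ) < 2 * b) {η : E n → ℝ}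
    (hη : IsTestFunction univ η) :
    Integrable fun x : E n => |(‖x‖ ^ (2 * b) + (‖x‖ ^ 2 + 1) ^ b) * η x| := by
  have h1 := (locallyIntegrable_norm_rpow hn hb).add
    (contDiff_regularized (n := n) one_pos b).continuous.locallyIntegrable
  exact (hη.integrable_mul (h1.locallyIntegrableOn univ)).abs

theorem tendsto_integral_regularized (hn : 1 ≤ n) {b : ℝ} (hb : -(n : ℝ) < 2 * b) {η : E n → ℝ}
    (hη : IsTestFunction univ η) :
    Tendsto (fun ε : ℝ => ∫ x, (‖x‖ ^ 2 + ε) ^ b * η x) (𝓝[>] 0)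
      (𝓝 (∫ x, ‖x‖ ^ (2 * b) * η x)) := by
  refine tendsto_integral_filter_of_dominated_convergence _ ?_ ?_
    (integrable_regularized_bound hn hb hη) ?_
  · filter_upwards [self_mem_nhdsWithin] with ε hε
    exact ((contDiff_regularized hε b).continuous.mul
      hη.contDiff.continuous).aestronglyMeasurable
  · filter_upwards [Ioc_mem_nhdsGT (zero_lt_one' ℝ)] with ε hε
    filter_upwards [ae_norm_pos hn] with x hx
    have hε0 : 0 < ε := hε.1
    have h1 : 0 ≤ (‖x‖ ^ 2 + ε) ^ b := by positivity
    have h2 : 0 ≤ ‖x‖ ^ (2 * b) + (‖x‖ ^ 2 + 1) ^ b := by positivity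
    rw [Real.norm_eq_abs, abs_mul, abs_mul, abs_of_nonneg h1, abs_of_nonneg h2]
    gcongr
    exact regularized_le hε.1 hε.2 b hx
  · filter_upwards [ae_norm_pos hn] with x hx
    have h1 : Tendsto (fun ε : ℝ => ‖x‖ ^ 2 + ε) (𝓝[>] 0) (𝓝 (‖x‖ ^ 2 + 0)) :=
      (tendsto_const_nhds.add tendsto_id).mono_left nhdsWithin_le_nhds
    rw [add_zero] at h1
    have h2 := (h1.rpow_const (p := b) (Or.inl (by positivity))).mul_const (η x)
    have e : ‖x‖ ^ (2 * b) = (‖x‖ ^ 2) ^ b := by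
      rw [Real.rpow_mul hx.le]
      norm_num
    rw [e]
    exact h2

theorem tendsto_integral_regularized_error (hn : 1 ≤ n) {b : ℝ} (hb : -(n : ℝ) < 2 * b)
    {η : E n → ℝ} (hη : IsTestFunction univ η) :
    Tendsto (fun ε : ℝ => ∫ x, (ε * (‖x‖ ^ 2 + ε) ^ (b - 1)) * η x) (𝓝[>] 0) (𝓝 0) := by
  have hz : (0 : ℝ) = ∫ _ : E n, (0 : ℝ) := by simp
  rw [hz]
  refine tendsto_integral_filter_of_dominated_convergence _ ?_ ?_
    (integrable_regularized_bound hn hb hη) ?_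
  · rw [← hz]
    filter_upwards [self_mem_nhdsWithin] with ε hε
    exact ((continuous_const.mul (contDiff_regularized hε (b - 1)).continuous).mul
      hη.contDiff.continuous).aestronglyMeasurable
  · rw [← hz]
    filter_upwards [Ioc_mem_nhdsGT (zero_lt_one' ℝ)] with ε hε
    filter_upwards [ae_norm_pos hn] with x hx
    have hε0 : 0 < ε := hε.1
    have hp : 0 < ‖x‖ ^ 2 + ε := by positivity
    have h1 : 0 ≤ ε * (‖x‖ ^ 2 + ε) ^ (b - 1) := by positivity
    have h2 : 0 ≤ ‖x‖ ^ (2 * b) + (‖x‖ ^ 2 + 1) ^ b := by positivity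
    rw [Real.norm_eq_abs, abs_mul _ (η x), abs_mul _ (η x), abs_of_nonneg h1, abs_of_nonneg h2]
    gcongr
    refine le_trans ?_ (regularized_le hε.1 hε.2 b hx)
    rw [Real.rpow_sub_one hp.ne', mul_div_assoc', div_le_iff₀ hp, mul_comm]
    have : 0 ≤ ‖x‖ ^ 2 := by positivity
    gcongr
    linarith
  · rw [← hz]
    filter_upwards [ae_norm_pos hn] with x hx
    have h0 : Tendsto (fun ε : ℝ => ε) (𝓝[>] 0) (𝓝 0) := tendsto_id.mono_left nhdsWithin_le_nhds
    have h1 : Tendsto (fun ε : ℝ => ‖x‖ ^ 2 + ε) (𝓝[>] 0) (𝓝 (‖x‖ ^ 2 + 0)) :=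
      tendsto_const_nhds.add h0
    rw [add_zero] at h1
    have h2 := (h0.mul (h1.rpow_const (p := b - 1) (Or.inl (by positivity)))).mul_const (η x)
    simpa using h2

/-- `Δ‖x‖^s = s (s + n - 2) ‖x‖^{s-2}` as distributions, for `s > 2 - n`. -/
theorem integral_norm_rpow_mul_laplacian (hn : 1 ≤ n) {s : ℝ} (hs : 2 - (n : ℝ) < s)
    {η : E n → ℝ} (hη : IsTestFunction univ η) :
    ∫ x, ‖x‖ ^ s * Δ η x = s * (s + n - 2) * ∫ x, ‖x‖ ^ (s - 2) * η x := by
  have hΔ : IsTestFunction univ (Δ η) := hη.polyLap 1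
  have e1 : 2 * (s / 2) = s := by ring
  have e2 : 2 * (s / 2 - 1) = s - 2 := by ring
  have L1 := tendsto_integral_regularized hn (b := s / 2) (by linarith) hΔ
  have L2 := tendsto_integral_regularized hn (b := s / 2 - 1) (by linarith) hη
  have L3 := tendsto_integral_regularized_error hn (b := s / 2 - 1) (by linarith) hη
  rw [e1] at L1
  rw [e2] at L2
  have L4 := (L2.const_mul (s * (s + n - 2))).sub (L3.const_mul (s * (s - 2)))
  rw [mul_zero, sub_zero] at L4
  refine tendsto_nhds_unique L1 (L4.congr' ?_)
  filter_upwards [self_mem_nhdsWithin] with ε hε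
  have hc : ∀ c : ℝ, Continuous fun x : E n => (‖x‖ ^ 2 + ε) ^ c := fun c =>
    (contDiff_regularized hε c).continuous
  have hη2 : ContDiff ℝ 2 η := hη.contDiff.of_le two_le_infty
  rw [integral_mul_laplacian ((contDiff_regularized hε _).of_le two_le_infty) hη2 hη.2,
    ← integral_const_mul, ← integral_const_mul, ← integral_sub]
  · refine integral_congr_ae (ae_of_all _ fun x => ?_)
    simp only [laplacian_regularized hε]
    ring
  · exact (hη.integrable_mul ((hc _).locallyIntegrable.locallyIntegrableOn univ)).const_mul _
  · exact (hη.integrable_mul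
      ((continuous_const.mul (hc _)).locallyIntegrable.locallyIntegrableOn univ)).const_mul _

/-- Iteration of `Δ‖x‖^s = s (s + n - 2) ‖x‖^{s-2}`, valid for `s > 2m - n`. -/
theorem integral_norm_rpow_mul_polyLaplacian (hn : 1 ≤ n) (m : ℕ) {s : ℝ}
    (hs : 2 * (m : ℝ) - n < s) {η : E n → ℝ} (hη : IsTestFunction univ η) :
    ∫ x, ‖x‖ ^ s * polyLaplacian m η x =
      (∏ j ∈ Finset.range m, ((s - 2 * j) * (s - 2 * j + n - 2))) *
        ∫ x, ‖x‖ ^ (s - 2 * m) * η x := by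
  induction m generalizing η with
  | zero => simp [polyLaplacian]
  | succ k ih =>
    push_cast at hs
    rw [polyLaplacian_succ, ih (by linarith) (η := Δ η) (hη.polyLap 1),
      integral_norm_rpow_mul_laplacian hn (by linarith) hη, Finset.prod_range_succ,
      show s - 2 * ((k + 1 : ℕ) : ℝ) = s - 2 * k - 2 by push_cast; ring]
    ring

/-! ### Concentration at the origin -/

/-- The area `n |B₁|` of the unit sphere. -/
def sphereArea (n : ℕ) : ℝ := n * (volume : Measure (E n)).real (Metric.ball 0 1)

theorem sphereArea_pos (hn : 1 ≤ n) : 0 < sphereArea n := by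
  unfold sphereArea
  have h1 : 0 < (volume : Measure (E n)).real (Metric.ball 0 1) :=
    ENNReal.toReal_pos (Metric.measure_ball_pos volume _ one_pos).ne' measure_ball_lt_top.ne
  have : (0 : ℝ) < n := by exact_mod_cast hn
  positivity

/-- Integration of `δ ‖x‖^{δ-n}` over the unit ball in polar coordinates. -/
theorem integral_ball_norm_rpow (hn : 1 ≤ n) {δ : ℝ} (hδ : 0 < δ) :
    δ * ∫ x in Metric.ball (0 : E n) 1, ‖x‖ ^ (δ - n) = sphereArea n := by
  have : Nontrivial (E n) := Module.nontrivial_of_finrank_pos (R := ℝ)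
    (by rw [finrank_euclideanSpace_fin]; exact hn)
  have h1 : ∫ x in Metric.ball (0 : E n) 1, ‖x‖ ^ (δ - n) =
      ∫ x : E n, (Iio (1 : ℝ)).indicator (fun r => r ^ (δ - n)) ‖x‖ := by
    rw [← integral_indicator measurableSet_ball]
    refine integral_congr_ae (ae_of_all _ fun x => ?_)
    simp [indicator]
  rw [h1, integral_fun_norm_addHaar]
  have h2 : ∫ y in Ioi (0 : ℝ), y ^ (Module.finrank ℝ (E n) - 1) •
      (Iio (1 : ℝ)).indicator (fun r => r ^ (δ - n)) y = ∫ y in Ioc (0 : ℝ) 1, y ^ (δ - 1) := by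
    rw [integral_Ioc_eq_integral_Ioo, ← integral_indicator measurableSet_Ioi,
      ← integral_indicator measurableSet_Ioo]
    refine integral_congr_ae (ae_of_all _ fun y => ?_)
    by_cases h0 : 0 < y
    · by_cases h3 : y < 1
      · simp only [indicator, mem_Ioi, h0, mem_Iio, h3, mem_Ioo, and_self, if_true,
          smul_eq_mul, finrank_euclideanSpace, Fintype.card_fin]
        rw [← Real.rpow_natCast, ← Real.rpow_add h0]
        push_cast [hn]
        ring_nf
      · simp [indicator, h3]
    · simp [indicator, h0]
  rw [h2, ← intervalIntegral.integral_of_le zero_le_one, integral_rpow (Or.inl (by linarith))]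
  simp only [sub_add_cancel, Real.one_rpow, Real.zero_rpow hδ.ne', sub_zero, smul_eq_mul,
    nsmul_eq_mul, finrank_euclideanSpace, Fintype.card_fin, sphereArea]
  field_simp

theorem rpow_add_le {r : ℝ} (hr : 0 < r) (s : ℝ) {δ : ℝ} (h0 : 0 ≤ δ) (h1 : δ ≤ 1) :
    r ^ (s + δ) ≤ r ^ s + r ^ (s + 1) := by
  rcases le_total r 1 with h | h
  · have := Real.rpow_le_rpow_of_exponent_ge hr h (show s ≤ s + δ by linarith)
    have : 0 ≤ r ^ (s + 1) := by positivity
    linarith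
  · have := Real.rpow_le_rpow_of_exponent_le h (show s + δ ≤ s + 1 by linarith)
    have : 0 ≤ r ^ s := by positivity
    linarith

/-- `δ ‖x‖^{δ-n}` concentrates at the origin as `δ → 0⁺`. -/
theorem tendsto_mul_integral_norm_rpow (hn : 1 ≤ n) {η : E n → ℝ} (hη : IsTestFunction univ η) :
    Tendsto (fun δ : ℝ => δ * ∫ x, ‖x‖ ^ (δ - n) * η x) (𝓝[>] 0) (𝓝 (sphereArea n * η 0)) := by
  obtain ⟨L, hL⟩ := (hη.contDiff.of_le (by simp) :
    ContDiff ℝ 1 η).lipschitzWith_of_hasCompactSupport hη.2 (by simp)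
  obtain ⟨M, hM⟩ := hη.contDiff.continuous.bounded_above_of_compact_support hη.2
  obtain ⟨R, hR0, hR⟩ := hη.2.isBounded.exists_pos_norm_lt
  set C : ℝ := max L M
  set R' : ℝ := max R 1
  have hM0 : 0 ≤ M := (norm_nonneg _).trans (hM 0)
  set B := Metric.ball (0 : E n) R'
  -- `η = η(0) 1_{‖x‖ < 1} + g` with `|g(x)| ≤ C ‖x‖` and `g` of bounded support
  let g : E n → ℝ := fun x => η x - (Metric.ball (0 : E n) 1).indicator (fun _ => η 0) x
  have hg : ∀ x, |g x| ≤ B.indicator (fun x => C * ‖x‖) x := by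
    intro x
    by_cases hx1 : x ∈ Metric.ball (0 : E n) 1
    · have hxB : x ∈ B := Metric.ball_subset_ball (le_max_right _ _) hx1
      simp only [g, indicator_of_mem hx1, indicator_of_mem hxB]
      have := hL.dist_le_mul x 0
      rw [Real.dist_eq, dist_zero_right] at this
      exact this.trans (by gcongr; exact le_max_left _ _)
    · simp only [g, indicator_of_notMem hx1, sub_zero]
      by_cases hxB : x ∈ B
      · rw [indicator_of_mem hxB]
        have h1 : 1 ≤ ‖x‖ := by simpa using hx1
        have h2 := hM x
        rw [Real.norm_eq_abs] at h2
        have h3 : M ≤ C := le_max_right _ _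
        nlinarith
      · rw [indicator_of_notMem hxB]
        have h1 : x ∉ tsupport η := fun h => hxB (by
          rw [mem_ball_zero_iff]
          exact (hR x h).trans_le (le_max_left _ _))
        rw [image_eq_zero_of_notMem_tsupport h1, abs_zero]
  have hint : ∀ s : ℝ, -(n : ℝ) < s → IntegrableOn (fun x : E n => ‖x‖ ^ s) B := fun s hs =>
    ((locallyIntegrable_norm_rpow hn hs).integrableOn_isCompact
      (isCompact_closedBall 0 R')).mono_set Metric.ball_subset_closedBall
  set K : ℝ := ∫ x in B, C * (‖x‖ ^ ((1 : ℝ) - n) + ‖x‖ ^ ((1 : ℝ) - n + 1))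
  have hKi : IntegrableOn (fun x : E n => C * (‖x‖ ^ ((1 : ℝ) - n) + ‖x‖ ^ ((1 : ℝ) - n + 1))) B :=
    ((hint _ (by linarith)).add (hint _ (by linarith))).const_mul C
  have hbound : ∀ δ ∈ Ioc (0 : ℝ) 1,
      |δ * (∫ x, ‖x‖ ^ (δ - n) * η x) - sphereArea n * η 0| ≤ δ * K := by
    intro δ hδ
    have hl := locallyIntegrable_norm_rpow hn (s := δ - n) (by linarith [hδ.1])
    have i1 := hη.integrable_mul (hl.locallyIntegrableOn univ)
    have i2 : Integrable fun x : E n =>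
        ‖x‖ ^ (δ - n) * (Metric.ball (0 : E n) 1).indicator (fun _ => η 0) x := by
      have := ((hl.integrableOn_isCompact (isCompact_closedBall 0 1)).mono_set
        Metric.ball_subset_closedBall).mul_const (η 0)
      refine ((integrable_indicator_iff measurableSet_ball).2 this).congr (ae_of_all _ fun x => ?_)
      simp [indicator]
    have e1 : ∫ x, ‖x‖ ^ (δ - n) * (Metric.ball (0 : E n) 1).indicator (fun _ => η 0) x =
        (∫ x in Metric.ball (0 : E n) 1, ‖x‖ ^ (δ - n)) * η 0 := by
      rw [← integral_mul_const, ← integral_indicator measurableSet_ball]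
      refine integral_congr_ae (ae_of_all _ fun x => ?_)
      simp [indicator]
    rw [← integral_ball_norm_rpow hn hδ.1, mul_assoc, ← mul_sub, ← e1, ← integral_sub i1 i2,
      abs_mul, abs_of_pos hδ.1]
    refine mul_le_mul_of_nonneg_left ?_ hδ.1.le
    rw [← Real.norm_eq_abs, show K = ∫ x, B.indicator _ x from
      (integral_indicator measurableSet_ball).symm]
    refine norm_integral_le_of_norm_le ((integrable_indicator_iff measurableSet_ball).2 hKi) ?_
    filter_upwards [ae_norm_pos hn] with x hx
    rw [← mul_sub, Real.norm_eq_abs, abs_mul, abs_of_nonneg (by positivity)]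
    refine (mul_le_mul_of_nonneg_left (hg x) (by positivity)).trans ?_
    by_cases hxB : x ∈ B
    · rw [indicator_of_mem hxB, indicator_of_mem hxB]
      have h1 := rpow_add_le hx (1 - n) hδ.1.le hδ.2
      have h2 : ‖x‖ ^ ((1 : ℝ) - n + δ) = ‖x‖ ^ (δ - n) * ‖x‖ := by
        rw [← Real.rpow_add_one hx.ne']
        ring_nf
      rw [h2] at h1
      have hC : 0 ≤ C := hM0.trans (le_max_right _ _)
      nlinarith
    · rw [indicator_of_notMem hxB, indicator_of_notMem hxB, mul_zero]
  rw [tendsto_iff_dist_tendsto_zero]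
  refine squeeze_zero' (Eventually.of_forall fun _ => dist_nonneg) (g := fun δ => δ * K) ?_ ?_
  · filter_upwards [Ioc_mem_nhdsGT (zero_lt_one' ℝ)] with δ hδ
    rw [Real.dist_eq]
    exact hbound δ hδ
  · have : Tendsto (fun δ : ℝ => δ * K) (𝓝 0) (𝓝 (0 * K)) := tendsto_id.mul_const K
    rw [zero_mul] at this
    exact this.mono_left nhdsWithin_le_nhds

/-! ### The fundamental solution -/

theorem abs_log_le {r : ℝ} (hr : 0 < r) :
    |Real.log r| ≤ 2 * r ^ (1 / 2 : ℝ) + 2 * r ^ (-(1 / 2) : ℝ) := by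
  have h1 := Real.log_le_rpow_div hr.le (show (0 : ℝ) < 1 / 2 by norm_num)
  have h2 := Real.log_le_rpow_div (inv_pos.2 hr).le (show (0 : ℝ) < 1 / 2 by norm_num)
  rw [Real.log_inv, Real.inv_rpow hr.le, ← Real.rpow_neg hr.le] at h2
  have h3 : 0 < r ^ (1 / 2 : ℝ) := by positivity
  have h4 : 0 < r ^ (-(1 / 2) : ℝ) := by positivity
  rw [abs_le]
  constructor <;> linarith

theorem locallyIntegrable_norm_rpow_mul_log (hn : 1 ≤ n) {s : ℝ} (hs : 0 ≤ s) :
    LocallyIntegrable fun x : E n => ‖x‖ ^ s * Real.log ‖x‖ := by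
  have hn' : (1 : ℝ) ≤ n := by exact_mod_cast hn
  have h1 := (locallyIntegrable_norm_rpow hn (s := s + 1 / 2) (by linarith)).add
    (locallyIntegrable_norm_rpow hn (s := s - 1 / 2) (by linarith))
  refine (h1.smul (2 : ℝ)).mono ?_ ?_
  · exact ((measurable_norm.pow_const s).mul
      (Real.measurable_log.comp measurable_norm)).aestronglyMeasurable
  · filter_upwards [ae_norm_pos hn] with x hx
    have h2 := abs_log_le hx
    have e1 : ‖x‖ ^ (s + 1 / 2) = ‖x‖ ^ s * ‖x‖ ^ (1 / 2 : ℝ) := Real.rpow_add hx _ _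
    have e2 : ‖x‖ ^ (s - 1 / 2) = ‖x‖ ^ s * ‖x‖ ^ (-(1 / 2) : ℝ) := by
      rw [← Real.rpow_add hx, sub_eq_add_neg]
    have h3 : 0 < ‖x‖ ^ s := by positivity
    simp only [Pi.smul_apply, Pi.add_apply, smul_eq_mul, e1, e2]
    rw [Real.norm_eq_abs, abs_mul, abs_of_pos h3]
    refine le_trans ?_ (le_abs_self _)
    nlinarith

theorem rbf_eq_rpow {m : ℕ} (h : 2 * (m : ℤ) - n < 0 ∨ Odd n) (x : E n) :
    rbf n m x = ‖x‖ ^ (2 * (m : ℝ) - n) := by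
  rw [rbf, if_pos h, ← Real.rpow_intCast]
  push_cast
  rfl

theorem rbf_eq_rpow_mul_log {m : ℕ} (h : ¬(2 * (m : ℤ) - n < 0 ∨ Odd n)) (x : E n) :
    rbf n m x = ‖x‖ ^ (2 * (m : ℝ) - n) * Real.log ‖x‖ := by
  rw [rbf, if_neg h, ← Real.rpow_intCast]
  push_cast
  rfl

theorem locallyIntegrable_rbf (hn : 1 ≤ n) {m : ℕ} (hm : 1 ≤ m) :
    LocallyIntegrable (rbf n m) := by
  have hm' : (1 : ℝ) ≤ m := by exact_mod_cast hm
  by_cases h : 2 * (m : ℤ) - n < 0 ∨ Odd n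
  · rw [show rbf n m = _ from funext (rbf_eq_rpow h)]
    exact locallyIntegrable_norm_rpow hn (by linarith)
  · rw [show rbf n m = _ from funext (rbf_eq_rpow_mul_log h)]
    refine locallyIntegrable_norm_rpow_mul_log hn ?_
    have h1 : 0 ≤ 2 * (m : ℤ) - n := by
      by_contra hlt
      exact h (Or.inl (by omega))
    exact_mod_cast h1

theorem abs_exp_sub_one_le_mul (x : ℝ) : |Real.exp x - 1| ≤ |x| * (1 + Real.exp x) := by
  have h1 := Real.add_one_le_exp x
  have h2 := Real.add_one_le_exp (-x)
  have h3 := Real.exp_pos x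
  have h4 : Real.exp (-x) * Real.exp x = 1 := by rw [← Real.exp_add]; simp
  have h5 : (-x + 1) * Real.exp x ≤ 1 := by nlinarith
  rcases le_total 0 x with hx | hx
  · rw [abs_of_nonneg (by linarith), abs_of_nonneg hx]
    nlinarith
  · have : Real.exp x ≤ 1 := Real.exp_le_one_iff.2 hx
    rw [abs_of_nonpos (by linarith), abs_of_nonpos hx]
    nlinarith

/-- A bound, uniform in `δ`, of the difference quotients of `t ↦ r^t` at `s`. -/
theorem abs_slope_rpow_le {r : ℝ} (hr : 0 < r) (s : ℝ) {δ : ℝ} (h0 : 0 < δ) (h1 : δ ≤ 1) :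
    |δ⁻¹ * (r ^ (s + δ) - r ^ s)| ≤ 2 * |r ^ s * Real.log r| + |r ^ (s + 1) * Real.log r| := by
  have e1 : r ^ (s + δ) - r ^ s = r ^ s * (Real.exp (δ * Real.log r) - 1) := by
    rw [Real.rpow_add hr, mul_sub, mul_one, Real.rpow_def_of_pos hr δ, mul_comm δ]
  have h2 := abs_exp_sub_one_le_mul (δ * Real.log r)
  have h3 : Real.exp (δ * Real.log r) ≤ 1 + r := by
    have := rpow_add_le hr 0 h0.le h1
    rw [zero_add, zero_add, Real.rpow_zero, Real.rpow_one] at this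
    rwa [Real.rpow_def_of_pos hr, mul_comm] at this
  have hs : 0 < r ^ s := by positivity
  rw [Real.rpow_add_one hr.ne', e1, abs_mul, abs_mul, abs_mul, abs_mul, abs_mul (r ^ s),
    abs_of_pos hs, abs_of_pos (inv_pos.2 h0), abs_of_pos hr]
  rw [abs_mul, abs_of_pos h0] at h2
  have h4 : δ⁻¹ * |Real.exp (δ * Real.log r) - 1| ≤ |Real.log r| * (2 + r) := by
    rw [inv_mul_le_iff₀ h0]
    refine h2.trans ?_
    rw [mul_assoc]
    have h5 : 1 + Real.exp (δ * Real.log r) ≤ 2 + r := by linarith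
    have h6 := abs_nonneg (Real.log r)
    gcongr
  calc δ⁻¹ * (r ^ s * |Real.exp (δ * Real.log r) - 1|)
      = r ^ s * (δ⁻¹ * |Real.exp (δ * Real.log r) - 1|) := by ring
    _ ≤ r ^ s * (|Real.log r| * (2 + r)) := by gcongr
    _ = _ := by ring

theorem tendsto_integral_norm_rpow_add (hn : 1 ≤ n) {s : ℝ} (hs : -(n : ℝ) < s) {η : E n → ℝ}
    (hη : IsTestFunction univ η) :
    Tendsto (fun δ : ℝ => ∫ x, ‖x‖ ^ (s + δ) * η x) (𝓝[>] 0) (𝓝 (∫ x, ‖x‖ ^ s * η x)) := by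
  have hi : Integrable fun x : E n => |(‖x‖ ^ s + ‖x‖ ^ (s + 1)) * η x| :=
    (hη.integrable_mul (((locallyIntegrable_norm_rpow hn hs).add
      (locallyIntegrable_norm_rpow hn (s := s + 1) (by linarith))).locallyIntegrableOn univ)).abs
  refine tendsto_integral_filter_of_dominated_convergence _ ?_ ?_ hi ?_
  · refine Eventually.of_forall fun δ => ?_
    exact ((measurable_norm.pow_const _).aestronglyMeasurable).mul
      hη.contDiff.continuous.aestronglyMeasurable
  · filter_upwards [Ioc_mem_nhdsGT (zero_lt_one' ℝ)] with δ hδ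
    filter_upwards [ae_norm_pos hn] with x hx
    have h1 : 0 ≤ ‖x‖ ^ (s + δ) := by positivity
    have h2 : 0 ≤ ‖x‖ ^ s + ‖x‖ ^ (s + 1) := by positivity
    rw [Real.norm_eq_abs, abs_mul, abs_mul, abs_of_nonneg h1, abs_of_nonneg h2]
    gcongr
    exact rpow_add_le hx s hδ.1.le hδ.2
  · filter_upwards [ae_norm_pos hn] with x hx
    have h1 : Tendsto (fun δ : ℝ => s + δ) (𝓝[>] 0) (𝓝 (s + 0)) :=
      (tendsto_const_nhds.add tendsto_id).mono_left nhdsWithin_le_nhds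
    rw [add_zero] at h1
    exact (((Real.continuous_const_rpow hx.ne').tendsto s).comp h1).mul_const _

theorem tendsto_slope_integral_norm_rpow (hn : 1 ≤ n) {s : ℝ} (hs : 0 ≤ s) {η : E n → ℝ}
    (hη : IsTestFunction univ η) :
    Tendsto (fun δ : ℝ => δ⁻¹ * ((∫ x, ‖x‖ ^ (s + δ) * η x) - ∫ x, ‖x‖ ^ s * η x)) (𝓝[>] 0)
      (𝓝 (∫ x, ‖x‖ ^ s * Real.log ‖x‖ * η x)) := by
  have hn' : (1 : ℝ) ≤ n := by exact_mod_cast hn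
  have hlog := fun t (ht : 0 ≤ t) => (hη.integrable_mul
    ((locallyIntegrable_norm_rpow_mul_log (n := n) hn (s := t) ht).locallyIntegrableOn univ)).abs
  have hi : Integrable fun x : E n => 2 * |‖x‖ ^ s * Real.log ‖x‖ * η x| +
      |‖x‖ ^ (s + 1) * Real.log ‖x‖ * η x| :=
    ((hlog s hs).const_mul 2).add (hlog (s + 1) (by linarith))
  have key : Tendsto (fun δ : ℝ => ∫ x, δ⁻¹ * (‖x‖ ^ (s + δ) - ‖x‖ ^ s) * η x) (𝓝[>] 0)
      (𝓝 (∫ x, ‖x‖ ^ s * Real.log ‖x‖ * η x)) := by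
    refine tendsto_integral_filter_of_dominated_convergence _ ?_ ?_ hi ?_
    · refine Eventually.of_forall fun δ => ?_
      exact ((((measurable_norm.pow_const _).sub (measurable_norm.pow_const _)).const_mul
        _).aestronglyMeasurable).mul hη.contDiff.continuous.aestronglyMeasurable
    · filter_upwards [Ioc_mem_nhdsGT (zero_lt_one' ℝ)] with δ hδ
      filter_upwards [ae_norm_pos hn] with x hx
      rw [Real.norm_eq_abs, abs_mul, abs_mul _ (η x), abs_mul _ (η x), ← mul_assoc, ← add_mul]
      exact mul_le_mul_of_nonneg_right (abs_slope_rpow_le hx s hδ.1 hδ.2) (abs_nonneg _)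
    · filter_upwards [ae_norm_pos hn] with x hx
      have h1 := (Real.hasStrictDerivAt_const_rpow hx s).hasDerivAt.tendsto_slope_zero
      have h2 := h1.mono_left (nhdsWithin_mono 0 (s := Ioi 0) (fun y (hy : 0 < y) => hy.ne'))
      simpa only [smul_eq_mul] using h2.mul_const (η x)
  refine key.congr' ?_
  filter_upwards [self_mem_nhdsWithin] with δ (hδ : 0 < δ)
  have i1 := hη.integrable_mul
    ((locallyIntegrable_norm_rpow hn (s := s + δ) (by linarith)).locallyIntegrableOn univ)
  have i2 := hη.integrable_mul
    ((locallyIntegrable_norm_rpow hn (s := s) (by linarith)).locallyIntegrableOn univ)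
  rw [← integral_sub i1 i2, ← integral_const_mul]
  refine integral_congr_ae (ae_of_all _ fun x => ?_)
  simp only
  ring

/-- `ψ_{2m-n}` is a nonzero multiple of a fundamental solution of `Δ^m`: the two sides of
`Δ^m ‖x‖^{2m-n+δ} = p(δ) q(δ) δ ‖x‖^{δ-n}` are compared as `δ → 0⁺`, to first order in `δ` where
`p` vanishes at `0`, which is the logarithmic case. -/
theorem exists_isFundamentalSolution_rbf (hn : 1 ≤ n) {m : ℕ} (hm : 1 ≤ m) :
    ∃ ϱ : ℝ, ϱ ≠ 0 ∧ IsFundamentalSolution m (fun x : E n => ϱ * rbf n m x) := by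
  suffices h : ∃ c : ℝ, c ≠ 0 ∧ ∀ η : E n → ℝ, IsTestFunction univ η →
      ∫ x, rbf n m x * polyLaplacian m η x = c * η 0 by
    obtain ⟨c, hc, h⟩ := h
    refine ⟨c⁻¹, inv_ne_zero hc, (locallyIntegrable_rbf hn hm).smul c⁻¹, fun η hη => ?_⟩
    simp_rw [mul_assoc]
    rw [integral_const_mul, h η hη, inv_mul_cancel_left₀ hc]
  obtain ⟨k, rfl⟩ : ∃ k, m = k + 1 := ⟨m - 1, by omega⟩
  set s : ℝ := 2 * ((k + 1 : ℕ) : ℝ) - n with hs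
  have hsn : -(n : ℝ) < s := by
    have : (0 : ℝ) ≤ k := Nat.cast_nonneg k
    rw [hs]
    push_cast
    linarith
  -- `q` omits the factor with index `k = m - 1`, which is equal to `δ`
  let p : ℝ → ℝ := fun δ => ∏ j ∈ Finset.range (k + 1), (s + δ - 2 * j)
  let q : ℝ → ℝ := fun δ => ∏ j ∈ Finset.range k, (s + δ - 2 * j + n - 2)
  have hI : ∀ η : E n → ℝ, IsTestFunction univ η → ∀ δ : ℝ, 0 < δ →
      ∫ x, ‖x‖ ^ (s + δ) * polyLaplacian (k + 1) η x =
        p δ * q δ * (δ * ∫ x, ‖x‖ ^ (δ - n) * η x) := by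
    intro η hη δ hδ
    rw [integral_norm_rpow_mul_polyLaplacian hn (k + 1) (by linarith) hη, Finset.prod_mul_distrib,
      Finset.prod_range_succ (fun j : ℕ => s + δ - 2 * (j : ℝ) + n - 2),
      show s + δ - 2 * ((k + 1 : ℕ) : ℝ) = δ - n by rw [hs]; ring,
      show s + δ - 2 * (k : ℝ) + n - 2 = δ by rw [hs]; push_cast; ring]
    ring
  have hqc : Continuous q := continuous_finsetProd _ fun j _ => by fun_prop
  have hpc : Continuous p := continuous_finsetProd _ fun j _ => by fun_prop
  have hq0 : q 0 ≠ 0 := by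
    refine Finset.prod_ne_zero_iff.2 fun j hj => ?_
    have h1 : (j : ℝ) + 1 ≤ k := by exact_mod_cast Finset.mem_range.1 hj
    rw [hs]
    push_cast
    intro h
    linarith
  have hlim : ∀ f : ℝ → ℝ, Continuous f → Tendsto f (𝓝[>] 0) (𝓝 (f 0)) := fun f hf =>
    (hf.tendsto 0).mono_left nhdsWithin_le_nhds
  have hval : ∀ η : E n → ℝ, IsTestFunction univ η →
      ∫ x, ‖x‖ ^ s * polyLaplacian (k + 1) η x = p 0 * q 0 * (sphereArea n * η 0) := by
    intro η hη
    refine tendsto_nhds_unique (tendsto_integral_norm_rpow_add hn hsn (hη.polyLap (k + 1))) ?_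
    refine (((hlim p hpc).mul (hlim q hqc)).mul (tendsto_mul_integral_norm_rpow hn hη)).congr' ?_
    filter_upwards [self_mem_nhdsWithin] with δ hδ
    exact (hI η hη δ hδ).symm
  by_cases hcase : 2 * ((k + 1 : ℕ) : ℤ) - n < 0 ∨ Odd n
  · -- no factor of `p 0` vanishes, because `2m - n` is negative or odd
    refine ⟨p 0 * q 0 * sphereArea n, ?_, fun η hη => ?_⟩
    · refine mul_ne_zero (mul_ne_zero (Finset.prod_ne_zero_iff.2 fun j hj => ?_) hq0)
        (sphereArea_pos hn).ne'
      have hj' := Finset.mem_range.1 hj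
      intro h0
      have h1 : (2 * ((k + 1 : ℕ) : ℤ) - n - 2 * j : ℤ) = 0 := by
        rw [hs, add_zero] at h0
        exact_mod_cast h0
      rcases hcase with h2 | ⟨l, hl⟩ <;> omega
    · simp_rw [rbf_eq_rpow hcase]
      rw [hval η hη, mul_assoc (p 0 * q 0)]
  · have hs0 : 0 ≤ s := by
      have h1 : 0 ≤ 2 * ((k + 1 : ℕ) : ℤ) - n := by
        by_contra hlt
        exact hcase (Or.inl (by omega))
      rw [hs]
      exact_mod_cast h1
    obtain ⟨l, hl⟩ : Even n := Nat.not_odd_iff_even.1 fun h => hcase (Or.inr h)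
    have hlk : 2 * ((k + 1 : ℕ) : ℤ) - n ≥ 0 := by
      by_contra hlt
      exact hcase (Or.inl (by omega))
    -- `p` has a simple zero at `0`, from the factor with index `m - n / 2`
    have hjr : k + 1 - l ∈ Finset.range (k + 1) := Finset.mem_range.2 (by omega)
    have hsj : s = 2 * ((k + 1 - l : ℕ) : ℝ) := by
      rw [hs, Nat.cast_sub (by omega), hl]
      push_cast
      ring
    let r : ℝ → ℝ := fun δ => ∏ j ∈ (Finset.range (k + 1)).erase (k + 1 - l), (s + δ - 2 * j)
    have hrc : Continuous r := continuous_finsetProd _ fun j _ => by fun_prop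
    have hpr : ∀ δ, p δ = δ * r δ := by
      intro δ
      have := Finset.mul_prod_erase (Finset.range (k + 1)) (fun j : ℕ => s + δ - 2 * (j : ℝ)) hjr
      simp only [p, r]
      rw [← this, hsj]
      ring
    have hr0 : r 0 ≠ 0 := by
      refine Finset.prod_ne_zero_iff.2 fun j hj h0 => (Finset.mem_erase.1 hj).1 ?_
      rw [hsj, add_zero, ← mul_sub] at h0
      have h1 : ((k + 1 - l : ℕ) : ℝ) = j := by linarith
      exact_mod_cast h1.symm
    refine ⟨r 0 * q 0 * sphereArea n, mul_ne_zero (mul_ne_zero hr0 hq0) (sphereArea_pos hn).ne',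
      fun η hη => ?_⟩
    simp_rw [rbf_eq_rpow_mul_log hcase]
    refine tendsto_nhds_unique (tendsto_slope_integral_norm_rpow hn hs0 (hη.polyLap (k + 1))) ?_
    rw [mul_assoc (r 0 * q 0)]
    refine (((hlim r hrc).mul (hlim q hqc)).mul (tendsto_mul_integral_norm_rpow hn hη)).congr' ?_
    filter_upwards [self_mem_nhdsWithin] with δ (hδ : 0 < δ)
    rw [hI η hη δ hδ, hval η hη, hpr, hpr]
    field_simp
    ring

/-! ### Growth of the radial basis function -/

theorem measurable_rbf (n m : ℕ) : Measurable (rbf n m) := by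
  by_cases h : 2 * (m : ℤ) - n < 0 ∨ Odd n
  · rw [show rbf n m = _ from funext (rbf_eq_rpow h)]
    exact measurable_norm.pow_const _
  · rw [show rbf n m = _ from funext (rbf_eq_rpow_mul_log h)]
    exact (measurable_norm.pow_const _).mul (Real.measurable_log.comp measurable_norm)

/-- At infinity, `ψ_{2m-n}` has comparable sizes at points of comparable norm. -/
theorem abs_rbf_le_of_comparable (n m : ℕ) : ∃ C : ℝ, 0 ≤ C ∧ ∀ y z : E n, 2 ≤ ‖y‖ →
    ‖y‖ / 2 ≤ ‖z‖ → ‖z‖ ≤ 2 * ‖y‖ → |rbf n m z| ≤ C * (1 + |rbf n m y|) := by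
  set s : ℝ := 2 * (m : ℝ) - n with hs
  refine ⟨1 + 2 ^ s * 2, by positivity, fun y z hy h1 h2 => ?_⟩
  have hz1 : 1 ≤ ‖z‖ := by linarith
  have hy0 : 0 < ‖y‖ := by linarith
  have h2s : (0 : ℝ) < 2 ^ s := by positivity
  have hpow : 0 ≤ s → ‖z‖ ^ s ≤ 2 ^ s * ‖y‖ ^ s := fun h => by
    rw [← Real.mul_rpow (by norm_num) hy0.le]
    exact Real.rpow_le_rpow (by positivity) h2 h
  have hys : 0 < ‖y‖ ^ s := by positivity
  have hzs : 0 < ‖z‖ ^ s := by positivity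
  by_cases h : 2 * (m : ℤ) - n < 0 ∨ Odd n
  · rw [rbf_eq_rpow h, rbf_eq_rpow h, ← hs, abs_of_pos hzs, abs_of_pos hys]
    rcases lt_or_ge s 0 with hneg | hpos
    · have : ‖z‖ ^ s ≤ 1 := Real.rpow_le_one_of_one_le_of_nonpos hz1 hneg.le
      nlinarith [mul_pos h2s hys]
    · have := hpow hpos
      nlinarith [mul_pos h2s hys]
  · have hpos : 0 ≤ s := by
      have h1 : 0 ≤ 2 * (m : ℤ) - n := by
        by_contra hlt
        exact h (Or.inl (by omega))
      rw [hs]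
      exact_mod_cast h1
    rw [rbf_eq_rpow_mul_log h, rbf_eq_rpow_mul_log h, ← hs]
    have hlz : 0 ≤ Real.log ‖z‖ := Real.log_nonneg hz1
    have hly : 0 ≤ Real.log ‖y‖ := Real.log_nonneg (by linarith)
    have hl : Real.log ‖z‖ ≤ 2 * Real.log ‖y‖ := by
      rw [← Real.log_rpow hy0]
      refine Real.log_le_log (by linarith) (h2.trans ?_)
      norm_num
      nlinarith
    rw [abs_of_nonneg (by positivity), abs_of_nonneg (by positivity)]
    have h3 : ‖z‖ ^ s * Real.log ‖z‖ ≤ (2 ^ s * ‖y‖ ^ s) * (2 * Real.log ‖y‖) :=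
      mul_le_mul (hpow hpos) hl hlz (by positivity)
    have h4 : 0 ≤ ‖y‖ ^ s * Real.log ‖y‖ := by positivity
    nlinarith [h2s]

/-- The weight `1 + |ψ_{2m-n}(y)| 1_{‖y‖ ≥ 1}` that controls local averages of `ψ_{2m-n}(· - y)`. -/
def momentWeight (n m : ℕ) (y : E n) : ℝ :=
  1 + {y : E n | 1 ≤ ‖y‖}.indicator (fun y => |rbf n m y|) y

theorem one_le_momentWeight (n m : ℕ) (y : E n) : 1 ≤ momentWeight n m y := by
  unfold momentWeight
  have := indicator_nonneg (s := {y : E n | 1 ≤ ‖y‖}) (fun y _ => abs_nonneg (rbf n m y)) y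
  linarith

theorem measurableSet_one_le_norm : MeasurableSet {y : E n | 1 ≤ ‖y‖} :=
  measurableSet_le measurable_const measurable_norm

theorem integrable_momentWeight_mul {m : ℕ} {p : E n → ℝ} (hp : Integrable p)
    (h : HasRbfMoment m p) : Integrable fun y => momentWeight n m y * |p y| := by
  have h1 := ((integrable_indicator_iff measurableSet_one_le_norm).2 h).abs
  refine (hp.abs.add h1).congr (ae_of_all _ fun y => ?_)
  by_cases hy : 1 ≤ ‖y‖
  · simp [momentWeight, indicator, hy, abs_mul, add_mul]
  · simp [momentWeight, indicator, hy]

/-- For `y` far away from the origin, `ψ_{2m-n}(x - y)` is bounded by a multiple of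
`1 + |ψ_{2m-n}(y)|` for all `x` in the ball, and for bounded `y` the integral is bounded because
`ψ_{2m-n}` is locally integrable. -/
theorem integral_closedBall_rbf_le (hn : 1 ≤ n) {m : ℕ} (hm : 1 ≤ m) (R : ℝ) (hR : 0 < R) :
    ∃ C : ℝ, 0 ≤ C ∧ ∀ y : E n,
      ∫ x in Metric.closedBall (0 : E n) R, |rbf n m (x - y)| ≤ C * momentWeight n m y := by
  obtain ⟨C, hC0, hC⟩ := abs_rbf_le_of_comparable n m
  have hloc := locallyIntegrable_rbf hn hm
  set V := (volume : Measure (E n)).real (Metric.closedBall 0 R)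
  set I := ∫ x in Metric.closedBall (0 : E n) (3 * R + 2), |rbf n m x|
  have hV : 0 ≤ V := measureReal_nonneg
  have hI : 0 ≤ I := integral_nonneg fun _ => abs_nonneg _
  refine ⟨C * V + I, by positivity, fun y => ?_⟩
  have hM := one_le_momentWeight n m y
  rcases le_or_gt (2 * R + 2) ‖y‖ with hy | hy
  · have hMy : momentWeight n m y = 1 + |rbf n m y| := by
      have : y ∈ {y : E n | 1 ≤ ‖y‖} := show 1 ≤ ‖y‖ by linarith
      rw [momentWeight, indicator_of_mem this]
    have h1 := norm_setIntegral_le_of_norm_le_const (μ := volume)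
      (s := Metric.closedBall (0 : E n) R) (f := fun x => |rbf n m (x - y)|)
      (C := C * momentWeight n m y) measure_closedBall_lt_top (fun x hx => by
        have hx' : ‖x‖ ≤ R := by simpa using hx
        have h2 := norm_sub_norm_le y x
        have h3 := norm_sub_le x y
        rw [norm_sub_rev] at h2
        rw [hMy, Real.norm_eq_abs, abs_abs]
        exact hC y (x - y) (by linarith) (by linarith) (by linarith))
    refine (le_abs_self _).trans ((Real.norm_eq_abs _).symm.le.trans (h1.trans ?_))
    change C * momentWeight n m y * V ≤ _
    nlinarith [mul_nonneg hI (zero_le_one.trans hM)]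
  · have h1 : ∫ x in Metric.closedBall (0 : E n) R, |rbf n m (x - y)| ≤ I := by
      rw [← integral_indicator measurableSet_closedBall,
        ← integral_add_right_eq_self _ y,
        show I = ∫ x, (Metric.closedBall (0 : E n) (3 * R + 2)).indicator (fun x => |rbf n m x|) x
          from (integral_indicator measurableSet_closedBall).symm]
      refine integral_mono_of_nonneg (ae_of_all _ fun x => indicator_nonneg
        (fun _ _ => abs_nonneg _) _) ((integrable_indicator_iff measurableSet_closedBall).2
        (hloc.integrableOn_isCompact (isCompact_closedBall _ _)).abs) (ae_of_all _ fun x => ?_)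
      simp only
      by_cases hx : x + y ∈ Metric.closedBall (0 : E n) R
      · have hx' : x ∈ Metric.closedBall (0 : E n) (3 * R + 2) := by
          rw [mem_closedBall_zero_iff] at hx ⊢
          have := norm_sub_le (x + y) y
          rw [add_sub_cancel_right] at this
          linarith
        rw [indicator_of_mem hx, indicator_of_mem hx', add_sub_cancel_right]
      · rw [indicator_of_notMem hx]
        exact indicator_nonneg (fun _ _ => abs_nonneg _) _
    refine h1.trans ?_
    nlinarith [mul_nonneg hC0 hV, mul_nonneg (mul_nonneg hC0 hV) (zero_le_one.trans hM)]

/-! ### Convolution with the radial basis function -/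

/-- `g` is measurable, bounded and of bounded support. -/
structure IsBoundedlySupported (g : E n → ℝ) : Prop where
  aestronglyMeasurable : AEStronglyMeasurable g
  exists_bound : ∃ R C : ℝ, 0 < R ∧ 0 ≤ C ∧
    ∀ x, |g x| ≤ (Metric.closedBall (0 : E n) R).indicator (fun _ => C) x

theorem IsTestFunction.isBoundedlySupported {X : Set (E n)} {η : E n → ℝ}
    (hη : IsTestFunction X η) : IsBoundedlySupported η := by
  refine ⟨hη.contDiff.continuous.aestronglyMeasurable, ?_⟩
  obtain ⟨M, hM⟩ := hη.contDiff.continuous.bounded_above_of_compact_support hη.2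
  obtain ⟨R, hR0, hR⟩ := hη.2.isBounded.exists_pos_norm_lt
  refine ⟨R, M, hR0, (norm_nonneg _).trans (hM 0), fun x => ?_⟩
  by_cases hx : x ∈ Metric.closedBall (0 : E n) R
  · rw [indicator_of_mem hx]
    exact hM x
  · have h1 : x ∉ tsupport η := fun h => hx (by simpa using (hR x h).le)
    rw [image_eq_zero_of_notMem_tsupport h1, abs_zero, indicator_of_notMem hx]

theorem isBoundedlySupported_indicator (R : ℝ) (hR : 0 < R) :
    IsBoundedlySupported ((Metric.closedBall (0 : E n) R).indicator fun _ => (1 : ℝ)) :=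
  ⟨(measurable_const.indicator measurableSet_closedBall).aestronglyMeasurable, R, 1, hR,
    zero_le_one, fun x => (abs_of_nonneg (indicator_nonneg (by simp) x)).le⟩

theorem IsBoundedlySupported.integrable_rbf_sub_mul (hn : 1 ≤ n) {m : ℕ} (hm : 1 ≤ m)
    {g : E n → ℝ} (hg : IsBoundedlySupported g) (y : E n) :
    Integrable fun x => rbf n m (x - y) * g x := by
  obtain ⟨R, C, hR, hC, hb⟩ := hg.2
  have hloc : LocallyIntegrable fun x => rbf n m (x - y) := by
    have h1 := (locallyIntegrable_rbf hn hm (n := n))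
    rw [locallyIntegrable_iff] at h1 ⊢
    intro K hK
    have h2 := h1 ((fun x => x - y) '' K) (hK.image (by fun_prop))
    have h3 : MeasurePreserving (fun x : E n => x - y) volume volume :=
      measurePreserving_sub_right volume y
    have h4 := (h3.integrableOn_comp_preimage
      (MeasurableEquiv.subRight y).measurableEmbedding).2 h2
    refine h4.mono_set fun x hx => ⟨x, hx, rfl⟩
  have hi : Integrable fun x => (Metric.closedBall (0 : E n) R).indicator
      (fun x => C * |rbf n m (x - y)|) x := (integrable_indicator_iff measurableSet_closedBall).2
    ((hloc.integrableOn_isCompact (isCompact_closedBall _ _)).abs.const_mul C)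
  refine hi.mono' (((measurable_rbf n m).comp
    (measurable_id.sub_const y)).aestronglyMeasurable.mul hg.1) (ae_of_all _ fun x => ?_)
  rw [Real.norm_eq_abs, abs_mul]
  have h1 := mul_le_mul_of_nonneg_left (hb x) (abs_nonneg (rbf n m (x - y)))
  refine h1.trans (le_of_eq ?_)
  by_cases hx : x ∈ Metric.closedBall (0 : E n) R
  · rw [indicator_of_mem hx, indicator_of_mem hx, mul_comm]
  · rw [indicator_of_notMem hx, indicator_of_notMem hx, mul_zero]

theorem IsBoundedlySupported.integral_abs_rbf_sub_mul_le (hn : 1 ≤ n) {m : ℕ} (hm : 1 ≤ m)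
    {g : E n → ℝ} (hg : IsBoundedlySupported g) : ∃ K : ℝ, 0 ≤ K ∧ ∀ y,
      ∫ x, |rbf n m (x - y) * g x| ≤ K * momentWeight n m y := by
  obtain ⟨R, C, hR, hC, hb⟩ := hg.2
  obtain ⟨K, hK0, hK⟩ := integral_closedBall_rbf_le hn hm R hR
  refine ⟨C * K, by positivity, fun y => ?_⟩
  have hi := ((isBoundedlySupported_indicator R hR).integrable_rbf_sub_mul hn hm y).abs.const_mul C
  calc ∫ x, |rbf n m (x - y) * g x|
      ≤ ∫ x, C * |rbf n m (x - y) *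
          (Metric.closedBall (0 : E n) R).indicator (fun _ => (1 : ℝ)) x| := by
        refine integral_mono_of_nonneg (ae_of_all _ fun _ => abs_nonneg _) hi
          (ae_of_all _ fun x => ?_)
        simp only
        rw [abs_mul, abs_mul]
        have h1 := mul_le_mul_of_nonneg_left (hb x) (abs_nonneg (rbf n m (x - y)))
        refine h1.trans (le_of_eq ?_)
        by_cases hx : x ∈ Metric.closedBall (0 : E n) R
        · rw [indicator_of_mem hx, indicator_of_mem hx, abs_one]; ring
        · rw [indicator_of_notMem hx, indicator_of_notMem hx]; simp
    _ = C * ∫ x in Metric.closedBall (0 : E n) R, |rbf n m (x - y)| := by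
        rw [integral_const_mul, ← integral_indicator measurableSet_closedBall]
        congr 1
        refine integral_congr_ae (ae_of_all _ fun x => ?_)
        by_cases hx : x ∈ Metric.closedBall (0 : E n) R <;> simp [indicator, hx]
    _ ≤ C * (K * momentWeight n m y) := by gcongr; exact hK y
    _ = _ := by ring

/-- The integrability that Fubini's theorem needs for the convolution of `q` with `ψ_{2m-n}`, tested
against `g`. -/
theorem IsBoundedlySupported.integrable_prod (hn : 1 ≤ n) {m : ℕ} (hm : 1 ≤ m) {g q : E n → ℝ}
    (hg : IsBoundedlySupported g) (hq : AEStronglyMeasurable q)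
    (hqM : Integrable fun y => momentWeight n m y * |q y|) :
    Integrable (fun z : E n × E n => q z.2 * (rbf n m (z.1 - z.2) * g z.1))
      (volume.prod volume) := by
  have hmeas : AEStronglyMeasurable (fun z : E n × E n => q z.2 * (rbf n m (z.1 - z.2) * g z.1))
      (volume.prod volume) :=
    hq.comp_snd.mul (((measurable_rbf n m).comp
      (measurable_fst.sub measurable_snd)).aestronglyMeasurable.mul hg.1.comp_fst)
  obtain ⟨K, hK0, hK⟩ := hg.integral_abs_rbf_sub_mul_le hn hm
  refine (integrable_prod_iff' hmeas).2 ⟨ae_of_all _ fun y =>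
    (hg.integrable_rbf_sub_mul hn hm y).const_mul (q y), ?_⟩
  refine (hqM.const_mul K).mono' hmeas.norm.prod_swap.integral_prod_right' (ae_of_all _ fun y => ?_)
  rw [Real.norm_of_nonneg (integral_nonneg fun _ => norm_nonneg _)]
  have e : ∀ x, ‖q y * (rbf n m (x - y) * g x)‖ = |q y| * |rbf n m (x - y) * g x| := fun x => by
    rw [Real.norm_eq_abs, abs_mul]
  simp_rw [e]
  rw [integral_const_mul]
  have := mul_le_mul_of_nonneg_left (hK y) (abs_nonneg (q y))
  linarith

section

variable {m : ℕ} {q : E n → ℝ}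

theorem convolutionExistsAt_ae (hn : 1 ≤ n) (hm : 1 ≤ m) (hq : AEStronglyMeasurable q)
    (hqM : Integrable fun y => momentWeight n m y * |q y|) (ϱ : ℝ) :
    ∀ᵐ x, ConvolutionExistsAt q (fun y => ϱ * rbf n m y) x (ContinuousLinearMap.mul ℝ ℝ)
      volume := by
  have h : ∀ᵐ x, ∀ k : ℕ, Integrable fun y => q y * (rbf n m (x - y) *
      (Metric.closedBall (0 : E n) (k + 1)).indicator (fun _ => (1 : ℝ)) x) :=
    ae_all_iff.2 fun k =>
      ((isBoundedlySupported_indicator (k + 1) (by positivity)).integrable_prod hn hm hq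
        hqM).prod_right_ae
  filter_upwards [h] with x hx
  obtain ⟨k, hk⟩ := exists_nat_ge ‖x‖
  have hxk : x ∈ Metric.closedBall (0 : E n) (k + 1) := by
    rw [mem_closedBall_zero_iff]
    linarith
  refine ((hx k).const_mul ϱ).congr (ae_of_all _ fun y => ?_)
  simp only [indicator_of_mem hxk, ContinuousLinearMap.mul_apply']
  ring

theorem locallyIntegrable_convolution_rbf (hn : 1 ≤ n) (hm : 1 ≤ m) (hq : AEStronglyMeasurable q)
    (hqM : Integrable fun y => momentWeight n m y * |q y|) (ϱ : ℝ) :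
    LocallyIntegrable (q ⋆[ContinuousLinearMap.mul ℝ ℝ] fun y => ϱ * rbf n m y) := by
  rw [locallyIntegrable_iff]
  intro K hK
  obtain ⟨R, hR0, hR⟩ := hK.isBounded.exists_pos_norm_lt
  have h := (((isBoundedlySupported_indicator R hR0).integrable_prod hn hm hq
    hqM).integral_prod_left).const_mul ϱ
  have h2 : IntegrableOn (q ⋆[ContinuousLinearMap.mul ℝ ℝ] fun y => ϱ * rbf n m y)
      (Metric.closedBall (0 : E n) R) := by
    refine (integrable_indicator_iff measurableSet_closedBall).1 (h.congr (ae_of_all _ fun x => ?_))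
    by_cases hx : x ∈ Metric.closedBall (0 : E n) R
    · simp only [indicator_of_mem hx, convolution_def, ContinuousLinearMap.mul_apply']
      rw [← integral_const_mul]
      refine integral_congr_ae (ae_of_all _ fun y => ?_)
      simp only
      ring
    · simp [indicator_of_notMem hx]
  exact h2.mono_set fun x hx => by simpa using (hR x hx).le

theorem integral_convolution_rbf_mul (hn : 1 ≤ n) (hm : 1 ≤ m) (hq : AEStronglyMeasurable q)
    (hqM : Integrable fun y => momentWeight n m y * |q y|) (ϱ : ℝ) {g : E n → ℝ}
    (hg : IsBoundedlySupported g) :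
    ∫ x, (q ⋆[ContinuousLinearMap.mul ℝ ℝ] fun y => ϱ * rbf n m y) x * g x =
      ∫ y, q y * ∫ x, ϱ * rbf n m (x - y) * g x := by
  have h1 : ∀ x, (q ⋆[ContinuousLinearMap.mul ℝ ℝ] fun y => ϱ * rbf n m y) x * g x =
      ∫ y, ϱ * (q y * (rbf n m (x - y) * g x)) := fun x => by
    rw [convolution_def, ← integral_mul_const]
    refine integral_congr_ae (ae_of_all _ fun y => ?_)
    simp only [ContinuousLinearMap.mul_apply']
    ring
  have h2 : ∀ y, q y * ∫ x, ϱ * rbf n m (x - y) * g x =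
      ∫ x, ϱ * (q y * (rbf n m (x - y) * g x)) := fun y => by
    rw [← integral_const_mul]
    refine integral_congr_ae (ae_of_all _ fun x => ?_)
    simp only
    ring
  simp_rw [h1, h2]
  exact integral_integral_swap ((hg.integrable_prod hn hm hq hqM).const_mul ϱ)

theorem integral_translate_mul_polyLaplacian {Φ : E n → ℝ} (hΦ : IsFundamentalSolution m Φ)
    {η : E n → ℝ} (hη : IsTestFunction univ η) (y : E n) :
    ∫ x, Φ (x - y) * polyLaplacian m η x = η y := by
  rw [← integral_add_right_eq_self _ y]
  have h := hΦ.2 _ (hη.comp_affine y (c := 1) one_ne_zero)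
  rw [polyLaplacian_comp_affine m hη.1] at h
  simp only [one_pow, one_mul, one_smul, smul_zero, add_zero] at h
  rw [← h]
  refine integral_congr_ae (ae_of_all _ fun x => ?_)
  simp only [add_sub_cancel_right]
  rw [add_comm y x]

theorem isWeakSolution_convolution (hn : 1 ≤ n) (hm : 1 ≤ m) (hq : AEStronglyMeasurable q)
    (hqM : Integrable fun y => momentWeight n m y * |q y|) {ϱ : ℝ}
    (hϱ : IsFundamentalSolution m fun x : E n => ϱ * rbf n m x) :
    IsWeakSolution m univ (q ⋆[ContinuousLinearMap.mul ℝ ℝ] fun y => ϱ * rbf n m y) q where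
  locallyIntegrable := (locallyIntegrable_convolution_rbf hn hm hq hqM ϱ).locallyIntegrableOn _
  integral_eq η hη := by
    rw [integral_convolution_rbf_mul hn hm hq hqM ϱ (hη.polyLap m).isBoundedlySupported]
    refine integral_congr_ae (ae_of_all _ fun y => ?_)
    simp only
    rw [integral_translate_mul_polyLaplacian hϱ hη y]

end

/-! ### Test functions obtained by convolution -/

theorem polyLaplacian_convolution (m : ℕ) {u φ : E n → ℝ} (hu : LocallyIntegrable u)
    (hφ : IsTestFunction univ φ) :
    polyLaplacian m (u ⋆[ContinuousLinearMap.mul ℝ ℝ] φ) =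
      u ⋆[ContinuousLinearMap.mul ℝ ℝ] polyLaplacian m φ := by
  funext x
  have hs : ContDiff ℝ ∞ (u ⋆[ContinuousLinearMap.mul ℝ ℝ] φ) :=
    hφ.2.contDiff_convolution_right _ hu hφ.1
  have hex : ∀ ψ : E n → ℝ, IsTestFunction univ ψ → Integrable fun t => u t * ψ (x - t) :=
    fun ψ hψ => hψ.2.convolutionExists_right (ContinuousLinearMap.mul ℝ ℝ) hu
      hψ.1.continuous x
  rw [polyLaplacian_eq_sum m hs, convolution_def]
  simp only [ContinuousLinearMap.mul_apply']
  have e : ∀ t, u t * polyLaplacian m φ (x - t) =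
      ∑ α ∈ Finset.piAntidiag (Finset.univ : Finset (Fin n)) m,
        multiCoeff m α * (u t * iteratedPartial α (iteratedPartial α φ) (x - t)) := fun t => by
    rw [polyLaplacian_eq_sum m hφ.1, Finset.mul_sum]
    exact Finset.sum_congr rfl fun α _ => by ring
  simp_rw [e]
  rw [integral_finsetSum _ fun α _ => (hex _ ((hφ.multiDeriv α).multiDeriv α)).const_mul _]
  refine Finset.sum_congr rfl fun α _ => ?_
  rw [integral_const_mul, iteratedPartial_convolution α hu hφ,
    iteratedPartial_convolution α hu (hφ.multiDeriv α)]
  rfl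

theorem IsTestFunction.convolution {u φ : E n → ℝ} (hu : LocallyIntegrable u)
    (hc : HasCompactSupport u) (hφ : IsTestFunction univ φ) :
    IsTestFunction univ (u ⋆[ContinuousLinearMap.mul ℝ ℝ] φ) :=
  ⟨hφ.2.contDiff_convolution_right _ hu hφ.1,
    hc.convolution (ContinuousLinearMap.mul ℝ ℝ) hφ.2, subset_univ _⟩

/-! ### A compactly supported parametrix -/

theorem contDiffAt_rbf (m : ℕ) {x : E n} (hx : x ≠ 0) : ContDiffAt ℝ ∞ (rbf n m) x := by
  have h0 : ‖x‖ ≠ 0 := norm_ne_zero_iff.2 hx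
  have hN : ContDiffAt ℝ ∞ (fun x : E n => ‖x‖) x := contDiffAt_norm ℝ hx
  by_cases h : 2 * (m : ℤ) - n < 0 ∨ Odd n
  · rw [show rbf n m = _ from funext (rbf_eq_rpow h)]
    exact hN.rpow_const_of_ne h0
  · rw [show rbf n m = _ from funext (rbf_eq_rpow_mul_log h)]
    exact (hN.rpow_const_of_ne h0).mul (hN.log h0)

/-- Cutting off a fundamental solution that is smooth away from the origin changes the equation
`Δ^m Φ = δ` by a test function. -/
theorem exists_parametrix {m : ℕ} {Φ χ : E n → ℝ} (hΦ : IsFundamentalSolution m Φ)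
    (hsm : ∀ x : E n, x ≠ 0 → ContDiffAt ℝ ∞ Φ x) (hχ : IsTestFunction univ χ)
    (hχ1 : ∀ x : E n, ‖x‖ ≤ 1 → χ x = 1) :
    ∃ Z : E n → ℝ, IsTestFunction univ Z ∧ tsupport Z ⊆ tsupport χ ∧
      ∀ ζ, IsTestFunction univ ζ →
        ∫ x, χ x * Φ x * polyLaplacian m ζ x = ζ 0 - ∫ x, Z x * ζ x := by
  let θ : ContDiffBump (0 : E n) := ⟨1 / 4, 1 / 2, by norm_num, by norm_num⟩
  let b : ContDiffBump (0 : E n) := ⟨1 / 8, 1 / 4, by norm_num, by norm_num⟩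
  have hθs : ContDiff ℝ ∞ (θ : E n → ℝ) := θ.contDiff
  have hbs : ContDiff ℝ ∞ (b : E n → ℝ) := b.contDiff
  -- the test function `ζ` is split as `θ ζ + (1 - θ) ζ`; the first summand only sees `Φ`, and the
  -- second one only sees the smooth function `S`, which agrees with `χ Φ` where `1 - θ ≠ 0`
  let S : E n → ℝ := fun x => (1 - b x) * (χ x * Φ x)
  have hS : ContDiff ℝ ∞ S := by
    rw [contDiff_iff_contDiffAt]
    intro x
    rcases eq_or_ne x 0 with rfl | hx
    · have : S =ᶠ[𝓝 0] fun _ => 0 := by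
        filter_upwards [Metric.ball_mem_nhds (0 : E n) (show (0 : ℝ) < 1 / 8 by norm_num)] with y hy
        have hb1 : b y = 1 := b.one_of_mem_closedBall (Metric.ball_subset_closedBall hy)
        simp [S, hb1]
      exact contDiffAt_const.congr_of_eventuallyEq this
    · exact (contDiffAt_const.sub hbs.contDiffAt).mul (hχ.1.contDiffAt.mul (hsm x hx))
  have hSχ : tsupport S ⊆ tsupport χ := by
    refine closure_mono fun x hx h => hx ?_
    simp only [S, h, zero_mul, mul_zero]
  let Z : E n → ℝ := fun x => -((1 - θ x) * polyLaplacian m S x)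
  have hZs : tsupport Z ⊆ tsupport χ := by
    refine Subset.trans ?_ ((tsupport_polyLaplacian_subset m S).trans hSχ)
    refine closure_mono fun x hx h => hx ?_
    simp only [Z, h, mul_zero, neg_zero]
  refine ⟨Z, ⟨((contDiff_const.sub hθs).mul (smooth_polyLaplacian m hS)).neg,
    hχ.2.of_isClosed_subset (isClosed_tsupport _) hZs, subset_univ _⟩, hZs, fun ζ hζ => ?_⟩
  have hin : IsTestFunction univ (fun x => θ x * ζ x) :=
    ⟨hθs.mul hζ.1, hζ.2.mul_left, subset_univ _⟩
  have hout : IsTestFunction univ (fun x => (1 - θ x) * ζ x) :=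
    ⟨(contDiff_const.sub hθs).mul hζ.1, hζ.2.mul_left, subset_univ _⟩
  have hsplit : polyLaplacian m ζ =
      polyLaplacian m (fun x => θ x * ζ x) + polyLaplacian m (fun x => (1 - θ x) * ζ x) := by
    rw [← polyLaplacian_add m hin.1 hout.1]
    congr 1
    funext x
    simp only [Pi.add_apply]
    ring
  have hχΦ : LocallyIntegrableOn (fun x => χ x * Φ x) univ :=
    (hΦ.1.integrable_smul_left_of_hasCompactSupport hχ.1.continuous
      hχ.2).locallyIntegrable.locallyIntegrableOn _
  have e1 : ∫ x, χ x * Φ x * polyLaplacian m (fun x => θ x * ζ x) x = ζ 0 := by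
    have h0 := hΦ.2 _ hin
    rw [θ.one_of_mem_closedBall (Metric.mem_closedBall_self θ.rIn_pos.le), one_mul] at h0
    rw [← h0]
    refine integral_congr_ae (ae_of_all _ fun x => ?_)
    simp only
    by_cases hx : ‖x‖ ≤ 1
    · rw [hχ1 x hx, one_mul]
    · have hx' : x ∉ tsupport (polyLaplacian m fun x => θ x * ζ x) := by
        intro hmem
        have h1 := (tsupport_mul_subset_left) (tsupport_polyLaplacian_subset m _ hmem)
        rw [θ.tsupport_eq, mem_closedBall_zero_iff] at h1
        have h2 : ‖x‖ ≤ 1 / 2 := h1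
        linarith
      rw [image_eq_zero_of_notMem_tsupport hx', mul_zero, mul_zero]
  have e2 : ∫ x, χ x * Φ x * polyLaplacian m (fun x => (1 - θ x) * ζ x) x = -∫ x, Z x * ζ x := by
    have h1 : ∀ x, χ x * Φ x * polyLaplacian m (fun x => (1 - θ x) * ζ x) x =
        S x * polyLaplacian m (fun x => (1 - θ x) * ζ x) x := by
      intro x
      by_cases hx : x ∈ tsupport (polyLaplacian m fun x => (1 - θ x) * ζ x)
      · have h2 : tsupport (fun x => (1 - θ x) * ζ x) ⊆ {x | 1 / 4 ≤ ‖x‖} := by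
          refine closure_minimal (fun y hy => ?_) (isClosed_le continuous_const continuous_norm)
          by_contra hlt
          refine hy ?_
          have h3 : θ y = 1 := θ.one_of_mem_closedBall (by
            rw [mem_closedBall_zero_iff]
            exact (not_le.1 hlt).le)
          simp [h3]
        have h4 : 1 / 4 ≤ ‖x‖ := h2 (tsupport_polyLaplacian_subset m _ hx)
        have h5 : b x = 0 := b.zero_of_le_dist (by rw [dist_zero_right]; exact h4)
        simp [S, h5]
      · rw [image_eq_zero_of_notMem_tsupport hx, mul_zero, mul_zero]
    simp_rw [h1]
    rw [integral_mul_polyLaplacian m (hS.of_le (WithTop.coe_le_coe.2 le_top)) hout.1 hout.2,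
      ← integral_neg]
    refine integral_congr_ae (ae_of_all _ fun x => ?_)
    simp only [Z]
    ring
  have i1 := (hin.polyLap m).integrable_mul hχΦ
  have i2 := (hout.polyLap m).integrable_mul hχΦ
  rw [sub_eq_add_neg, ← e1, ← e2, ← integral_add i1 i2, hsplit]
  refine integral_congr_ae (ae_of_all _ fun x => ?_)
  simp only [Pi.add_apply]
  ring

/-- The factor of `log R` in `ψ_{2m-n}(R x) / R^{2m-n}`. -/
def logPart (n m : ℕ) (x : E n) : ℝ :=
  if 2 * (m : ℤ) - n < 0 ∨ Odd n then 0 else (‖x‖ ^ 2) ^ (m - n / 2)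

theorem smooth_logPart (n m : ℕ) : ContDiff ℝ ∞ (logPart n m) := by
  unfold logPart
  split_ifs
  · exact contDiff_const
  · exact (contDiff_norm_sq ℝ).pow _

/-- Homogeneity of `ψ_{2m-n}` up to a logarithm. -/
theorem rbf_smul {m : ℕ} {R : ℝ} (hR : 0 < R) {x : E n} (hx : 0 < ‖x‖) :
    rbf n m (R • x) = R ^ (2 * (m : ℝ) - n) * (rbf n m x + Real.log R * logPart n m x) := by
  have hnorm : ‖R • x‖ = R * ‖x‖ := by rw [norm_smul, Real.norm_of_nonneg hR.le]
  by_cases h : 2 * (m : ℤ) - n < 0 ∨ Odd n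
  · rw [rbf_eq_rpow h, rbf_eq_rpow h, logPart, if_pos h, hnorm, Real.mul_rpow hR.le hx.le]
    ring
  · have h1 : n / 2 ≤ m := by
      by_contra hlt
      exact h (Or.inl (by omega))
    obtain ⟨l, hl⟩ : Even n := Nat.not_odd_iff_even.1 fun h' => h (Or.inr h')
    have h2 : (‖x‖ ^ 2) ^ (m - n / 2) = ‖x‖ ^ (2 * (m : ℝ) - n) := by
      rw [← pow_mul, ← Real.rpow_natCast]
      congr 1
      have : n / 2 = l := by omega
      rw [this] at h1 ⊢
      push_cast [h1]
      rw [hl]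
      push_cast
      ring
    rw [rbf_eq_rpow_mul_log h, rbf_eq_rpow_mul_log h, logPart, if_neg h, h2, hnorm,
      Real.mul_rpow hR.le hx.le, Real.log_mul hR.ne' hx.ne']
    ring

/-- The parametrices `χ(x / R) Φ(x)` at all scales `R`. Because `ψ_{2m-n}` is homogeneous up to a
logarithm, their errors are dilates of two fixed test functions. -/
theorem exists_scaled_parametrix (hn : 1 ≤ n) {m : ℕ} {ϱ : ℝ}
    (hϱ : IsFundamentalSolution m fun x : E n => ϱ * rbf n m x) {χ : E n → ℝ}
    (hχ : IsTestFunction univ χ) (hχ1 : ∀ x : E n, ‖x‖ ≤ 1 → χ x = 1) :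
    ∃ Z Y : E n → ℝ, IsTestFunction univ Z ∧ IsTestFunction univ Y ∧
      tsupport Z ⊆ tsupport χ ∧ tsupport Y ⊆ tsupport χ ∧
      ∀ R : ℝ, 0 < R → ∀ ζ, IsTestFunction univ ζ →
        ∫ x, χ (R⁻¹ • x) * (ϱ * rbf n m x) * polyLaplacian m ζ x =
          ζ 0 - ∫ x, (R ^ n)⁻¹ * (Z (R⁻¹ • x) + Real.log R * Y (R⁻¹ • x)) * ζ x := by
  obtain ⟨Z, hZ, hZs, hZi⟩ := exists_parametrix hϱ
    (fun x hx => contDiffAt_const.mul (contDiffAt_rbf m hx)) hχ hχ1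
  let T : E n → ℝ := fun x => χ x * (ϱ * logPart n m x)
  have hT : IsTestFunction univ T :=
    ⟨hχ.1.mul (contDiff_const.mul (smooth_logPart n m)), hχ.2.mul_right, subset_univ _⟩
  have hTs : tsupport T ⊆ tsupport χ := by
    refine closure_mono fun x hx h => hx ?_
    simp only [T, h, zero_mul]
  let Y : E n → ℝ := fun x => -polyLaplacian m T x
  have hYs : tsupport Y ⊆ tsupport χ := by
    refine Subset.trans ?_ ((tsupport_polyLaplacian_subset m T).trans hTs)
    refine closure_mono fun x hx h => hx ?_
    simp only [Y, h, neg_zero]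
  have hY : IsTestFunction univ Y := ⟨(smooth_polyLaplacian m hT.1).neg,
    hχ.2.of_isClosed_subset (isClosed_tsupport _) hYs, subset_univ _⟩
  refine ⟨Z, Y, hZ, hY, hZs, hYs, fun R hR ζ hζ => ?_⟩
  have hζR : IsTestFunction univ (fun x => ζ (R • x)) := by
    simpa using hζ.comp_affine 0 hR.ne'
  have hΔ : polyLaplacian m (fun x => ζ (R • x)) =
      fun x => R ^ (2 * m) * polyLaplacian m ζ (R • x) := by
    simpa using polyLaplacian_comp_affine m hζ.1 0 R
  have h1 := hZi _ hζR
  have h2 : ∫ x, T x * polyLaplacian m (fun x => ζ (R • x)) x = -∫ x, Y x * ζ (R • x) := by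
    rw [integral_mul_polyLaplacian m (hT.1.of_le (WithTop.coe_le_coe.2 le_top)) hζR.1 hζR.2,
      ← integral_neg]
    simp only [Y, neg_mul, neg_neg]
  have hχΦ : LocallyIntegrableOn (fun x => χ x * (ϱ * rbf n m x)) univ :=
    (hϱ.1.integrable_smul_left_of_hasCompactSupport hχ.1.continuous
      hχ.2).locallyIntegrable.locallyIntegrableOn _
  have i1 := (hζR.polyLap m).integrable_mul hχΦ
  have i2 := (hζR.polyLap m).integrable_mul
    (hT.1.continuous.locallyIntegrable.locallyIntegrableOn _)
  have i3 := hζR.integrable_mul (hZ.1.continuous.locallyIntegrable.locallyIntegrableOn _)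
  have i4 := hζR.integrable_mul (hY.1.continuous.locallyIntegrable.locallyIntegrableOn _)
  have hfin : Module.finrank ℝ (E n) = n := finrank_euclideanSpace_fin
  -- substitute `x = R z` on both sides
  have s1 := Measure.integral_comp_inv_smul_of_nonneg (volume : Measure (E n))
    (fun z => χ z * (ϱ * rbf n m (R • z)) * polyLaplacian m ζ (R • z)) hR.le
  have s2 := Measure.integral_comp_inv_smul_of_nonneg (volume : Measure (E n))
    (fun z => (R ^ n)⁻¹ * (Z z + Real.log R * Y z) * ζ (R • z)) hR.le
  simp only [smul_inv_smul₀ hR.ne', hfin, smul_eq_mul] at s1 s2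
  rw [s1, s2]
  have hRn : R ^ n * R ^ (2 * (m : ℝ) - n) = R ^ (2 * m) := by
    rw [← Real.rpow_natCast R n, ← Real.rpow_add hR, ← Real.rpow_natCast R (2 * m)]
    congr 1
    push_cast
    ring
  have e1 : R ^ n * ∫ z, χ z * (ϱ * rbf n m (R • z)) * polyLaplacian m ζ (R • z) =
      (∫ z, χ z * (ϱ * rbf n m z) * polyLaplacian m (fun x => ζ (R • x)) z) +
        Real.log R * ∫ z, T z * polyLaplacian m (fun x => ζ (R • x)) z := by
    rw [← integral_const_mul, ← integral_const_mul, ← integral_add i1 (i2.const_mul _)]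
    refine integral_congr_ae ?_
    filter_upwards [ae_norm_pos hn] with z hz
    rw [rbf_smul hR hz, hΔ, ← hRn]
    simp only [T]
    ring
  have e2 : R ^ n * ∫ z, (R ^ n)⁻¹ * (Z z + Real.log R * Y z) * ζ (R • z) =
      (∫ z, Z z * ζ (R • z)) + Real.log R * ∫ z, Y z * ζ (R • z) := by
    rw [← integral_const_mul, ← integral_const_mul, ← integral_add i3 (i4.const_mul _)]
    refine integral_congr_ae (ae_of_all _ fun z => ?_)
    simp only
    field_simp
  rw [e1, e2, h1, h2, smul_zero]
  ring

/-! ### Liouville's theorem in the Beppo-Levi space -/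

/-- The dilate `R^{-n} (Z(x / R) + log R · Y(x / R))`, the form of the error of a parametrix at
scale `R`. -/
def dilatedError (Z Y : E n → ℝ) (R : ℝ) (x : E n) : ℝ :=
  (R ^ n)⁻¹ * (Z (R⁻¹ • x) + Real.log R * Y (R⁻¹ • x))

theorem IsTestFunction.dilatedError {Z Y : E n → ℝ} (hZ : IsTestFunction univ Z)
    (hY : IsTestFunction univ Y) {R : ℝ} (hR : 0 < R) :
    IsTestFunction univ (dilatedError Z Y R) := by
  have h1 : IsTestFunction univ (fun x => Z (R⁻¹ • x)) := by
    simpa using hZ.comp_affine 0 (inv_ne_zero hR.ne')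
  have h2 : IsTestFunction univ (fun x => Y (R⁻¹ • x)) := by
    simpa using hY.comp_affine 0 (inv_ne_zero hR.ne')
  have h3 : HasCompactSupport fun x : E n => Real.log R * Y (R⁻¹ • x) := h2.2.mul_left
  exact ⟨contDiff_const.mul (h1.1.add (contDiff_const.mul h2.1)),
    (h1.2.add h3).mul_left, subset_univ _⟩

theorem tendsto_one_add_log_sq_div_sqrt :
    Tendsto (fun R : ℝ => (1 + Real.log R) ^ 2 * R ^ (-(1 / 2) : ℝ)) atTop (𝓝 0) := by
  have h1 := (isLittleO_log_rpow_atTop (show (0 : ℝ) < 1 / 4 by norm_num)).tendsto_div_nhds_zero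
  have h2 := tendsto_rpow_neg_atTop (show (0 : ℝ) < 1 / 4 by norm_num)
  have h3 := ((h2.add h1).pow 2)
  rw [add_zero, zero_pow two_ne_zero] at h3
  refine h3.congr' ?_
  filter_upwards [eventually_gt_atTop 0] with R hR
  have e : R ^ (-(1 / 2) : ℝ) = (R ^ (-(1 / 4) : ℝ)) ^ 2 := by
    rw [← Real.rpow_natCast, ← Real.rpow_mul hR.le]
    norm_num
  have e2 : Real.log R / R ^ (1 / 4 : ℝ) = Real.log R * R ^ (-(1 / 4) : ℝ) := by
    rw [Real.rpow_neg hR.le, ← div_eq_mul_inv]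
  rw [e, e2]
  ring

/-- The convolution of a dilated error with `η` is of size `R^{-n} (1 + log R)` and lives on a ball
of radius `O(R)`. -/
theorem abs_convolution_dilatedError_le {Z Y η : E n → ℝ} {C r : ℝ} (hZ : ∀ x, |Z x| ≤ C)
    (hY : ∀ x, |Y x| ≤ C) (hZs : tsupport Z ⊆ Metric.closedBall 0 2)
    (hYs : tsupport Y ⊆ Metric.closedBall 0 2) (hη : Integrable η)
    (hr0 : 0 < r) (hr : ∀ x, η x ≠ 0 → ‖x‖ ≤ r) {R : ℝ} (hR : 1 ≤ R) (x : E n) :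
    |(dilatedError Z Y R ⋆[ContinuousLinearMap.mul ℝ ℝ] η) x| ≤
      (Metric.closedBall (0 : E n) ((2 + r) * R)).indicator
        (fun _ => (R ^ n)⁻¹ * (C * (1 + Real.log R)) * ∫ y, |η y|) x := by
  have hR0 : 0 < R := by linarith
  have hlog : 0 ≤ Real.log R := Real.log_nonneg hR
  have hsupp : ∀ t, 2 * R < ‖t‖ → dilatedError Z Y R t = 0 := by
    intro t ht
    have h1 : R⁻¹ • t ∉ Metric.closedBall (0 : E n) 2 := by
      rw [mem_closedBall_zero_iff, norm_smul, Real.norm_of_nonneg (by positivity), not_le,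
        ← div_eq_inv_mul, lt_div_iff₀ hR0]
      exact ht
    rw [dilatedError, image_eq_zero_of_notMem_tsupport fun h => h1 (hZs h),
      image_eq_zero_of_notMem_tsupport fun h => h1 (hYs h)]
    ring
  by_cases hx : x ∈ Metric.closedBall (0 : E n) ((2 + r) * R)
  · rw [indicator_of_mem hx, convolution_def]
    have hb : ∀ t, |dilatedError Z Y R t| ≤ (R ^ n)⁻¹ * (C * (1 + Real.log R)) := by
      intro t
      rw [dilatedError, abs_mul, abs_of_pos (by positivity : 0 < (R ^ n)⁻¹)]
      gcongr
      refine (abs_add_le _ _).trans ?_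
      rw [abs_mul, abs_of_nonneg hlog]
      nlinarith [hZ (R⁻¹ • t), mul_le_mul_of_nonneg_left (hY (R⁻¹ • t)) hlog]
    have hi : Integrable fun t => |η (x - t)| := (hη.comp_sub_left x).abs
    have h1 := norm_integral_le_of_norm_le (μ := volume)
      (f := fun t => (ContinuousLinearMap.mul ℝ ℝ) (dilatedError Z Y R t) (η (x - t)))
      (hi.const_mul ((R ^ n)⁻¹ * (C * (1 + Real.log R)))) (ae_of_all _ fun t => by
        rw [ContinuousLinearMap.mul_apply', Real.norm_eq_abs, abs_mul]
        exact mul_le_mul_of_nonneg_right (hb t) (abs_nonneg _))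
    rw [integral_const_mul, integral_sub_left_eq_self (fun y => |η y|)] at h1
    exact h1
  · rw [indicator_of_notMem hx, convolution_def]
    have h0 : ∀ t, (ContinuousLinearMap.mul ℝ ℝ) (dilatedError Z Y R t) (η (x - t)) = 0 := by
      intro t
      rw [ContinuousLinearMap.mul_apply']
      by_cases h1 : 2 * R < ‖t‖
      · rw [hsupp t h1, zero_mul]
      · have h2 : η (x - t) = 0 := by
          by_contra h3
          have h4 := hr _ h3
          refine hx (mem_closedBall_zero_iff.2 ?_)
          have h5 := norm_add_le (x - t) t
          rw [sub_add_cancel] at h5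
          nlinarith
        rw [h2, mul_zero]
    simp [h0]

/-- The error of a parametrix tends to zero when tested against a square integrable function: its
dilates at scale `R` have `L²` norm `O(R^{-n/2} log R)`. -/
theorem tendsto_integral_mul_convolution_dilatedError (hn : 1 ≤ n) {g Z Y η : E n → ℝ}
    (hg : MemLp g 2) (hZ : IsTestFunction univ Z) (hY : IsTestFunction univ Y)
    (hZs : tsupport Z ⊆ Metric.closedBall 0 2) (hYs : tsupport Y ⊆ Metric.closedBall 0 2)
    (hη : IsTestFunction univ η) :
    Tendsto (fun R : ℝ => ∫ x, g x * (dilatedError Z Y R ⋆[ContinuousLinearMap.mul ℝ ℝ] η) x)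
      atTop (𝓝 0) := by
  obtain ⟨C₁, hC₁⟩ := hZ.1.continuous.bounded_above_of_compact_support hZ.2
  obtain ⟨C₂, hC₂⟩ := hY.1.continuous.bounded_above_of_compact_support hY.2
  obtain ⟨r, hr0, hr⟩ := hη.2.isBounded.exists_pos_norm_lt
  have hηi : Integrable η := hη.1.continuous.integrable_of_hasCompactSupport hη.2
  set C := max C₁ C₂
  set A := ∫ y, |η y|
  set V := (volume : Measure (E n)).real (Metric.closedBall 0 1)
  set K := (C * A) ^ 2 * (2 + r) ^ n * V
  have hg2 : Integrable fun x => g x ^ 2 := hg.integrable_sq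
  set G := ∫ x, g x ^ 2
  have hV : 0 ≤ V := measureReal_nonneg
  have hlim : Tendsto (fun R : ℝ => 1 / 2 * (R ^ (-(1 / 2) : ℝ) * G +
      K * ((1 + Real.log R) ^ 2 * R ^ (-(1 / 2) : ℝ)))) atTop (𝓝 0) := by
    have h1 := (tendsto_rpow_neg_atTop (show (0 : ℝ) < 1 / 2 by norm_num)).mul_const G
    have h2 := tendsto_one_add_log_sq_div_sqrt.const_mul K
    have h3 := (h1.add h2).const_mul (1 / 2 : ℝ)
    rw [zero_mul, mul_zero, add_zero, mul_zero] at h3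
    exact h3
  refine squeeze_zero_norm' ?_ hlim
  filter_upwards [eventually_ge_atTop 1] with R hR
  have hR0 : 0 < R := by linarith
  set S := (R ^ n)⁻¹ * (C * (1 + Real.log R)) * A with hS
  set κ : ℝ := R ^ (-(1 / 2) : ℝ) with hκ
  have hκ0 : 0 < κ := by positivity
  set B := Metric.closedBall (0 : E n) ((2 + r) * R)
  have hh := abs_convolution_dilatedError_le (C := C) (r := r)
    (fun x => (hC₁ x).trans (le_max_left _ _)) (fun x => (hC₂ x).trans (le_max_right _ _)) hZs hYs
    hηi hr0 (fun x hx => (hr x (subset_tsupport η hx)).le) hR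
  have hBi : Integrable (B.indicator fun _ => S ^ 2) :=
    (integrable_indicator_iff measurableSet_closedBall).2
      (integrableOn_const measure_closedBall_lt_top.ne)
  -- `2 |a b| ≤ κ a² + κ⁻¹ b²` with `κ = R^{-1/2}`
  have hpt : ∀ x, ‖g x * (dilatedError Z Y R ⋆[ContinuousLinearMap.mul ℝ ℝ] η) x‖ ≤
      1 / 2 * (κ * g x ^ 2 + κ⁻¹ * B.indicator (fun _ => S ^ 2) x) := by
    intro x
    rw [Real.norm_eq_abs, abs_mul]
    have h1 : |(dilatedError Z Y R ⋆[ContinuousLinearMap.mul ℝ ℝ] η) x| ^ 2 ≤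
        B.indicator (fun _ => S ^ 2) x := by
      have h2 := hh x
      by_cases hx : x ∈ B
      · rw [indicator_of_mem hx] at h2 ⊢
        exact pow_le_pow_left₀ (abs_nonneg _) h2 2
      · rw [indicator_of_notMem hx] at h2 ⊢
        rw [le_antisymm h2 (abs_nonneg _)]
        norm_num
    set b := |(dilatedError Z Y R ⋆[ContinuousLinearMap.mul ℝ ℝ] η) x|
    have h3 : κ⁻¹ * b ^ 2 ≤ κ⁻¹ * B.indicator (fun _ => S ^ 2) x :=
      mul_le_mul_of_nonneg_left h1 (by positivity)
    have h4 : 2 * (|g x| * b) ≤ κ * g x ^ 2 + κ⁻¹ * b ^ 2 := by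
      have h5 : 0 ≤ κ⁻¹ * (κ * |g x| - b) ^ 2 := by positivity
      have h6 : κ⁻¹ * (κ * |g x| - b) ^ 2 = κ * g x ^ 2 + κ⁻¹ * b ^ 2 - 2 * (|g x| * b) := by
        rw [← sq_abs (g x)]
        field_simp
        ring
      linarith
    linarith
  refine (norm_integral_le_of_norm_le (((hg2.const_mul κ).add
    (hBi.const_mul κ⁻¹)).const_mul (1 / 2)) (ae_of_all _ hpt)).trans ?_
  simp only [Pi.add_apply]
  rw [integral_const_mul, integral_add (hg2.const_mul κ) (hBi.const_mul κ⁻¹), integral_const_mul,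
    integral_const_mul, integral_indicator measurableSet_closedBall, setIntegral_const, smul_eq_mul]
  refine mul_le_mul_of_nonneg_left (add_le_add le_rfl ?_) (by norm_num)
  -- `R^n` from the volume cancels one factor `R^{-n}`; the other one is at most `κ²` as `n ≥ 1`
  have hvol : (volume : Measure (E n)).real B = ((2 + r) * R) ^ n * V := by
    rw [Measure.addHaar_real_closedBall' _ _ (by positivity), finrank_euclideanSpace_fin]
  have hRn : R ≤ R ^ n := by
    calc R = R ^ 1 := (pow_one R).symm
      _ ≤ R ^ n := pow_le_pow_right₀ hR hn
  have hκR : κ⁻¹ * (R ^ n)⁻¹ ≤ κ := by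
    have h1 : R⁻¹ = κ * κ := by
      rw [hκ, ← Real.rpow_add hR0, ← Real.rpow_neg_one]
      norm_num
    have h2 : (R ^ n)⁻¹ ≤ κ * κ := h1 ▸ inv_anti₀ hR0 hRn
    rw [inv_mul_le_iff₀ hκ0]
    exact h2
  rw [hvol]
  have hK : 0 ≤ K * (1 + Real.log R) ^ 2 := by positivity
  calc κ⁻¹ * (((2 + r) * R) ^ n * V * S ^ 2)
      = K * (1 + Real.log R) ^ 2 * (κ⁻¹ * (R ^ n)⁻¹) := by
        rw [hS, mul_pow]
        simp only [K]
        field_simp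
    _ ≤ K * (1 + Real.log R) ^ 2 * κ := mul_le_mul_of_nonneg_left hκR hK
    _ = _ := by ring

theorem rbf_sub_comm (m : ℕ) (x y : E n) : rbf n m (x - y) = rbf n m (y - x) := by
  simp only [rbf, norm_sub_rev x y]

/-- Truncating the fundamental solution at scale `k + 1` does not change the pairing of its
convolution with `θ` and `q` in the limit. -/
theorem tendsto_integral_mul_convolution_cutoff (hn : 1 ≤ n) {m : ℕ} (hm : 1 ≤ m)
    {q χ θ : E n → ℝ} (hq : AEStronglyMeasurable q)
    (hqM : Integrable fun y => momentWeight n m y * |q y|) (ϱ : ℝ)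
    (hχ : IsTestFunction univ χ) (hχ1 : ∀ x : E n, ‖x‖ ≤ 1 → χ x = 1) (hχb : ∀ x, |χ x| ≤ 1)
    (hθ : IsTestFunction univ θ) :
    Tendsto (fun k : ℕ => ∫ x, q x *
        ((fun y => χ ((k + 1 : ℝ)⁻¹ • y) * (ϱ * rbf n m y)) ⋆[ContinuousLinearMap.mul ℝ ℝ] θ) x)
      atTop (𝓝 (∫ y, q y * ∫ x, ϱ * rbf n m (x - y) * θ x)) := by
  obtain ⟨K, hK0, hK⟩ := hθ.isBoundedlySupported.integral_abs_rbf_sub_mul_le hn hm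
  obtain ⟨r, hr0, hr⟩ := hθ.2.isBounded.exists_pos_norm_lt
  have hχs : ∀ k : ℕ, IsTestFunction univ fun y : E n => χ ((k + 1 : ℝ)⁻¹ • y) := fun k => by
    simpa using hχ.comp_affine 0 (c := (k + 1 : ℝ)⁻¹) (by positivity)
  have hl : LocallyIntegrable fun y : E n => ϱ * rbf n m y := (locallyIntegrable_rbf hn hm).smul ϱ
  have hA : ∀ k : ℕ, LocallyIntegrable fun y => χ ((k + 1 : ℝ)⁻¹ • y) * (ϱ * rbf n m y) :=
    fun k => by
      have h := hl.integrable_smul_left_of_hasCompactSupport (hχs k).1.continuous (hχs k).2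
      exact h.locallyIntegrable
  refine tendsto_integral_of_dominated_convergence
    (fun y => |ϱ| * K * (momentWeight n m y * |q y|)) ?_ (hqM.const_mul _) ?_ ?_
  · intro k
    exact hq.mul (hθ.2.contDiff_convolution_right _ (hA k) hθ.1).continuous.aestronglyMeasurable
  · intro k
    refine ae_of_all _ fun x => ?_
    have h1 : |((fun y => χ ((k + 1 : ℝ)⁻¹ • y) * (ϱ * rbf n m y))
        ⋆[ContinuousLinearMap.mul ℝ ℝ] θ) x| ≤ |ϱ| * (K * momentWeight n m x) := by
      rw [convolution_eq_swap]
      have hi := (hθ.isBoundedlySupported.integrable_rbf_sub_mul hn hm x).abs.const_mul |ϱ|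
      have hle : ∀ u, ‖(ContinuousLinearMap.mul ℝ ℝ)
          (χ ((k + 1 : ℝ)⁻¹ • (x - u)) * (ϱ * rbf n m (x - u))) (θ u)‖ ≤
            |ϱ| * |rbf n m (u - x) * θ u| := by
        intro u
        rw [ContinuousLinearMap.mul_apply', Real.norm_eq_abs, rbf_sub_comm m x u, abs_mul, abs_mul,
          abs_mul, abs_mul]
        have h2 := hχb ((k + 1 : ℝ)⁻¹ • (x - u))
        have h3 : 0 ≤ |ϱ| * |rbf n m (u - x)| * |θ u| := by positivity
        nlinarith
      refine (norm_integral_le_of_norm_le hi (ae_of_all _ hle)).trans ?_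
      rw [integral_const_mul]
      exact mul_le_mul_of_nonneg_left (hK x) (abs_nonneg _)
    rw [Real.norm_eq_abs, abs_mul]
    have := mul_le_mul_of_nonneg_left h1 (abs_nonneg (q x))
    linarith
  · refine ae_of_all _ fun x => Tendsto.const_mul _ (tendsto_const_nhds.congr' ?_)
    obtain ⟨N, hN⟩ := exists_nat_ge (‖x‖ + r)
    filter_upwards [eventually_ge_atTop N] with k hk
    rw [convolution_eq_swap]
    refine integral_congr_ae (ae_of_all _ fun u => ?_)
    simp only [ContinuousLinearMap.mul_apply']
    by_cases hu : u ∈ tsupport θ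
    · have h1 : ‖(k + 1 : ℝ)⁻¹ • (x - u)‖ ≤ 1 := by
        have h2 := norm_sub_le x u
        have h3 := hr u hu
        have h4 : (N : ℝ) ≤ k := by exact_mod_cast hk
        have h5 : (0 : ℝ) < k + 1 := by positivity
        rw [norm_smul, Real.norm_of_nonneg (by positivity), inv_mul_le_iff₀ h5]
        linarith
      rw [hχ1 _ h1, one_mul, rbf_sub_comm m x u]
    · rw [image_eq_zero_of_notMem_tsupport hu, mul_zero, mul_zero]

/-- The derivatives of order `m` of a solution are those of the convolution with the fundamental
solution as soon as they are square integrable. With the parametrix `A_R = χ(x / R) Φ` and its error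
`W_R`, one has `∂^α η = Δ^m (A_R * ∂^α η) + ∂^α (W_R * η)`. Tested against `D`, the first summand
gives `∫ q (A_R * ∂^α η)` and the second one `± ∫ ∂^α D (W_R * η)`, which tends to zero. -/
theorem IsWeakSolution.integral_mul_iteratedPartial (hn : 1 ≤ n) {m : ℕ} (hm : 1 ≤ m)
    {q D g : E n → ℝ} {α : Fin n → ℕ} (hq : AEStronglyMeasurable q)
    (hqM : Integrable fun y => momentWeight n m y * |q y|) {ϱ : ℝ}
    (hϱ : IsFundamentalSolution m fun x : E n => ϱ * rbf n m x)
    (hD : IsWeakSolution m univ D q) (hDg : HasWeakPartial univ α D g) (hg : MemLp g 2)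
    {η : E n → ℝ} (hη : IsTestFunction univ η) :
    ∫ x, D x * iteratedPartial α η x =
      ∫ x, (q ⋆[ContinuousLinearMap.mul ℝ ℝ] fun y => ϱ * rbf n m y) x *
        iteratedPartial α η x := by
  let χ : ContDiffBump (0 : E n) := ⟨1, 2, one_pos, one_lt_two⟩
  have hχ : IsTestFunction univ (χ : E n → ℝ) :=
    ⟨χ.contDiff, χ.hasCompactSupport, subset_univ _⟩
  have hχ1 : ∀ x : E n, ‖x‖ ≤ 1 → χ x = 1 := fun x hx =>
    χ.one_of_mem_closedBall (mem_closedBall_zero_iff.2 hx)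
  have hχb : ∀ x, |χ x| ≤ 1 := fun x => by
    rw [abs_of_nonneg χ.nonneg]
    exact χ.le_one
  obtain ⟨Z, Y, hZ, hY, hZs, hYs, hpar⟩ := exists_scaled_parametrix hn hϱ hχ hχ1
  rw [χ.tsupport_eq] at hZs hYs
  have hθ := hη.multiDeriv α
  set θ := iteratedPartial α η
  rw [integral_convolution_rbf_mul hn hm hq hqM ϱ hθ.isBoundedlySupported]
  have hcast : Tendsto (fun k : ℕ => (k + 1 : ℝ)) atTop atTop :=
    tendsto_atTop_add_const_right _ _ tendsto_natCast_atTop_atTop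
  have l1 := (tendsto_integral_mul_convolution_dilatedError hn hg hZ hY hZs hYs hη).comp hcast
  have l2 := tendsto_integral_mul_convolution_cutoff hn hm hq hqM ϱ hχ hχ1 hχb hθ
  have l3 := l2.add (l1.const_mul ((-1) ^ ∑ i, α i))
  rw [mul_zero, add_zero] at l3
  refine tendsto_nhds_unique tendsto_const_nhds (l3.congr fun k => ?_)
  have hR : (0 : ℝ) < k + 1 := by positivity
  simp only [Function.comp_apply]
  generalize (k + 1 : ℝ) = R at hR
  have hχR : IsTestFunction univ fun y : E n => χ (R⁻¹ • y) := by
    simpa using hχ.comp_affine 0 (inv_ne_zero hR.ne')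
  set A : E n → ℝ := fun y => χ (R⁻¹ • y) * (ϱ * rbf n m y)
  have hA : LocallyIntegrable A := (hϱ.1.integrable_smul_left_of_hasCompactSupport
    hχR.1.continuous hχR.2).locallyIntegrable
  have hAc : HasCompactSupport A := hχR.2.mul_right
  have hW := hZ.dilatedError hY hR
  have hWl : LocallyIntegrable (dilatedError Z Y R) := hW.1.continuous.locallyIntegrable
  have hWη := IsTestFunction.convolution hWl hW.2 hη
  have hG := IsTestFunction.convolution hA hAc hθ
  have h1 := hD.2 _ hG
  have h2 : polyLaplacian m (A ⋆[ContinuousLinearMap.mul ℝ ℝ] θ) = fun x =>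
      θ x - iteratedPartial α (dilatedError Z Y R ⋆[ContinuousLinearMap.mul ℝ ℝ] η) x := by
    rw [polyLaplacian_convolution m hA hθ, iteratedPartial_convolution α hWl hη]
    funext x
    have h3 := hpar R hR _ (hθ.comp_affine x (c := -1) (by norm_num))
    rw [polyLaplacian_comp_affine m hθ.1] at h3
    have h4 : ((-1 : ℝ)) ^ (2 * m) = 1 := by simp
    simp only [h4, one_mul, neg_smul, one_smul, smul_zero, add_zero,
      ← sub_eq_add_neg] at h3
    exact h3
  rw [← h1, h2]
  simp only [mul_sub]
  rw [integral_sub (hθ.integrable_mul hD.1) ((hWη.multiDeriv α).integrable_mul hD.1),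
    hDg.2 _ hWη]
  ring

/-- A solution in the Beppo-Levi space is the convolution with the fundamental solution up to a
polynomial of degree less than `m`. -/
theorem IsWeakSolution.exists_polyFun (hn : 1 ≤ n) {m : ℕ} (hm : 1 ≤ m) {q D : E n → ℝ}
    (hq : AEStronglyMeasurable q) (hqM : Integrable fun y => momentWeight n m y * |q y|) {ϱ : ℝ}
    (hϱ : IsFundamentalSolution m fun x : E n => ϱ * rbf n m x)
    (hD : IsWeakSolution m univ D q) (hBL : MemBeppoLevi m univ D) :
    ∃ P : MvPolynomial (Fin n) ℝ, P.totalDegree ≤ m - 1 ∧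
      ∀ᵐ x, D x = (q ⋆[ContinuousLinearMap.mul ℝ ℝ] fun y => ϱ * rbf n m y) x + polyFun P x := by
  set N := q ⋆[ContinuousLinearMap.mul ℝ ℝ] fun y => ϱ * rbf n m y with hN
  have hNl : LocallyIntegrableOn N univ :=
    (locallyIntegrable_convolution_rbf hn hm hq hqM ϱ).locallyIntegrableOn _
  obtain ⟨P, hP, h⟩ := exists_polyFun_ae_eq hm isOpen_univ convex_univ (u := fun x => D x - N x)
    (hBL.1.sub hNl) fun α hα η hη => by
      obtain ⟨g, hg, hg2⟩ := hBL.2 α hα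
      rw [Measure.restrict_univ] at hg2
      have hη' := hη.multiDeriv α
      simp only [sub_mul]
      rw [integral_sub (hη'.integrable_mul hBL.1) (hη'.integrable_mul hNl),
        hD.integral_mul_iteratedPartial hn hm hq hqM hϱ hg hg2 hη, sub_self]
  refine ⟨P, hP, ?_⟩
  filter_upwards [h] with x hx
  rw [← hx (mem_univ x)]
  ring

/-! ### Solutions that are classically differentiable -/

theorem continuous_polyLaplacian (m : ℕ) {u : E n → ℝ}
    (hu : ContDiff ℝ ((2 * m : ℕ) : WithTop ℕ∞) u) : Continuous (polyLaplacian m u) := by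
  induction m generalizing u with
  | zero => exact hu.continuous
  | succ k ih => exact ih (contDiff_laplacian hu)

/-- Locally, a solution of class `C^{2m}` can be replaced by its product with a cutoff function,
which is of class `C^{2m}` on the whole space. -/
theorem IsWeakSolution.exists_ball {m : ℕ} {X : Set (E n)} (hX : IsOpen X) {D q : E n → ℝ}
    (hq : LocallyIntegrable q) (hD : IsWeakSolution m X D q)
    (hDc : ContDiffOn ℝ ((2 * m : ℕ) : WithTop ℕ∞) D X) {x : E n} (hx : x ∈ X) :
    ∃ r > 0, ContinuousAt (polyLaplacian m D) x ∧
      ∀ᵐ y, y ∈ Metric.ball x r → polyLaplacian m D y = q y := by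
  obtain ⟨ε, hε, hεX⟩ := Metric.isOpen_iff.1 hX x hx
  let χ : ContDiffBump x := ⟨ε / 3, ε / 2, by positivity, by linarith⟩
  have hχX : tsupport χ ⊆ X := by
    rw [χ.tsupport_eq]
    exact (Metric.closedBall_subset_ball (by change ε / 2 < ε; linarith)).trans hεX
  have hu : ContDiff ℝ ((2 * m : ℕ) : WithTop ℕ∞) fun y => χ y * D y := by
    refine contDiff_iff_contDiffAt.2 fun y => ?_
    by_cases hy : y ∈ tsupport χ
    · exact χ.contDiffAt.mul (hDc.contDiffAt (hX.mem_nhds (hχX hy)))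
    · refine (contDiffAt_const (c := (0 : ℝ))).congr_of_eventuallyEq ?_
      filter_upwards [(isClosed_tsupport χ).isOpen_compl.mem_nhds hy] with z hz
      rw [image_eq_zero_of_notMem_tsupport hz, zero_mul]
  have hball : Metric.ball x (ε / 3) ⊆ X :=
    (Metric.ball_subset_ball (by linarith)).trans hεX
  have hloc : ∀ y ∈ Metric.ball x (ε / 3), (fun y => χ y * D y) =ᶠ[𝓝 y] D := by
    intro y hy
    filter_upwards [Metric.isOpen_ball.mem_nhds hy] with z hz
    rw [χ.one_of_mem_closedBall (Metric.ball_subset_closedBall hz), one_mul]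
  have hΔ : ∀ y ∈ Metric.ball x (ε / 3),
      polyLaplacian m (fun y => χ y * D y) =ᶠ[𝓝 y] polyLaplacian m D :=
    fun y hy => polyLaplacian_congr_nhds m (hloc y hy)
  have hcont := continuous_polyLaplacian m hu
  refine ⟨ε / 3, by positivity,
    hcont.continuousAt.congr (hΔ x (Metric.mem_ball_self (by positivity))), ?_⟩
  have h := ae_eq_of_forall_integral_mul_eq Metric.isOpen_ball
    (hcont.locallyIntegrable.locallyIntegrableOn (Metric.ball x (ε / 3)))
    (hq.locallyIntegrableOn _) fun η hη => by
      rw [← integral_mul_polyLaplacian m hu hη.1 hη.2,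
        ← hD.2 η ⟨hη.1, hη.2, hη.3.trans hball⟩]
      exact (hη.polyLap m).integral_mul_congr (ae_of_all _ fun y hy => (hloc y hy).eq_of_nhds)
  filter_upwards [h] with y hy hyB
  rw [← hy hyB, (hΔ y hyB).eq_of_nhds]

theorem IsWeakSolution.polyLaplacian_eq_ae {m : ℕ} {X : Set (E n)} (hX : IsOpen X)
    {D q : E n → ℝ} (hq : LocallyIntegrable q) (hD : IsWeakSolution m X D q)
    (hDc : ContDiffOn ℝ ((2 * m : ℕ) : WithTop ℕ∞) D X) :
    ∀ᵐ x, x ∈ X → polyLaplacian m D x = q x := by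
  rw [ae_iff]
  refine measure_null_of_locally_null _ fun x hx => ?_
  have hxX : x ∈ X := by
    by_contra h
    exact hx fun h' => absurd h' h
  obtain ⟨r, hr, -, h⟩ := hD.exists_ball hX hq hDc hxX
  refine ⟨_ ∩ Metric.ball x r, inter_mem_nhdsWithin _ (Metric.ball_mem_nhds x hr),
    measure_mono_null ?_ (ae_iff.1 h)⟩
  rintro y ⟨hy, hyB⟩ hy'
  exact hy fun _ => hy' hyB

theorem IsWeakSolution.polyLaplacian_eq_of_continuousAt {m : ℕ} {X : Set (E n)} (hX : IsOpen X)
    {D q : E n → ℝ} (hq : LocallyIntegrable q) (hD : IsWeakSolution m X D q)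
    (hDc : ContDiffOn ℝ ((2 * m : ℕ) : WithTop ℕ∞) D X) {x : E n} (hx : x ∈ X)
    (hqx : ContinuousAt q x) : polyLaplacian m D x = q x := by
  obtain ⟨r, hr, hc, h⟩ := hD.exists_ball hX hq hDc hx
  by_contra hne
  have h1 := (hc.sub hqx).eventually_ne (sub_ne_zero.2 hne)
  obtain ⟨y, hy, hyB⟩ := (Measure.dense_of_ae h).inter_nhds_nonempty
    (inter_mem h1 (Metric.ball_mem_nhds x hr))
  exact hyB.1 (sub_eq_zero.2 (hy hyB.2))

/-! ### The solutions on the whole space -/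

theorem integrable_pdeRhs (m : ℕ) (lam : ℝ) {pg pd : E n → ℝ} (hg : IsDensity pg)
    (hd : IsDensity pd) : Integrable (pdeRhs m lam pg pd) :=
  (hg.1.sub hd.1).const_mul _

/-- The moment hypotheses on the densities, in the form that the convolution lemmas use. -/
theorem integrable_momentWeight_mul_sub {m : ℕ} {pg pd : E n → ℝ} (hg : IsDensity pg)
    (hd : IsDensity pd) (hgm : HasRbfMoment m pg) (hdm : HasRbfMoment m pd) :
    Integrable fun y => momentWeight n m y * |pg y - pd y| := by
  have hi : Integrable fun y => pg y - pd y := hg.1.sub hd.1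
  have hm : HasRbfMoment m fun y => pg y - pd y :=
    (hgm.sub hdm).congr (ae_of_all _ fun y => (mul_sub _ _ _).symm)
  exact integrable_momentWeight_mul hi hm

theorem integrable_momentWeight_mul_pdeRhs {m : ℕ} (lam : ℝ) {pg pd : E n → ℝ} (hg : IsDensity pg)
    (hd : IsDensity pd) (hgm : HasRbfMoment m pg) (hdm : HasRbfMoment m pd) :
    Integrable fun y => momentWeight n m y * |pdeRhs m lam pg pd y| := by
  refine ((integrable_momentWeight_mul_sub hg hd hgm hdm).const_mul
    |(-1) ^ (m + 1) / (2 * lam)|).congr (ae_of_all _ fun y => ?_)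
  simp only [pdeRhs, abs_mul]
  ring

theorem particularSolution_eq_convolution (m : ℕ) (lam ϱ : ℝ) (pg pd : E n → ℝ) :
    particularSolution m lam ϱ pg pd =
      pdeRhs m lam pg pd ⋆[ContinuousLinearMap.mul ℝ ℝ] fun y => ϱ * rbf n m y := by
  funext x
  simp only [particularSolution, convolution_def, ContinuousLinearMap.mul_apply', pdeRhs]
  rw [← integral_const_mul]
  simp only [mul_assoc]

theorem polyLaplacian_polyFun_eq_zero {m : ℕ} (hm : 1 ≤ m) {P : MvPolynomial (Fin n) ℝ}
    (hP : P.totalDegree ≤ m - 1) : polyLaplacian m (polyFun P) = 0 := by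
  funext x
  rw [polyLaplacian_eq_sum m (smooth_polyFun P)]
  refine Finset.sum_eq_zero fun α hα => ?_
  have hα' := mem_piAntidiag_univ.1 hα
  have h0 : iteratedPartial α (polyFun P) = polyFun 0 := by
    rw [iteratedPartial_polyFun_eq_zero (by omega)]
    funext y
    simp [polyFun]
  rw [h0, iteratedPartial_polyFun_eq_zero (by rw [MvPolynomial.totalDegree_zero]; omega)]
  exact mul_zero _

theorem IsWeakSolution.add_polyFun {m : ℕ} (hm : 1 ≤ m) {X : Set (E n)} {D q : E n → ℝ}
    (hD : IsWeakSolution m X D q) {P : MvPolynomial (Fin n) ℝ} (hP : P.totalDegree ≤ m - 1) :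
    IsWeakSolution m X (fun x => D x + polyFun P x) q where
  locallyIntegrable :=
    hD.1.add ((smooth_polyFun P).continuous.locallyIntegrable.locallyIntegrableOn X)
  integral_eq η hη := by
    have hP' := smooth_polyFun P
    have h := integral_mul_polyLaplacian m (hP'.of_le (WithTop.coe_le_coe.2 le_top)) hη.1 hη.2
    rw [polyLaplacian_polyFun_eq_zero hm hP] at h
    simp only [add_mul]
    rw [integral_add ((hη.polyLap m).integrable_mul hD.1) ((hη.polyLap m).integrable_mul
      (hP'.continuous.locallyIntegrable.locallyIntegrableOn X)), hD.2 η hη, h]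
    simp

theorem IsWeakSolution.congr {m : ℕ} {X : Set (E n)} (hX : IsOpen X) {D D' q : E n → ℝ}
    (hD : IsWeakSolution m X D q) (h : ∀ᵐ x, x ∈ X → D x = D' x) : IsWeakSolution m X D' q where
  locallyIntegrable := LocallyIntegrableOn.congr_ae_on hX hD.1 h
  integral_eq η hη := by
    rw [← hD.2 η hη]
    exact ((hη.polyLap m).integral_mul_congr h).symm

theorem totalDegree_sub_le {k : ℕ} {P Q : MvPolynomial (Fin n) ℝ} (hP : P.totalDegree ≤ k)
    (hQ : Q.totalDegree ≤ k) : (P - Q).totalDegree ≤ k :=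
  (MvPolynomial.totalDegree_sub P Q).trans (max_le hP hQ)

end

end PolyWGAN

theorem theorem2 (n m : ℕ) (hn : 1 ≤ n) (hm : 1 ≤ m) :
    -- the constant depends on the dimension `n` and on the order `m` only
    ∃ ϱ : ℝ, ϱ ≠ 0 ∧ IsFundamentalSolution m (fun x : E n => ϱ * rbf n m x) ∧
    ∀ (lam : ℝ) (pg pd : E n → ℝ), lam ≠ 0 → IsDensity pg → IsDensity pd →
      HasRbfMoment m pg → HasRbfMoment m pd →
      -- an optimal discriminator on `X` solves the polyharmonic equation on `X`
      (∀ X : Set (E n), IsCarrier pg pd X → ∀ D : E n → ℝ, IsOptimal m lam pg pd X D →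
        IsWeakSolution m X D (pdeRhs m lam pg pd)) ∧
      -- a solution with `2m` continuous derivatives solves the equation pointwise
      (∀ (X : Set (E n)) (D : E n → ℝ), IsOpen X →
        IsWeakSolution m X D (pdeRhs m lam pg pd) →
        ContDiffOn ℝ ((2 * m : ℕ) : WithTop ℕ∞) D X →
        (∀ᵐ x, x ∈ X → polyLaplacian m D x = pdeRhs m lam pg pd x) ∧
        ∀ x ∈ X, ContinuousAt (fun y => pg y - pd y) x →
          polyLaplacian m D x = pdeRhs m lam pg pd x) ∧
      -- the particular solution is well defined and solves the equation on all of `ℝⁿ`,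
      -- also after adding any polynomial of degree at most `m - 1`
      (∀ᵐ x, ConvolutionExistsAt (fun y => pg y - pd y) (fun y => ϱ * rbf n m y) x
        (ContinuousLinearMap.mul ℝ ℝ) volume) ∧
      IsWeakSolution m univ (particularSolution m lam ϱ pg pd) (pdeRhs m lam pg pd) ∧
      (∀ P : MvPolynomial (Fin n) ℝ, P.totalDegree ≤ m - 1 →
        IsWeakSolution m univ (fun x => particularSolution m lam ϱ pg pd x + polyFun P x)
          (pdeRhs m lam pg pd)) ∧
      -- the general solution in the Beppo-Levi space on `ℝⁿ`, if it has a solution at all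
      (∀ D₀ : E n → ℝ, MemBeppoLevi m univ D₀ → IsWeakSolution m univ D₀ (pdeRhs m lam pg pd) →
        ∀ D : E n → ℝ,
          (MemBeppoLevi m univ D ∧ IsWeakSolution m univ D (pdeRhs m lam pg pd)) ↔
            ∃ P : MvPolynomial (Fin n) ℝ, P.totalDegree ≤ m - 1 ∧
              ∀ᵐ x, D x = particularSolution m lam ϱ pg pd x + polyFun P x) ∧
      -- the general optimal discriminator on `ℝⁿ`, if there is one
      (∀ D₀ : E n → ℝ, IsOptimal m lam pg pd univ D₀ →
        ∀ D : E n → ℝ, IsOptimal m lam pg pd univ D ↔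
          IsAdmissible m pg pd univ D ∧
            ∃ P : MvPolynomial (Fin n) ℝ, P.totalDegree ≤ m - 1 ∧
              ∀ᵐ x, D x = particularSolution m lam ϱ pg pd x + polyFun P x) ∧
      -- on every `X`, the optimal discriminators differ by polynomials of degree at most `m - 1`
      (∀ X : Set (E n), IsCarrier pg pd X → ∀ D₀ : E n → ℝ, IsOptimal m lam pg pd X D₀ →
        ∀ D : E n → ℝ, IsOptimal m lam pg pd X D ↔
          IsAdmissible m pg pd X D ∧
            ∃ P : MvPolynomial (Fin n) ℝ, P.totalDegree ≤ m - 1 ∧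
              ∀ᵐ x, x ∈ X → D x = D₀ x + polyFun P x) := by
  obtain ⟨ϱ, hϱ0, hϱ⟩ := exists_isFundamentalSolution_rbf (n := n) hn hm
  refine ⟨ϱ, hϱ0, hϱ, fun lam pg pd hlam hg hd hgm hdm => ?_⟩
  have hqi := integrable_pdeRhs m lam hg hd
  have hq := hqi.aestronglyMeasurable
  have hqM := integrable_momentWeight_mul_pdeRhs lam hg hd hgm hdm
  have hpart : IsWeakSolution m univ (particularSolution m lam ϱ pg pd) (pdeRhs m lam pg pd) := by
    rw [particularSolution_eq_convolution]
    exact isWeakSolution_convolution hn hm hq hqM hϱ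
  have hgen : ∀ D : E n → ℝ, MemBeppoLevi m univ D → IsWeakSolution m univ D (pdeRhs m lam pg pd) →
      ∃ P : MvPolynomial (Fin n) ℝ, P.totalDegree ≤ m - 1 ∧
        ∀ᵐ x, D x = particularSolution m lam ϱ pg pd x + polyFun P x := by
    rw [particularSolution_eq_convolution]
    exact fun D hBL hD => hD.exists_polyFun hn hm hq hqM hϱ hBL
  refine ⟨fun X hX D hD => hD.isWeakSolution hlam hg hd hX.isOpen, fun X D hX hD hDc => ⟨?_, ?_⟩,
    ?_, hpart, fun P hP => hpart.add_polyFun hm hP, fun D₀ hBL₀ hD₀ D => ⟨?_, ?_⟩,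
    fun D₀ hD₀ D => ?_, fun X hX D₀ hD₀ D => hD₀.isOptimal_iff hm hlam hX D⟩
  · exact hD.polyLaplacian_eq_ae hX hqi.locallyIntegrable hDc
  · exact fun x hx hc => hD.polyLaplacian_eq_of_continuousAt hX hqi.locallyIntegrable hDc hx
      (hc.const_mul _)
  · exact convolutionExistsAt_ae hn hm (hg.1.sub hd.1).aestronglyMeasurable
      (integrable_momentWeight_mul_sub hg hd hgm hdm) ϱ
  · exact fun h => hgen D h.1 h.2
  · rintro ⟨P, hP, h⟩
    obtain ⟨P₀, hP₀, h₀⟩ := hgen D₀ hBL₀ hD₀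
    refine ⟨((hBL₀.add_smul (memBeppoLevi_polyFun hm univ (totalDegree_sub_le hP hP₀)) 1).congr
      isOpen_univ ?_), (hpart.add_polyFun hm hP).congr isOpen_univ ?_⟩
    · filter_upwards [h, h₀] with x hx hx₀ _
      rw [hx, hx₀, polyFun_sub, Pi.sub_apply]
      ring
    · filter_upwards [h] with x hx _ using hx.symm
  · have huniv : IsCarrier pg pd univ :=
      ⟨isOpen_univ, convex_univ, ae_of_all _ fun x hx => absurd (mem_univ x) hx⟩
    obtain ⟨P₀, hP₀, h₀⟩ := hgen D₀ hD₀.1.1 (hD₀.isWeakSolution hlam hg hd isOpen_univ)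
    refine (hD₀.isOptimal_iff hm hlam huniv D).trans (and_congr_right fun _ => ⟨?_, ?_⟩)
    · rintro ⟨P, hP, h⟩
      refine ⟨P + P₀, (MvPolynomial.totalDegree_add P P₀).trans (max_le hP hP₀), ?_⟩
      filter_upwards [h, h₀] with x hx hx₀
      rw [hx (mem_univ x), hx₀, polyFun_add, Pi.add_apply]
      ring
    · rintro ⟨P, hP, h⟩
      refine ⟨P - P₀, totalDegree_sub_le hP hP₀, ?_⟩
      filter_upwards [h, h₀] with x hx hx₀ _
      rw [hx, hx₀, polyFun_sub, Pi.sub_apply]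
      ring
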